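/- Let $\delta>0$ be a constant. In the model of massively parallel computation (MPC) there are $\mathcal M$ machines, each with a local memory of $\mathcal S$ words of $O(\log n)$ bits. Computation proceeds in synchronous rounds: in a round every machine performs an arbitrary local computation on the contents of its memory and then sends words to machines that it specifies; all words sent by a machine in a round, and all words that it retains together with those it receives, must fit into its local space $\mathcal S$. The global space is $\mathcal S_{\mathcal G}=\mathcal S\cdot\mathcal M$. Let $b$ and $n\ge 1$ be integers with $\log^{10} n\le b\le n$, and let $S_1,\dots,S_n\subseteq\{1,\dots,n\}$ be sets with $|S_i|=b$ and $i\in S_i$ for every $i$, given as the list of all pairs $(i,j)$ with $j\in S_i$, distributed arbitrarily among the machines. Then one can deterministically find a set $\mathcal L\subseteq\{1,\dots,n\}$ with $$|\mathcal L|\le O\bigl(n\cdot(\min\{b,\mathcal S\})^{-1/5}\bigr)$$ and $S_i\cap\mathcal L\neq\emptyset$ for every $i\in\{1,\dots,n\}$, in a constant number of MPC rounds with local space $\mathcal S=O(n^\delta)$ and global space $\mathcal S_{\mathcal G}=O(nb)$. More precisely: there is a constant $C_0>0$, depending only on $\delta$, such that for every constant $C_1$ there is a single deterministic algorithm which does this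 on every MPC with $C_0n^\delta\le\mathcal S\le C_1n^\delta$ and $C_0nb\le\mathcal S\cdot\mathcal M\le C_1nb$; the number of rounds, the constant in the word length and the constant in the bound on $|\mathcal L|$ depend only on $\delta$ and $C_1$. At the end the elements of $\mathcal L$ are stored in the memories of the machines, each element exactly once. -/

import Mathlib

namespace MPC

/-- A deterministic algorithm for massively parallel computation (one program for all machines, all
rounds and all input sizes).  `step (params, id, r, mem)` is the local computation which the machine
with address `id` performs in round `r` when its memory holds the words `mem`; `params` lists the
globally known parameters (input size, number of machines, local space).  The result is the pair
consisting of the words that the machine retains and of the list of the messages that it sends, one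
entry `(destination, word)` for every word sent.  Local computation is unrestricted, except that it
has to be a computation. -/
structure Algorithm where
  step : List ℕ × ℕ × ℕ × List ℕ → List ℕ × List (ℕ × ℕ)
  computable : Computable step

/-- The contents of the memories of `M` machines with addresses `0, …, M - 1`. -/
abbrev Config (M : ℕ) : Type := Fin M → List ℕ

/-- The words that a machine in configuration `c` retains in round `r`. -/
def Algorithm.retained (A : Algorithm) (params : List ℕ) {M : ℕ} (r : ℕ) (c : Config M)
    (m : Fin M) : List ℕ :=
  (A.step (params, (m : ℕ), r, c m)).1

/-- The messages that a machine in configuration `c` sends in round `r`. -/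
def Algorithm.sent (A : Algorithm) (params : List ℕ) {M : ℕ} (r : ℕ) (c : Config M)
    (m : Fin M) : List (ℕ × ℕ) :=
  (A.step (params, (m : ℕ), r, c m)).2

/-- The words that machine `m` receives at the end of round `r`, ordered by their senders. -/
def Algorithm.received (A : Algorithm) (params : List ℕ) {M : ℕ} (r : ℕ) (c : Config M)
    (m : Fin M) : List ℕ :=
  (List.finRange M).flatMap fun m' =>
    ((A.sent params r c m').filter fun msg => msg.1 = (m : ℕ)).map Prod.snd

/-- The configuration after `r` synchronous rounds started from `init`.  After a round, the memory
of a machine holds what the machine has retained followed by what it has received. -/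
def Algorithm.run (A : Algorithm) (params : List ℕ) {M : ℕ} (init : Config M) : ℕ → Config M
  | 0 => init
  | r + 1 => fun m =>
      A.retained params r (A.run params init r) m ++ A.received params r (A.run params init r) m

/-- The execution of `A` from `init` for `R` rounds is legal on machines with `S` words of local
memory each, a word being a natural number below `B`: at all times the memory of every machine
(retained and received words together) consists of at most `S` words, and in every round every
machine sends at most `S` words, to existing machines only. -/
def Algorithm.Respects (A : Algorithm) (params : List ℕ) {M : ℕ} (init : Config M)
    (S B R : ℕ) : Prop :=
  (∀ r ≤ R, ∀ m, (A.run params init r m).length ≤ S ∧ ∀ w ∈ A.run params init r m, w < B) ∧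
  (∀ r < R, ∀ m, (A.sent params r (A.run params init r) m).length ≤ S ∧
    ∀ msg ∈ A.sent params r (A.run params init r) m, msg.1 < M)

end MPC

namespace Leaders

/-- The lists `inp m` of pairs, one list for each machine `m`, are a distribution of the family of
sets `F` among the machines: together they list every pair `(i, j)` with `j ∈ F i` exactly once, and
no other pair. -/
def IsDistribution {n M : ℕ} (F : Fin n → Finset (Fin n)) (inp : Fin M → List (Fin n × Fin n)) :
    Prop :=
  ∑ m, (inp m : Multiset (Fin n × Fin n)) =
    (Finset.univ.filter fun p : Fin n × Fin n => p.2 ∈ F p.1).val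

/-- A list of pairs `(i, j)` as it is stored in memory, two words for a pair. -/
def encode {n : ℕ} (l : List (Fin n × Fin n)) : List ℕ :=
  l.flatMap fun p => [(p.1 : ℕ), (p.2 : ℕ)]

/-- The memories of the machines together hold every element of `L` exactly once, and nothing
else. -/
def Outputs {n M : ℕ} (c : MPC.Config M) (L : Finset (Fin n)) : Prop :=
  ∑ m, (c m : Multiset ℕ) = L.val.map Fin.val

end Leaders

/-! Put `d = ⌊(min b S)^(1/5)⌋` and `u = ⌊S^(1/8)⌋`, and cut the numbers below `n` into blocks of
`d` consecutive numbers. A set with at most one element in every block has at most `n/d + 1`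
elements, so a union of a constant number `D` of such sets is small enough. The task is to choose
`D` of them that together hit every `S_i`.

The candidates come from one family of `q = d² u` such sets with the property that every set of `d²`
numbers is missed by at most `d²` members (`exists_family`). It exists by the probabilistic method:
a random member misses a given set with probability at most `exp(-d)` (`card_avoiding_le`), the
number of misses has a bounded exponential moment with base `exp(d/2)` because `q ≤ exp(d/2)`, and a
union bound over at most `n^(d²)` sets succeeds because `d > 2 log n + 2`. The lower bound on `b`
and the size of `S` make `d` this large. The family depends on the global parameters only, so every
machine finds the same one by exhaustive search, without communication (`family_spec`).

The choice is greedy. Every `S_i` is cut down to `d²` elements, all on one machine. On average a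
member of the family misses at most the share `d²/q = 1/u` of the sets not yet hit, and the best
member does no worse (`exec_phase`). As `u^D > n`, no set is left after `D` phases (`exec_hitSets`).

All communication beyond routing single words is one primitive: prefix sums of vectors of length `q`
over all machines, along a tree of degree `u` and depth `D` (`exec_scan`). It finds the best member,
and it drives the radix sort in base `q` that brings the elements of every `S_i` together
(`exec_radixSort`). A machine needs about `u q = d² u² ≤ S^(2/5 + 1/4)` words for it, which is of
lower order than `S`. Since `u ≥ n^(δ/16)`, the constant depth `D ≥ 64/δ` suffices. For the finitely
many small `n` the set of all numbers is output. -/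

namespace Primrec

/-! ### Primitive recursion as a `fun_prop` calculus, used for the computability of all local steps.
-/

variable {α β γ σ : Type*} [Primcodable α] [Primcodable β] [Primcodable γ] [Primcodable σ]

attribute [fun_prop] Primrec

attribute [fun_prop] Primrec.id Primrec.const Primrec.comp Primrec.fst Primrec.snd Primrec.pair

@[fun_prop] theorem fst' {f : α → β × γ} (hf : Primrec f) : Primrec fun a => (f a).1 := fst.comp hf
@[fun_prop] theorem snd' {f : α → β × γ} (hf : Primrec f) : Primrec fun a => (f a).2 := snd.comp hf

section Nat
variable {f g : α → ℕ}

@[fun_prop] theorem add' (hf : Primrec f) (hg : Primrec g) : Primrec fun a => f a + g a :=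
  nat_add.comp hf hg
@[fun_prop] theorem sub' (hf : Primrec f) (hg : Primrec g) : Primrec fun a => f a - g a :=
  nat_sub.comp hf hg
@[fun_prop] theorem mul' (hf : Primrec f) (hg : Primrec g) : Primrec fun a => f a * g a :=
  nat_mul.comp hf hg
@[fun_prop] theorem div' (hf : Primrec f) (hg : Primrec g) : Primrec fun a => f a / g a :=
  nat_div.comp hf hg
@[fun_prop] theorem mod' (hf : Primrec f) (hg : Primrec g) : Primrec fun a => f a % g a :=
  nat_mod.comp hf hg
@[fun_prop] theorem min' (hf : Primrec f) (hg : Primrec g) : Primrec fun a => min (f a) (g a) :=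
  nat_min.comp hf hg
@[fun_prop] theorem natPair' (hf : Primrec f) (hg : Primrec g) :
    Primrec fun a => Nat.pair (f a) (g a) := Primrec₂.natPair.comp hf hg
@[fun_prop] theorem unpair' (hf : Primrec f) : Primrec fun a => Nat.unpair (f a) :=
  unpair.comp hf
@[fun_prop] theorem sqrt' (hf : Primrec f) : Primrec fun a => Nat.sqrt (f a) :=
  nat_sqrt.comp hf
@[fun_prop] theorem pow' (hf : Primrec f) (hg : Primrec g) : Primrec fun a => f a ^ g a :=
  (Primrec₂.unpaired'.1 Nat.Primrec.pow).comp hf hg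
@[fun_prop] theorem decide_lt (hf : Primrec f) (hg : Primrec g) :
    Primrec fun a => decide (f a < g a) := (nat_lt.decide).comp hf hg
@[fun_prop] theorem decide_le (hf : Primrec f) (hg : Primrec g) :
    Primrec fun a => decide (f a ≤ g a) := (nat_le.decide).comp hf hg
@[fun_prop] theorem decide_eq (hf : Primrec f) (hg : Primrec g) :
    Primrec fun a => decide (f a = g a) := ((Primrec.eq (α := ℕ)).decide).comp hf hg
end Nat

@[fun_prop] theorem and' {f g : α → Bool} (hf : Primrec f) (hg : Primrec g) :
    Primrec fun a => f a && g a := Primrec.and.comp hf hg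
@[fun_prop] theorem or' {f g : α → Bool} (hf : Primrec f) (hg : Primrec g) :
    Primrec fun a => f a || g a := Primrec.or.comp hf hg
@[fun_prop] theorem not' {f : α → Bool} (hf : Primrec f) :
    Primrec fun a => !(f a) := Primrec.not.comp hf
@[fun_prop] theorem cond' {c : α → Bool} {f g : α → σ} (hc : Primrec c) (hf : Primrec f)
    (hg : Primrec g) : Primrec fun a => bif c a then f a else g a := Primrec.cond hc hf hg

@[fun_prop] theorem range' {f : α → ℕ} (hf : Primrec f) : Primrec fun a => List.range (f a) :=
  list_range.comp hf
@[fun_prop] theorem getD' {f : α → List σ} {g : α → ℕ} (d : σ) (hf : Primrec f) (hg : Primrec g) :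
    Primrec fun a => (f a).getD (g a) d := (list_getD d).comp hf hg
@[fun_prop] theorem append' {f g : α → List σ} (hf : Primrec f) (hg : Primrec g) :
    Primrec fun a => f a ++ g a := list_append.comp hf hg
@[fun_prop] theorem length' {f : α → List σ} (hf : Primrec f) :
    Primrec fun a => (f a).length := list_length.comp hf
@[fun_prop] theorem map' {f : α → List β} {g : α → β → σ} (hf : Primrec f)
    (hg : Primrec fun x : α × β => g x.1 x.2) : Primrec fun a => (f a).map (g a) :=
  list_map hf hg
@[fun_prop] theorem filter' {f : α → List β} {g : α → β → Bool} (hf : Primrec f)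
    (hg : Primrec fun x : α × β => g x.1 x.2) : Primrec fun a => (f a).filter (g a) := by
  have h : Primrec fun a => (f a).flatMap fun b => bif g a b then [b] else [] :=
    list_flatMap hf (Primrec.cond hg (list_cons.comp snd (const [])) (const []))
  refine h.of_eq fun a => ?_
  induction f a with
  | nil => rfl
  | cons b l ih => cases hb : g a b <;> simp [hb, ← ih]
@[fun_prop] theorem all' {f : α → List β} {g : α → β → Bool} (hf : Primrec f)
    (hg : Primrec fun x : α × β => g x.1 x.2) : Primrec fun a => (f a).all (g a) := by
  have h : Primrec fun a => (f a).foldr (fun b r => g a b && r) true :=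
    list_foldr hf (const true)
      (Primrec.and.comp (hg.comp (Primrec.pair fst (fst.comp snd))) (snd.comp snd)).to₂
  refine h.of_eq fun a => ?_
  induction f a with
  | nil => rfl
  | cons b l ih => simp [ih]
@[fun_prop] theorem any' {f : α → List β} {g : α → β → Bool} (hf : Primrec f)
    (hg : Primrec fun x : α × β => g x.1 x.2) : Primrec fun a => (f a).any (g a) := by
  have h : Primrec fun a => !((f a).all fun b => !(g a b)) :=
    Primrec.not.comp (all' hf (Primrec.not.comp hg))
  refine h.of_eq fun a => ?_
  rw [List.not_all_eq_any_not]
  simp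
@[fun_prop] theorem sum' {f : α → List ℕ} (hf : Primrec f) : Primrec fun a => (f a).sum := by
  have h : Primrec fun a => (f a).foldr (fun b r => b + r) 0 :=
    list_foldr hf (const 0) (nat_add.comp (fst.comp snd) (snd.comp snd)).to₂
  exact h.of_eq fun a => by simp [List.sum]
@[fun_prop] theorem findGreatest' {f : α → ℕ} {g : α → ℕ → Bool} (hf : Primrec f)
    (hg : Primrec fun x : α × ℕ => g x.1 x.2) :
    Primrec fun a => Nat.findGreatest (fun k => g a k = true) (f a) := by
  refine nat_findGreatest hf ?_
  refine Primrec₂.primrecRel (hg.of_eq fun x => ?_)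
  simp

end Primrec

/-! ### Programs as lists of rounds, and their legal executions. -/

namespace MPC

/-- A local computation of one round: from the parameters, the address and the memory to the
retained words and the messages. -/
abbrev Local : Type := List ℕ × ℕ × List ℕ → List ℕ × List (ℕ × ℕ)

/-- The step function which performs a list of local computations one after the other. -/
def progStep : List Local → List ℕ × ℕ × ℕ × List ℕ → List ℕ × List (ℕ × ℕ)
  | [], x => (x.2.2.2, [])
  | f :: fs, x => bif decide (x.2.2.1 = 0) then f (x.1, x.2.1, x.2.2.2)
      else progStep fs (x.1, x.2.1, x.2.2.1 - 1, x.2.2.2)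

theorem primrec_progStep (fs : List Local) (h : ∀ f ∈ fs, Primrec f) : Primrec (progStep fs) := by
  induction fs with
  | nil =>
    have : progStep [] = fun x => (x.2.2.2, []) := funext fun _ => rfl
    rw [this]; fun_prop
  | cons f fs ih =>
    have h1 : Primrec f := h f (by simp)
    have h2 := ih fun g hg => h g (by simp [hg])
    have : progStep (f :: fs) = fun x => bif decide (x.2.2.1 = 0) then f (x.1, x.2.1, x.2.2.2)
      else progStep fs (x.1, x.2.1, x.2.2.1 - 1, x.2.2.2) := funext fun _ => rfl
    rw [this]
    exact Primrec.cond' (by fun_prop) (h1.comp (by fun_prop)) (h2.comp (by fun_prop))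

/-- The algorithm which performs a list of local computations one after the other. -/
def ofList (fs : List Local) (h : ∀ f ∈ fs, Primrec f) : Algorithm :=
  ⟨progStep fs, (primrec_progStep fs h).to_comp⟩

/-- The configuration after one round. -/
def next (f : Local) (p : List ℕ) {M : ℕ} (c : Config M) : Config M := fun m =>
  (f (p, m, c m)).1 ++ (List.finRange M).flatMap fun m' : Fin M =>
    ((f (p, m', c m')).2.filter fun msg => msg.1 = (m : ℕ)).map Prod.snd

/-- Every memory holds at most `S` words, all of them below `B`. -/
def Fits {M : ℕ} (c : Config M) (S B : ℕ) : Prop :=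
  ∀ m, (c m).length ≤ S ∧ ∀ w ∈ c m, w < B

/-- Every machine sends at most `S` words, to existing machines only. -/
def SendsOK (f : Local) (p : List ℕ) {M : ℕ} (c : Config M) (S : ℕ) : Prop :=
  ∀ m : Fin M, (f (p, m, c m)).2.length ≤ S ∧ ∀ msg ∈ (f (p, m, c m)).2, msg.1 < M

/-- The list `fs` of local computations is executed legally and leads from `c` to `c'`. -/
def Exec (p : List ℕ) (S B : ℕ) {M : ℕ} : List Local → Config M → Config M → Prop
  | [], c, c' => Fits c S B ∧ c = c'
  | f :: fs, c, c' => Fits c S B ∧ SendsOK f p c S ∧ Exec p S B fs (next f p c) c'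

theorem Exec.fits {p : List ℕ} {S B M : ℕ} {fs : List Local} {c c' : Config M}
    (h : Exec p S B fs c c') : Fits c S B := by
  cases fs <;> exact h.1

theorem Exec.fits_end {p : List ℕ} {S B M : ℕ} {fs : List Local} {c c' : Config M}
    (h : Exec p S B fs c c') : Fits c' S B := by
  induction fs generalizing c with
  | nil => obtain ⟨h, rfl⟩ := h; exact h
  | cons f fs ih => exact ih h.2.2

theorem Exec.append {p : List ℕ} {S B M : ℕ} {fs gs : List Local} {c c' c'' : Config M}
    (h : Exec p S B fs c c') (h' : Exec p S B gs c' c'') : Exec p S B (fs ++ gs) c c'' := by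
  induction fs generalizing c with
  | nil => obtain ⟨_, rfl⟩ := h; exact h'
  | cons f fs ih => exact ⟨h.1, h.2.1, ih h.2.2⟩

/-- `progStep` lowers the round counter by one when it passes to the tail, so a run can be peeled
from the front although `Algorithm.run` recurses at the end. -/
theorem run_cons_succ (f : Local) (fs : List Local) (h : ∀ g ∈ f :: fs, Primrec g) (p : List ℕ)
    {M : ℕ} (c : Config M) (r : ℕ) :
    (ofList (f :: fs) h).run p c (r + 1) =
      (ofList fs fun g hg => h g (List.mem_cons_of_mem f hg)).run p (next f p c) r := by
  induction r with
  | zero =>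
    funext m
    simp [Algorithm.run, Algorithm.retained, Algorithm.received, Algorithm.sent, next, ofList,
      progStep]
  | succ r ih =>
    rw [Algorithm.run, ih]
    funext m
    simp [Algorithm.run, Algorithm.retained, Algorithm.received, Algorithm.sent, ofList,
      progStep]

/-- The bridge to the model: from here on executions are composed with `Exec`, and the round numbers
disappear. -/
theorem Exec.respects {p : List ℕ} {S B M : ℕ} {fs : List Local} (h : ∀ g ∈ fs, Primrec g)
    {c c' : Config M} (hx : Exec p S B fs c c') :
    (ofList fs h).Respects p c S B fs.length ∧ (ofList fs h).run p c fs.length = c' := by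
  induction fs generalizing c with
  | nil =>
    obtain ⟨hf, rfl⟩ := hx
    refine ⟨⟨fun r hr => ?_, fun r hr => by simp at hr⟩, rfl⟩
    obtain rfl : r = 0 := by simpa using hr
    exact hf
  | cons f fs ih =>
    obtain ⟨h1, h2, h3⟩ := hx
    obtain ⟨⟨ha, hb⟩, hc⟩ := ih (fun g hg => h g (List.mem_cons_of_mem f hg)) h3
    refine ⟨⟨fun r hr => ?_, fun r hr => ?_⟩, ?_⟩
    · cases r with
      | zero => exact h1
      | succ r =>
        rw [run_cons_succ]
        exact ha r (by simpa using hr)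
    · cases r with
      | zero => exact h2
      | succ r =>
        rw [run_cons_succ]
        have := hb r (by simpa using hr)
        simpa [Algorithm.sent, ofList, progStep] using this
    · rw [List.length_cons, run_cons_succ]
      exact hc

/-- The words which machine `m` receives, regardless of their order. -/
def inbox (f : Local) (p : List ℕ) {M : ℕ} (c : Config M) (m : Fin M) : Multiset ℕ :=
  ∑ m' : Fin M, (((f (p, m', c m')).2 : Multiset (ℕ × ℕ)).filter
    fun msg => msg.1 = (m : ℕ)).map Prod.snd

/-- As multisets, memories do not depend on the order of arrival. All later invariants speak of
multisets, and the programs use only order-independent statistics such as sums over filtered words.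
-/
theorem coe_next (f : Local) (p : List ℕ) {M : ℕ} (c : Config M) (m : Fin M) :
    (next f p c m : Multiset ℕ) = ((f (p, m, c m)).1 : Multiset ℕ) + inbox f p c m := by
  have key : ∀ (l : List (Fin M)) (g : Fin M → List ℕ),
      ((l.flatMap g : List ℕ) : Multiset ℕ) = (l.map fun x => (g x : Multiset ℕ)).sum := by
    intro l g
    induction l with
    | nil => rfl
    | cons a l ih => simp [← ih]
  rw [next, ← Multiset.coe_add, key, inbox]
  congr 1

/-- The memories are given by the multisets `X m`. -/
def Holds {M : ℕ} (c : Config M) (X : Fin M → Multiset ℕ) : Prop :=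
  ∀ m, (c m : Multiset ℕ) = X m

/-- Every multiset has at most `S` elements, all of them below `B`. -/
def MFits {M : ℕ} (X : Fin M → Multiset ℕ) (S B : ℕ) : Prop :=
  ∀ m, (X m).card ≤ S ∧ ∀ w ∈ X m, w < B

theorem Holds.fits {M S B : ℕ} {c : Config M} {X : Fin M → Multiset ℕ} (h : Holds c X)
    (hX : MFits X S B) : Fits c S B := fun m => by
  have := hX m
  rw [← h m] at this
  simpa using this

theorem Holds.mem_iff {M : ℕ} {c : Config M} {X : Fin M → Multiset ℕ} (h : Holds c X)
    (m : Fin M) (w : ℕ) : w ∈ c m ↔ w ∈ X m := by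
  rw [← h m, Multiset.mem_coe]

theorem Holds.mfits {M S B : ℕ} {c : Config M} {X : Fin M → Multiset ℕ} (h : Holds c X)
    (hc : Fits c S B) : MFits X S B := fun m => by
  have := hc m
  rw [← h m]
  simpa using this

theorem exec_round {f : Local} {p : List ℕ} {S B M : ℕ} {c : Config M} (Y : Fin M → Multiset ℕ)
    (hc : Fits c S B) (hs : SendsOK f p c S)
    (hY : ∀ m : Fin M, ((f (p, m, c m)).1 : Multiset ℕ) + inbox f p c m = Y m)
    (hfit : MFits Y S B) :
    Exec p S B [f] c (next f p c) ∧ Holds (next f p c) Y := by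
  have h : Holds (next f p c) Y := fun m => (coe_next f p c m).trans (hY m)
  exact ⟨⟨hc, hs, h.fits hfit, rfl⟩, h⟩

/-- A local computation that sends no messages. -/
theorem exec_local {f : Local} {p : List ℕ} {S B M : ℕ} {c : Config M} (Y : Fin M → Multiset ℕ)
    (hc : Fits c S B) (hs : ∀ m : Fin M, (f (p, m, c m)).2 = [])
    (hY : ∀ m : Fin M, ((f (p, m, c m)).1 : Multiset ℕ) = Y m) (hfit : MFits Y S B) :
    Exec p S B [f] c (next f p c) ∧ Holds (next f p c) Y := by
  refine exec_round Y hc (fun m => by simp [hs]) (fun m => ?_) hfit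
  rw [hY m, inbox, Finset.sum_eq_zero, add_zero]
  intro m' _
  simp [hs]

/-- Iterated execution of programs which maintain an invariant. -/
theorem exec_iterate {p : List ℕ} {S B M : ℕ} (prog : ℕ → List Local) (I : ℕ → Config M → Prop)
    (D : ℕ) (h : ∀ k < D, ∀ c, I k c → ∃ c', Exec p S B (prog k) c c' ∧ I (k + 1) c')
    (hfit : ∀ c, I 0 c → Fits c S B) (c : Config M) (hc : I 0 c) :
    ∃ c', Exec p S B ((List.range D).flatMap prog) c c' ∧ I D c' := by
  induction D with
  | zero => exact ⟨c, ⟨hfit c hc, rfl⟩, hc⟩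
  | succ D ih =>
    obtain ⟨c', h1, h2⟩ := ih fun k hk => h k (by omega)
    obtain ⟨c'', h3, h4⟩ := h D (by omega) c' h2
    refine ⟨c'', ?_, h4⟩
    rw [List.range_succ, List.flatMap_append]
    simpa using h1.append h3

/-! ### Words with four components -/

/-- The word with components `a`, `x`, `y`, `z`. -/
def word (a x y z : ℕ) : ℕ := Nat.pair a (Nat.pair x (Nat.pair y z))

/-- Tags in use: `0` for an item (position, key, value), `1` for a prefix sum (coordinate, value),
`2` for the number of a chosen set, and `3 + k` for a record of level `k` of a scan (leader,
coordinate, sum). -/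
def tag (w : ℕ) : ℕ := w.unpair.1
def fx (w : ℕ) : ℕ := w.unpair.2.unpair.1
def fy (w : ℕ) : ℕ := w.unpair.2.unpair.2.unpair.1
def fz (w : ℕ) : ℕ := w.unpair.2.unpair.2.unpair.2

@[simp] theorem tag_word (a x y z : ℕ) : tag (word a x y z) = a := by simp [tag, word]
@[simp] theorem fx_word (a x y z : ℕ) : fx (word a x y z) = x := by simp [fx, word]
@[simp] theorem fy_word (a x y z : ℕ) : fy (word a x y z) = y := by simp [fy, word]
@[simp] theorem fz_word (a x y z : ℕ) : fz (word a x y z) = z := by simp [fz, word]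

/-- Each pairing at most squares the bound, and three pairings are nested, hence the exponent `2 ^
3`. Numbers polynomial in `n` therefore give words of `O(log n)` bits. -/
theorem word_lt {a x y z T : ℕ} (ha : a < T) (hx : x < T) (hy : y < T) (hz : z < T) :
    word a x y z < T ^ 8 := by
  have key : ∀ {r s U : ℕ}, r < U → s < U → Nat.pair r s < U ^ 2 := fun {r s U} hr hs =>
    (Nat.pair_lt_max_add_one_sq r s).trans_le (Nat.pow_le_pow_left (by omega) 2)
  have hT : 1 ≤ T := by omega
  have h1 : Nat.pair y z < T ^ 2 := key hy hz
  have h2 : Nat.pair x (Nat.pair y z) < (T ^ 2) ^ 2 :=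
    key (hx.trans_le (Nat.le_self_pow two_ne_zero T)) h1
  have h3 : word a x y z < ((T ^ 2) ^ 2) ^ 2 := by
    refine key (ha.trans_le ?_) h2
    rw [← pow_mul]
    exact Nat.le_self_pow (by norm_num) T
  rwa [← pow_mul, ← pow_mul] at h3

open Primrec

section
variable {α : Type*} [Primcodable α] {f g h k : α → ℕ}

@[fun_prop] theorem primrec_word (hf : Primrec f) (hg : Primrec g) (hh : Primrec h)
    (hk : Primrec k) : Primrec fun a => word (f a) (g a) (h a) (k a) := by
  unfold word; fun_prop
@[fun_prop] theorem primrec_tag (hf : Primrec f) : Primrec fun a => tag (f a) := by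
  unfold tag; fun_prop
@[fun_prop] theorem primrec_fx (hf : Primrec f) : Primrec fun a => fx (f a) := by
  unfold fx; fun_prop
@[fun_prop] theorem primrec_fy (hf : Primrec f) : Primrec fun a => fy (f a) := by
  unfold fy; fun_prop
@[fun_prop] theorem primrec_fz (hf : Primrec f) : Primrec fun a => fz (f a) := by
  unfold fz; fun_prop
end

/-! ### Additive statistics of memories -/

/-- The sum of `g` over the elements of `X` with property `P`. -/
def tot (P : ℕ → Bool) (g : ℕ → ℕ) (X : Multiset ℕ) : ℕ :=
  (X.map fun w => if P w then g w else 0).sum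

theorem sum_map_filter (P : ℕ → Bool) (g : ℕ → ℕ) (l : List ℕ) :
    ((l.filter P).map g).sum = tot P g l := by
  induction l with
  | nil => rfl
  | cons a l ih =>
    simp only [tot, Multiset.map_coe, Multiset.sum_coe, List.map_cons, List.sum_cons] at ih ⊢
    cases h : P a <;> simp [h, ih]

@[simp] theorem tot_zero (P : ℕ → Bool) (g : ℕ → ℕ) : tot P g 0 = 0 := rfl

@[simp] theorem tot_add (P : ℕ → Bool) (g : ℕ → ℕ) (X Y : Multiset ℕ) :
    tot P g (X + Y) = tot P g X + tot P g Y := by simp [tot]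

@[simp] theorem tot_singleton (P : ℕ → Bool) (g : ℕ → ℕ) (w : ℕ) :
    tot P g {w} = if P w then g w else 0 := by simp [tot]

@[simp] theorem tot_sum {ι : Type*} (P : ℕ → Bool) (g : ℕ → ℕ) (s : Finset ι)
    (X : ι → Multiset ℕ) : tot P g (∑ i ∈ s, X i) = ∑ i ∈ s, tot P g (X i) := by
  classical
  induction s using Finset.induction_on with
  | empty => rfl
  | insert a s ha ih => rw [Finset.sum_insert ha, Finset.sum_insert ha, tot_add, ih]

theorem tot_eq_zero {P : ℕ → Bool} {g : ℕ → ℕ} {X : Multiset ℕ} (h : ∀ w ∈ X, P w = false) :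
    tot P g X = 0 := by
  refine Multiset.sum_eq_zero fun x hx => ?_
  obtain ⟨w, hw, rfl⟩ := Multiset.mem_map.1 hx
  simp [h w hw]

theorem filter_sum {ι α : Type*} (P : α → Prop) [DecidablePred P] (s : Finset ι)
    (X : ι → Multiset α) : (∑ i ∈ s, X i).filter P = ∑ i ∈ s, (X i).filter P := by
  classical
  induction s using Finset.induction_on with
  | empty => rfl
  | insert a s ha ih => rw [Finset.sum_insert ha, Finset.sum_insert ha, Multiset.filter_add, ih]

theorem map_sum_multiset {ι α β : Type*} (g : α → β) (s : Finset ι)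
    (X : ι → Multiset α) : (∑ i ∈ s, X i).map g = ∑ i ∈ s, (X i).map g :=
  map_sum (Multiset.mapAddMonoidHom g) X s

theorem coe_map_range {α : Type*} (q : ℕ) (g : ℕ → α) :
    (((List.range q).map g : List α) : Multiset α) = ∑ c ∈ Finset.range q, {g c} := by
  induction q with
  | zero => rfl
  | succ q ih => rw [List.range_succ, List.map_append, ← Multiset.coe_add, ih,
      Finset.sum_range_succ]; rfl

end MPC

/-! ### Prefix sums along a tree of machines: the program. -/

namespace MPC

section ScanProgram

variable (br dim : List ℕ → ℕ) (vec : List ℕ × ℕ × List ℕ → ℕ → ℕ)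
  (phi : List ℕ × List ℕ → ℕ → ℕ)

/-- Every machine adds its own vector to its memory. -/
def scanInit : Local := fun x =>
  (x.2.2 ++ (List.range (dim x.1)).map fun c => word 3 x.2.1 c (vec x c), [])

/-- The leaders of level `k` send the vector sums of their groups to the leaders of level
`k + 1`. -/
def scanUp (k : ℕ) : Local := fun x =>
  (x.2.2, bif decide (x.2.1 % br x.1 ^ k = 0) then
    (List.range (dim x.1)).map fun c => (x.2.1 / br x.1 ^ (k + 1) * br x.1 ^ (k + 1),
      word (4 + k) x.2.1 c
        ((x.2.2.filter fun w => decide (tag w = 3 + k) && decide (fy w = c)).map fz).sum)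
    else [])

/-- The root computes the initial values from the vector of the totals. -/
def scanRoot (D : ℕ) : Local := fun x =>
  (x.2.2 ++ bif decide (x.2.1 = 0) then (List.range (dim x.1)).map fun c =>
    word 1 c (phi (x.1, (List.range (dim x.1)).map fun c' =>
      ((x.2.2.filter fun w => decide (tag w = 3 + D) && decide (fy w = c')).map fz).sum) c) 0
    else [], [])

/-- The leaders of level `k + 1` send prefix sums to the leaders of level `k`. -/
def scanDown (k : ℕ) : Local := fun x =>
  (x.2.2.filter fun w => !decide (tag w = 1),
    (x.2.2.filter fun w => decide (tag w = 4 + k)).map fun w =>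
      (fx w, word 1 (fy w)
        (((x.2.2.filter fun w' => decide (tag w' = 1) && decide (fx w' = fy w)).map fy).sum +
          ((x.2.2.filter fun w' => decide (tag w' = 4 + k) &&
            (decide (fy w' = fy w) && decide (fx w' < fx w))).map fz).sum) 0))

/-- The auxiliary words of the scan are removed. -/
def scanClean : Local := fun x => (x.2.2.filter fun w => decide (tag w < 3), [])

/-- Prefix sums over all machines of the vectors `vec`, started from the values which `phi`
computes from the totals. -/
def scan (D : ℕ) : List Local :=
  [scanInit dim vec] ++ (List.range D).flatMap (fun k => [scanUp br dim k]) ++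
    [scanRoot dim phi D] ++ (List.range D).flatMap (fun j => [scanDown (D - 1 - j)]) ++ [scanClean]

variable {br dim vec phi}

theorem primrec_scan (hbr : Primrec br) (hdim : Primrec dim)
    (hvec : Primrec fun y : (List ℕ × ℕ × List ℕ) × ℕ => vec y.1 y.2)
    (hphi : Primrec fun y : (List ℕ × List ℕ) × ℕ => phi y.1 y.2) (D : ℕ) :
    ∀ f ∈ scan br dim vec phi D, Primrec f := by
  have hb {α : Type} [Primcodable α] {f : α → List ℕ} (hf : Primrec f) :
    Primrec fun a => br (f a) := hbr.comp hf
  have hd {α : Type} [Primcodable α] {f : α → List ℕ} (hf : Primrec f) :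
    Primrec fun a => dim (f a) := hdim.comp hf
  have hv {α : Type} [Primcodable α] {f : α → List ℕ × ℕ × List ℕ} {g : α → ℕ} (hf : Primrec f)
    (hg : Primrec g) : Primrec fun a => vec (f a) (g a) := hvec.comp (hf.pair hg)
  have hp {α : Type} [Primcodable α] {f : α → List ℕ × List ℕ} {g : α → ℕ} (hf : Primrec f)
    (hg : Primrec g) : Primrec fun a => phi (f a) (g a) := hphi.comp (hf.pair hg)
  intro f hf
  simp only [scan, List.mem_append, List.mem_flatMap, List.mem_singleton] at hf
  rcases hf with (((rfl | ⟨k, -, rfl⟩) | rfl) | ⟨k, -, rfl⟩) | rfl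
  · unfold scanInit; fun_prop
  · unfold scanUp; fun_prop
  · unfold scanRoot; fun_prop
  · unfold scanDown; fun_prop
  · unfold scanClean; fun_prop

end ScanProgram

/-! ### Prefix sums along a tree of machines: groups of `u ^ k` consecutive addresses, led by the
multiples of `u ^ k`. -/

section Levels

variable {M : ℕ} (u q : ℕ) (v : Fin M → ℕ → ℕ)

/-- The sum of the vectors of the machines in the group of level `k` with leader `m`. -/
def subtotal (k m c : ℕ) : ℕ := ∑ x : Fin M, if (x : ℕ) / u ^ k * u ^ k = m then v x c else 0

/-- The records of level `k` which machine `m` holds after the upward rounds. -/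
def level : ℕ → ℕ → Multiset ℕ
  | 0, m => ∑ c ∈ Finset.range q, {word 3 m c (subtotal u v 0 m c)}
  | k + 1, m => ∑ x : Fin M, if (x : ℕ) % u ^ k = 0 ∧ (x : ℕ) / u ^ (k + 1) * u ^ (k + 1) = m then
      ∑ c ∈ Finset.range q, {word (4 + k) x c (subtotal u v k x c)} else 0

/-- The prefix sum up to machine `m`. -/
def prefixSum (φ : ℕ → ℕ) (m c : ℕ) : ℕ := φ c + ∑ x : Fin M, if (x : ℕ) < m then v x c else 0

/-- The words that hold the prefix sums up to machine `m`. -/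
def prefixes (φ : ℕ → ℕ) (m : ℕ) : Multiset ℕ :=
  ∑ c ∈ Finset.range q, {word 1 c (prefixSum v φ m c) 0}

variable {u q v}

theorem mem_ite_zero {P : Prop} [Decidable P] {X : Multiset ℕ} {w : ℕ}
    (h : w ∈ if P then X else 0) : P ∧ w ∈ X := by
  split_ifs at h with hP
  · exact ⟨hP, h⟩
  · simp at h

theorem mem_level_zero {m w : ℕ} (h : w ∈ level u q v 0 m) :
    ∃ c < q, w = word 3 m c (subtotal u v 0 m c) := by
  simpa [level, Multiset.mem_sum] using h

theorem mem_level_succ {k m w : ℕ} (h : w ∈ level u q v (k + 1) m) :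
    ∃ x : Fin M, ∃ c < q, w = word (4 + k) x c (subtotal u v k x c) := by
  rw [level, Multiset.mem_sum] at h
  obtain ⟨x, -, h⟩ := h
  obtain ⟨-, h⟩ := mem_ite_zero h
  obtain ⟨c, hc, h⟩ := Multiset.mem_sum.1 h
  exact ⟨x, c, by simpa using hc, by simpa using h⟩

theorem tag_level {k m w : ℕ} (h : w ∈ level u q v k m) : tag w = 3 + k := by
  cases k with
  | zero => obtain ⟨c, -, rfl⟩ := mem_level_zero h; simp
  | succ k => obtain ⟨x, c, -, rfl⟩ := mem_level_succ h; simp; omega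

theorem mem_prefixes {φ : ℕ → ℕ} {m w : ℕ} (h : w ∈ prefixes q v φ m) :
    ∃ c < q, w = word 1 c (prefixSum v φ m c) 0 := by
  simpa [prefixes, Multiset.mem_sum] using h

theorem tag_prefixes {φ : ℕ → ℕ} {m w : ℕ} (h : w ∈ prefixes q v φ m) : tag w = 1 := by
  obtain ⟨c, -, rfl⟩ := mem_prefixes h; simp

theorem card_prefixes (φ : ℕ → ℕ) (m : ℕ) : (prefixes q v φ m).card = q := by
  simp [prefixes]

theorem tot_prefixes (φ : ℕ → ℕ) (m : ℕ) {c : ℕ} (hc : c < q) :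
    tot (fun w => decide (tag w = 1) && decide (fx w = c)) fy (prefixes q v φ m) =
      prefixSum v φ m c := by
  simp [prefixes, hc]

theorem subtotal_zero (m : Fin M) (c : ℕ) : subtotal u v 0 m c = v m c := by
  simp [subtotal, Fin.val_inj]

/-- Summation over the leaders of groups and then over the members of their groups. -/
theorem sum_subtotal (k c : ℕ) (P : ℕ → Prop) [DecidablePred P] :
    (∑ x : Fin M, if P x then subtotal u v k x c else 0) =
      ∑ z : Fin M, if P ((z : ℕ) / u ^ k * u ^ k) then v z c else 0 := by
  simp only [subtotal]
  have h1 : ∀ x : Fin M, (if P x then (∑ z : Fin M,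
      if (z : ℕ) / u ^ k * u ^ k = x then v z c else 0) else 0) =
      ∑ z : Fin M, if (z : ℕ) / u ^ k * u ^ k = x then (if P x then v z c else 0) else 0 := by
    intro x
    split_ifs <;> simp
  rw [Finset.sum_congr rfl fun x _ => h1 x, Finset.sum_comm]
  refine Finset.sum_congr rfl fun z _ => ?_
  -- The leader of a group has the smallest address in it, so it exists even if the last group is
  -- incomplete.
  have hz : (z : ℕ) / u ^ k * u ^ k < M := (Nat.div_mul_le_self _ _).trans_lt z.2
  rw [Finset.sum_eq_single (⟨(z : ℕ) / u ^ k * u ^ k, hz⟩ : Fin M)]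
  · simp
  · intro b _ hb
    rw [if_neg]
    intro h
    exact hb (Fin.ext h.symm)
  · simp

/-- Groups are nested: a machine and its leader of level `k` have the same leader of level `k + 1`.
-/
theorem div_mul_div_mul (z k : ℕ) (hu : 0 < u) :
    z / u ^ k * u ^ k / u ^ (k + 1) * u ^ (k + 1) = z / u ^ (k + 1) * u ^ (k + 1) := by
  rw [pow_succ, ← Nat.div_div_eq_div_mul, ← Nat.div_div_eq_div_mul,
    Nat.mul_div_cancel _ (pow_pos hu k)]

theorem tot_level (hu : 0 < u) (k m : ℕ) {c : ℕ} (hc : c < q) :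
    tot (fun w => decide (tag w = 3 + k) && decide (fy w = c)) fz (level u q v k m) =
      subtotal u v k m c := by
  cases k with
  | zero => simp [level, hc]
  | succ k =>
    have h1 : ∀ x : Fin M, tot (fun w => decide (tag w = 3 + (k + 1)) && decide (fy w = c)) fz
        (if (x : ℕ) % u ^ k = 0 ∧ (x : ℕ) / u ^ (k + 1) * u ^ (k + 1) = m then
          ∑ c ∈ Finset.range q, {word (4 + k) x c (subtotal u v k x c)} else 0) =
        if (x : ℕ) % u ^ k = 0 ∧ (x : ℕ) / u ^ (k + 1) * u ^ (k + 1) = m then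
          subtotal u v k x c else 0 := by
      intro x
      have : 4 + k = 3 + (k + 1) := by omega
      split_ifs
      · simp [hc, this]
      · rfl
    rw [level, tot_sum, Finset.sum_congr rfl fun x _ => h1 x,
      sum_subtotal k c fun y => y % u ^ k = 0 ∧ y / u ^ (k + 1) * u ^ (k + 1) = m, subtotal]
    refine Finset.sum_congr rfl fun z _ => ?_
    simp [div_mul_div_mul _ _ hu]

/-- The machines before `x` are those before the group of level `k + 1` around `x`, together with
the groups of level `k` inside that group whose leaders precede `x`. -/
theorem prefix_step (hu : 0 < u) (φ : ℕ → ℕ) (k c x : ℕ) (hx : x % u ^ k = 0) :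
    prefixSum v φ (x / u ^ (k + 1) * u ^ (k + 1)) c +
      (∑ y : Fin M, if ((y : ℕ) % u ^ k = 0 ∧
        (y : ℕ) / u ^ (k + 1) * u ^ (k + 1) = x / u ^ (k + 1) * u ^ (k + 1)) ∧ (y : ℕ) < x then
          subtotal u v k y c else 0) = prefixSum v φ x c := by
  rw [sum_subtotal k c fun y => (y % u ^ k = 0 ∧
        y / u ^ (k + 1) * u ^ (k + 1) = x / u ^ (k + 1) * u ^ (k + 1)) ∧ y < x,
    prefixSum, prefixSum, add_assoc, ← Finset.sum_add_distrib]
  congr 1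
  refine Finset.sum_congr rfl fun z _ => ?_
  rw [div_mul_div_mul _ _ hu]
  have hN : 0 < u ^ k := pow_pos hu k
  have hN' : 0 < u ^ (k + 1) := pow_pos hu _
  -- Since `x` is a multiple of `u ^ k`, rounding `z` down to such a multiple does not change
  -- whether it lies below `x`.
  have h1 : (z : ℕ) / u ^ k * u ^ k < x ↔ (z : ℕ) < x := by
    obtain ⟨y, rfl⟩ := Nat.dvd_of_mod_eq_zero hx
    rw [mul_comm (u ^ k) y, Nat.mul_lt_mul_right hN, Nat.div_lt_iff_lt_mul hN]
  have h2 : x / u ^ (k + 1) * u ^ (k + 1) ≤ x := Nat.div_mul_le_self _ _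
  have h3 : (z : ℕ) < x / u ^ (k + 1) * u ^ (k + 1) ↔ (z : ℕ) / u ^ (k + 1) < x / u ^ (k + 1) :=
    (Nat.div_lt_iff_lt_mul hN').symm
  simp only [h1, Nat.mul_left_inj hN'.ne']
  by_cases h4 : (z : ℕ) < x
  · have h5 : (z : ℕ) / u ^ (k + 1) ≤ x / u ^ (k + 1) := Nat.div_le_div_right h4.le
    rcases h5.lt_or_eq with h6 | h6
    · simp [h3.2 h6, h4, h6.ne]
    · have : ¬ (z : ℕ) < x / u ^ (k + 1) * u ^ (k + 1) := fun h => (h3.1 h).ne h6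
      simp [this, h6, h4]
  · have : ¬ (z : ℕ) < x / u ^ (k + 1) * u ^ (k + 1) := fun h => h4 (h.trans_le h2)
    simp [this, h4]

/-- A leader has at most `u` children, one for each digit number `k` in base `u`, and each of them
sends `q` records. -/
theorem card_level_le (hu : 0 < u) (k m : ℕ) : (level u q v k m).card ≤ u * q := by
  cases k with
  | zero => simpa [level] using Nat.le_mul_of_pos_left q hu
  | succ k =>
    have hN : 0 < u ^ k := pow_pos hu k
    rw [level, Multiset.card_sum]
    have h1 : ∀ x : Fin M, (if (x : ℕ) % u ^ k = 0 ∧ (x : ℕ) / u ^ (k + 1) * u ^ (k + 1) = m then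
        ∑ c ∈ Finset.range q, ({word (4 + k) x c (subtotal u v k x c)} : Multiset ℕ)
          else 0).card = if (x : ℕ) % u ^ k = 0 ∧ (x : ℕ) / u ^ (k + 1) * u ^ (k + 1) = m then
            q else 0 := by
      intro x
      split_ifs <;> simp
    rw [Finset.sum_congr rfl fun x _ => h1 x, ← Finset.sum_filter, Finset.sum_const, smul_eq_mul]
    refine Nat.mul_le_mul_right q ?_
    calc _ ≤ (Finset.range u).card := by
          refine Finset.card_le_card_of_injOn (fun x : Fin M => (x : ℕ) / u ^ k % u)
            (fun x _ => by simpa using Nat.mod_lt _ hu) ?_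
          intro x hx y hy hxy
          simp only [Finset.coe_filter, Finset.mem_univ, true_and, Set.mem_ofPred_eq] at hx hy
          have h2 : (x : ℕ) / u ^ k / u = (y : ℕ) / u ^ k / u := by
            rw [Nat.div_div_eq_div_mul, Nat.div_div_eq_div_mul, ← pow_succ]
            exact Nat.eq_of_mul_eq_mul_right (pow_pos hu (k + 1)) (hx.2.trans hy.2.symm)
          have h3 : (x : ℕ) / u ^ k = (y : ℕ) / u ^ k := by
            rw [← Nat.div_add_mod ((x : ℕ) / u ^ k) u, ← Nat.div_add_mod ((y : ℕ) / u ^ k) u, h2]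
            simpa using hxy
          refine Fin.ext ?_
          rw [← Nat.div_add_mod (x : ℕ) (u ^ k), ← Nat.div_add_mod (y : ℕ) (u ^ k), h3, hx.1, hy.1]
      _ = u := Finset.card_range u

theorem subtotal_le (k m c : ℕ) : subtotal u v k m c ≤ ∑ x, v x c :=
  Finset.sum_le_sum fun x _ => by split_ifs <;> simp

theorem prefixSum_le (φ : ℕ → ℕ) (m c : ℕ) : prefixSum v φ m c ≤ φ c + ∑ x, v x c :=
  Nat.add_le_add_left (Finset.sum_le_sum fun x _ => by split_ifs <;> simp) _

end Levels

end MPC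

namespace MPC

theorem MFits.mono {M S B : ℕ} {X Y : Fin M → Multiset ℕ} (h : MFits X S B)
    (hle : ∀ m, Y m ≤ X m) : MFits Y S B := fun m =>
  ⟨(Multiset.card_le_card (hle m)).trans (h m).1,
    fun w hw => (h m).2 w (Multiset.mem_of_le (hle m) hw)⟩

theorem Exec.trans_exists {p : List ℕ} {S B M : ℕ} {fs gs : List Local} {c c' : Config M}
    {Q : Config M → Prop} (h : Exec p S B fs c c')
    (h' : ∃ c'', Exec p S B gs c' c'' ∧ Q c'') : ∃ c'', Exec p S B (fs ++ gs) c c'' ∧ Q c'' := by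
  obtain ⟨c'', h1, h2⟩ := h'
  exact ⟨c'', h.append h1, h2⟩

theorem exec_two {p : List ℕ} {S B M : ℕ} {fs gs : List Local} {c : Config M}
    {P Q : Config M → Prop} (h : ∃ c', Exec p S B fs c c' ∧ P c')
    (h' : ∀ c', Fits c' S B → P c' → ∃ c'', Exec p S B gs c' c'' ∧ Q c'') :
    ∃ c'', Exec p S B (fs ++ gs) c c'' ∧ Q c'' := by
  obtain ⟨c', h1, h2⟩ := h
  exact h1.trans_exists (h' c' h1.fits_end h2)

theorem coe_filter {α : Type*} (P : α → Bool) (l : List α) :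
    ((l.filter P : List α) : Multiset α) = (l : Multiset α).filter fun w => P w = true := by
  rw [Multiset.filter_coe]
  congr 1
  exact List.filter_congr fun x _ => by simp

theorem tot_level_other {M u q : ℕ} {v : Fin M → ℕ → ℕ} {P : ℕ → Bool} {g : ℕ → ℕ} {l k m : ℕ}
    (hP : ∀ w, P w = true → tag w = k) (hl : 3 + l ≠ k) : tot P g (level u q v l m) = 0 :=
  tot_eq_zero fun w hw => by
    by_contra h
    exact hl ((tag_level hw).symm.trans (hP w (by simpa using h)))

theorem tot_levels {M u q : ℕ} {v : Fin M → ℕ → ℕ} {P : ℕ → Bool} {g : ℕ → ℕ} {k n m : ℕ}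
    (hP : ∀ w, P w = true → tag w = 3 + k) (hk : k < n) :
    tot P g (∑ l ∈ Finset.range n, level u q v l m) = tot P g (level u q v k m) := by
  rw [tot_sum]
  refine Finset.sum_eq_single k (fun l _ hl => tot_level_other hP (by omega)) fun h => ?_
  simp [hk] at h

section ScanSpec

variable {br dim : List ℕ → ℕ} {vec : List ℕ × ℕ × List ℕ → ℕ → ℕ}
  {phi : List ℕ × List ℕ → ℕ → ℕ} {p : List ℕ} {M S B D T : ℕ} {c : Config M}
  {X : Fin M → Multiset ℕ} {v : Fin M → ℕ → ℕ} {φ : ℕ → ℕ}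

/-- Everything that a machine holds at some time during a scan. -/
def scanAll (u q : ℕ) (X : Fin M → Multiset ℕ) (v : Fin M → ℕ → ℕ) (φ : ℕ → ℕ) (D : ℕ)
    (m : Fin M) : Multiset ℕ :=
  X m + ∑ l ∈ Finset.range (D + 1), level u q v l m + prefixes q v φ m

/-- Every intermediate memory of a scan is contained in `scanAll`, so the limits on space and word
size are checked only here. -/
theorem mfits_scanAll {u q : ℕ} (hu : 0 < u) (hX : MFits X S B)
    (hcard : ∀ m, (X m).card + ((D + 1) * (u * q) + q) ≤ S) (hD : 3 + D < T) (hM : M ≤ T)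
    (hq : q ≤ T) (hT : ∀ c < q, φ c + ∑ x, v x c < T) (hB : T ^ 8 ≤ B) :
    MFits (scanAll u q X v φ D) S B := by
  intro m
  constructor
  · rw [scanAll, Multiset.card_add, Multiset.card_add, Multiset.card_sum, card_prefixes]
    have : ∑ l ∈ Finset.range (D + 1), (level u q v l m).card ≤ (D + 1) * (u * q) := by
      refine (Finset.sum_le_card_nsmul _ _ (u * q) fun l _ => card_level_le hu l m).trans ?_
      simp
    have := hcard m
    omega
  · intro w hw
    rw [scanAll, Multiset.mem_add, Multiset.mem_add, Multiset.mem_sum] at hw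
    have hv : ∀ k m' c, c < q → subtotal u v k m' c < T := fun k m' c hc =>
      ((subtotal_le k m' c).trans (Nat.le_add_left _ _)).trans_lt (hT c hc)
    rcases hw with (hw | ⟨l, hl, hw⟩) | hw
    · exact (hX m).2 w hw
    · refine lt_of_lt_of_le ?_ hB
      have hl : l < D + 1 := by simpa using hl
      cases l with
      | zero =>
        obtain ⟨c, hc, rfl⟩ := mem_level_zero hw
        exact word_lt (by omega) (m.2.trans_le hM) (hc.trans_le hq) (hv _ _ _ hc)
      | succ k =>
        obtain ⟨x, c, hc, rfl⟩ := mem_level_succ hw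
        exact word_lt (by omega) (x.2.trans_le hM) (hc.trans_le hq) (hv _ _ _ hc)
    · refine lt_of_lt_of_le ?_ hB
      obtain ⟨c, hc, rfl⟩ := mem_prefixes hw
      exact word_lt (by omega) (hc.trans_le hq) ((prefixSum_le φ m c).trans_lt (hT c hc))
        (by omega)

theorem exec_scanInit (hv : ∀ m : Fin M, ∀ i, vec (p, m, c m) i = v m i)
    (hall : MFits (scanAll (br p) (dim p) X v φ D) S B) (hc : Holds c X) :
    ∃ c', Exec p S B [scanInit dim vec] c c' ∧
      Holds c' fun m => X m + ∑ l ∈ Finset.range 1, level (br p) (dim p) v l m := by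
  have hfit : MFits (fun m => X m + ∑ l ∈ Finset.range 1, level (br p) (dim p) v l m) S B := by
    refine hall.mono fun m => le_trans ?_ (Multiset.le_add_right _ _)
    exact add_le_add_right (Finset.sum_le_sum_of_subset (Finset.range_mono (by omega))) _
  refine ⟨_, exec_local _ (hc.fits (hall.mono fun m => ?_)) (fun m => rfl) (fun m => ?_) hfit⟩
  · rw [scanAll, add_assoc]
    exact Multiset.le_add_right _ _
  · simp only [scanInit, ← Multiset.coe_add, hc m, coe_map_range, Finset.range_one,
      Finset.sum_singleton, level, subtotal_zero, hv]

theorem exec_scanUp (hu : 0 < br p) (hX : ∀ m, ∀ w ∈ X m, tag w < 3 ∧ tag w ≠ 1)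
    (hall : MFits (scanAll (br p) (dim p) X v φ D) S B) (hq : dim p ≤ S) {k : ℕ} (hk : k < D)
    (hc : Holds c fun m => X m + ∑ l ∈ Finset.range (k + 1), level (br p) (dim p) v l m) :
    ∃ c', Exec p S B [scanUp br dim k] c c' ∧
      Holds c' fun m => X m + ∑ l ∈ Finset.range (k + 2), level (br p) (dim p) v l m := by
  have hfit : ∀ j ≤ D + 1,
      MFits (fun m => X m + ∑ l ∈ Finset.range j, level (br p) (dim p) v l m) S B := fun j hj => by
    refine hall.mono fun m => le_trans ?_ (Multiset.le_add_right _ _)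
    exact add_le_add_right (Finset.sum_le_sum_of_subset (Finset.range_mono hj)) _
  have hval : ∀ (m : Fin M) (i : ℕ), i < dim p →
      (((c m).filter fun w => decide (tag w = 3 + k) && decide (fy w = i)).map fz).sum =
        subtotal (br p) v k m i := by
    intro m i hi
    rw [sum_map_filter, hc m, tot_add, tot_levels (k := k) (by simp; tauto) (by omega),
      tot_level hu k m hi, tot_eq_zero, zero_add]
    intro w hw
    have := (hX m w hw).1
    simp; omega
  refine ⟨_, exec_round _ (hc.fits (hfit _ (by omega))) (fun m => ?_) (fun m => ?_)
    (hfit (k + 2) (by omega))⟩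
  · simp only [scanUp]
    cases h : decide ((m : ℕ) % br p ^ k = 0)
    · simp
    · simp only [cond_true, List.length_map, List.length_range, List.mem_map]
      refine ⟨hq, ?_⟩
      rintro _ ⟨i, -, rfl⟩
      exact (Nat.div_mul_le_self _ _).trans_lt m.2
  · rw [Finset.sum_range_succ _ (k + 1), ← add_assoc]
    refine congrArg₂ (· + ·) (hc m) ?_
    rw [inbox, level]
    refine Finset.sum_congr rfl fun x _ => ?_
    simp only [scanUp]
    by_cases h : (x : ℕ) % br p ^ k = 0
    · simp only [h, decide_true, cond_true, coe_map_range, filter_sum, Multiset.filter_singleton,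
        true_and]
      by_cases h' : (x : ℕ) / br p ^ (k + 1) * br p ^ (k + 1) = m
      · simp only [h', if_true, map_sum_multiset, Multiset.map_singleton]
        refine Finset.sum_congr rfl fun i hi => ?_
        rw [hval x i (by simpa using hi)]
      · simp [h']
    · simp [h]

theorem exec_scanRoot (hu : 0 < br p) (hX : ∀ m, ∀ w ∈ X m, tag w < 3 ∧ tag w ≠ 1)
    (hall : MFits (scanAll (br p) (dim p) X v φ D) S B) (hM : M ≤ br p ^ D)
    (hφ : ∀ i, phi (p, (List.range (dim p)).map fun c' => ∑ x, v x c') i = φ i)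
    (hc : Holds c fun m => X m + ∑ l ∈ Finset.range (D + 1), level (br p) (dim p) v l m) :
    ∃ c', Exec p S B [scanRoot dim phi D] c c' ∧
      Holds c' fun m => X m + ∑ l ∈ Finset.range (D + 1), level (br p) (dim p) v l m +
        if (m : ℕ) % br p ^ D = 0 then prefixes (dim p) v φ m else 0 := by
  have hfit := hall.mono (Y := fun m => X m + ∑ l ∈ Finset.range (D + 1),
    level (br p) (dim p) v l m) fun m => Multiset.le_add_right _ _
  have hfit' := hall.mono (Y := fun m => X m + ∑ l ∈ Finset.range (D + 1),
    level (br p) (dim p) v l m + if (m : ℕ) % br p ^ D = 0 then prefixes (dim p) v φ m else 0)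
    fun m => add_le_add_right (by split_ifs <;> simp) _
  refine ⟨_, exec_local _ (hc.fits hfit) (fun m => rfl) (fun m => ?_) hfit'⟩
  simp only [scanRoot, ← Multiset.coe_add, hc m]
  congr 1
  -- As `M ≤ br p ^ D`, machine `0` is the only leader of level `D`.
  rw [Nat.mod_eq_of_lt (m.2.trans_le hM)]
  by_cases hm : (m : ℕ) = 0
  · have hval : ((List.range (dim p)).map fun i =>
        (((c m).filter fun w => decide (tag w = 3 + D) && decide (fy w = i)).map fz).sum) =
        (List.range (dim p)).map fun c' => ∑ x, v x c' := by
      refine List.map_congr_left fun i hi => ?_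
      rw [sum_map_filter, hc m, tot_add, tot_levels (k := D) (by simp; tauto) (by omega),
        tot_level hu D m (by simpa using hi), tot_eq_zero, zero_add, subtotal]
      · refine Finset.sum_congr rfl fun x _ => ?_
        rw [Nat.div_eq_of_lt (x.2.trans_le hM), hm]
        rw [zero_mul, if_pos rfl]
      · intro w hw
        have := (hX m w hw).1
        simp; omega
    simp only [hm, decide_true, cond_true, if_true, coe_map_range, prefixes]
    refine Finset.sum_congr rfl fun i _ => ?_
    rw [← hm, hval, hφ, hm]
    simp [prefixSum]
  · simp [hm]

/-- A leader of level `k + 1` still holds the records of its children from the way up. To each child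
it sends its own prefix sum plus the records of the preceding siblings. It is its own first child,
so it can drop its old prefix sums. -/
theorem exec_scanDown (hu : 0 < br p) (hX : ∀ m, ∀ w ∈ X m, tag w < 3 ∧ tag w ≠ 1)
    (hall : MFits (scanAll (br p) (dim p) X v φ D) S B) {k : ℕ} (hk : k < D)
    (hc : Holds c fun m => X m + ∑ l ∈ Finset.range (D + 1), level (br p) (dim p) v l m +
        if (m : ℕ) % br p ^ (k + 1) = 0 then prefixes (dim p) v φ m else 0) :
    ∃ c', Exec p S B [scanDown k] c c' ∧
      Holds c' fun m => X m + ∑ l ∈ Finset.range (D + 1), level (br p) (dim p) v l m +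
        if (m : ℕ) % br p ^ k = 0 then prefixes (dim p) v φ m else 0 := by
  have hfit : ∀ j, MFits (fun m : Fin M => X m + ∑ l ∈ Finset.range (D + 1),
      level (br p) (dim p) v l m + if (m : ℕ) % br p ^ j = 0 then prefixes (dim p) v φ m else 0)
      S B := fun j => hall.mono fun m => add_le_add_right (by split_ifs <;> simp) _
  have hrec : ∀ m, (((c m).filter fun w => decide (tag w = 4 + k) : List ℕ) : Multiset ℕ) =
      level (br p) (dim p) v (k + 1) m := by
    intro m
    rw [coe_filter, hc m, Multiset.filter_add, Multiset.filter_add, filter_sum,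
      Finset.sum_eq_single (k + 1)]
    · rw [Multiset.filter_eq_nil.2, Multiset.filter_eq_self.2, Multiset.filter_eq_nil.2, zero_add,
        add_zero]
      · intro w hw
        have := tag_prefixes (mem_ite_zero hw).2
        simp; omega
      · intro w hw
        have := tag_level hw
        simp; omega
      · intro w hw
        have := (hX m w hw).1
        simp; omega
    · intro l _ hl
      refine Multiset.filter_eq_nil.2 fun w hw => ?_
      have := tag_level hw
      simp; omega
    · intro h
      simp at h; omega
  have hlev : ∀ (m : Fin M) (P : ℕ → Bool) (g : ℕ → ℕ), (∀ w, P w = true → tag w = 4 + k) →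
      (((c m).filter P).map g).sum = tot P g (level (br p) (dim p) v (k + 1) m) := by
    intro m P g hP
    rw [sum_map_filter, hc m, tot_add, tot_add,
      tot_levels (k := k + 1) (fun w hw => by rw [hP w hw]; omega) (by omega), tot_eq_zero,
      tot_eq_zero (X := ite _ _ _), zero_add, add_zero]
    · intro w hw
      have := tag_prefixes (mem_ite_zero hw).2
      by_contra h
      have := hP w (by simpa using h)
      omega
    · intro w hw
      have := (hX m w hw).1
      by_contra h
      have := hP w (by simpa using h)
      omega
  have hpre : ∀ (m : Fin M) (i : ℕ), (m : ℕ) % br p ^ (k + 1) = 0 → i < dim p →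
      (((c m).filter fun w' => decide (tag w' = 1) && decide (fx w' = i)).map fy).sum =
        prefixSum v φ m i := by
    intro m i hm hi
    rw [sum_map_filter, hc m, tot_add, tot_add, if_pos hm, tot_prefixes φ m hi, tot_eq_zero,
      tot_eq_zero, zero_add]
    · simp
    · intro w hw
      obtain ⟨l, -, hw⟩ := Multiset.mem_sum.1 hw
      have := tag_level hw
      simp; omega
    · intro w hw
      have := (hX m w hw).2
      simp [this]
  have hval : ∀ (m x : Fin M) (i : ℕ), (x : ℕ) % br p ^ k = 0 →
      (x : ℕ) / br p ^ (k + 1) * br p ^ (k + 1) = m → i < dim p →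
      (((c m).filter fun w' => decide (tag w' = 1) && decide (fx w' = i)).map fy).sum +
        (((c m).filter fun w' => decide (tag w' = 4 + k) &&
          (decide (fy w' = i) && decide (fx w' < x))).map fz).sum = prefixSum v φ x i := by
    intro m x i hx hxm hi
    rw [hpre m i (by rw [← hxm]; simp) hi, hlev m _ _ (by simp; tauto),
      ← prefix_step hu φ k i x hx, hxm, level, tot_sum]
    congr 1
    refine Finset.sum_congr rfl fun y _ => ?_
    by_cases hy : (y : ℕ) % br p ^ k = 0 ∧ (y : ℕ) / br p ^ (k + 1) * br p ^ (k + 1) = m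
    · simp only [hy, and_self, if_true, tot_sum, tot_singleton, tag_word, fy_word, fx_word,
        fz_word, decide_true, Bool.true_and, Bool.and_eq_true, decide_eq_true_eq, true_and]
      by_cases hyx : (y : ℕ) < x <;> simp [hyx, hi]
    · simp [hy]
  refine ⟨_, exec_round _ (hc.fits (hfit _)) (fun m => ?_) (fun m => ?_) (hfit k)⟩
  · constructor
    · simp only [scanDown, List.length_map]
      exact (List.length_filter_le _ _).trans (hc.fits (hfit _) m).1
    · intro msg hmsg
      simp only [scanDown, List.mem_map] at hmsg
      obtain ⟨w, hw, rfl⟩ := hmsg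
      rw [← Multiset.mem_coe, hrec m] at hw
      obtain ⟨x, i, -, rfl⟩ := mem_level_succ hw
      simp
  · congr 1
    · simp only [scanDown]
      rw [coe_filter, hc m, Multiset.filter_add, Multiset.filter_eq_self.2,
        Multiset.filter_eq_nil.2, add_zero]
      · intro w hw
        simp [tag_prefixes (mem_ite_zero hw).2]
      · intro w hw
        rcases Multiset.mem_add.1 hw with hw | hw
        · simp [(hX m w hw).2]
        · obtain ⟨l, -, hw⟩ := Multiset.mem_sum.1 hw
          have := tag_level hw
          simp; omega
    · have hsent : ∀ m' : Fin M, (((scanDown k (p, m', c m')).2 : Multiset (ℕ × ℕ)).filter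
          fun msg => msg.1 = (m : ℕ)).map Prod.snd = if (m : ℕ) % br p ^ k = 0 ∧
            (m : ℕ) / br p ^ (k + 1) * br p ^ (k + 1) = m' then prefixes (dim p) v φ m else 0 := by
        intro m'
        simp only [scanDown]
        -- Each record is answered to the machine that sent it, so only the records of `m` itself
        -- contribute to the inbox of `m`.
        rw [← Multiset.map_coe, hrec m', level, map_sum_multiset, filter_sum, map_sum_multiset,
          Finset.sum_eq_single m]
        · by_cases h : (m : ℕ) % br p ^ k = 0 ∧ (m : ℕ) / br p ^ (k + 1) * br p ^ (k + 1) = m'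
          · rw [if_pos h, if_pos h, map_sum_multiset, filter_sum, map_sum_multiset, prefixes]
            refine Finset.sum_congr rfl fun i hi => ?_
            simp only [Multiset.map_singleton, Multiset.filter_singleton, fx_word, fy_word,
              if_true]
            rw [hval m' m i h.1 h.2 (by simpa using hi)]
          · rw [if_neg h, if_neg h]
            rfl
        · intro x _ hx
          have hx' : (x : ℕ) ≠ m := fun h => hx (Fin.ext h)
          split_ifs
          · simp [map_sum_multiset, filter_sum, Multiset.filter_singleton, hx']
          · rfl
        · simp
      rw [inbox, Finset.sum_congr rfl fun m' _ => hsent m']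
      by_cases h : (m : ℕ) % br p ^ k = 0
      · have hlt : (m : ℕ) / br p ^ (k + 1) * br p ^ (k + 1) < M :=
          (Nat.div_mul_le_self _ _).trans_lt m.2
        rw [if_pos h, Finset.sum_eq_single (⟨_, hlt⟩ : Fin M)]
        · simp [h]
        · intro b _ hb
          rw [if_neg]
          rintro ⟨-, h'⟩
          exact hb (Fin.ext h'.symm)
        · simp
      · simp [h]

/-- The condition on tags separates the data `X` from the words of the scan, which use `1` and the
tags from `3` on. The values `φ` are computed at the root from the totals and added to all prefix
sums, so one scan also broadcasts a function of the totals. -/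
theorem exec_scan (hu : 0 < br p) (hX : ∀ m, ∀ w ∈ X m, tag w < 3 ∧ tag w ≠ 1)
    (hM : M ≤ br p ^ D) (hv : ∀ m : Fin M, ∀ i, vec (p, m, c m) i = v m i)
    (hφ : ∀ i, phi (p, (List.range (dim p)).map fun c' => ∑ x, v x c') i = φ i)
    (hXfit : MFits X S B) (hcard : ∀ m, (X m).card + ((D + 1) * (br p * dim p) + dim p) ≤ S)
    (hD : 3 + D < T) (hMT : M ≤ T) (hq : dim p ≤ T) (hqS : dim p ≤ S)
    (hT : ∀ i < dim p, φ i + ∑ x, v x i < T)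
    (hB : T ^ 8 ≤ B) (hc : Holds c X) :
    ∃ c', Exec p S B (scan br dim vec phi D) c c' ∧
      Holds c' fun m => X m + prefixes (dim p) v φ m := by
  have hall : MFits (scanAll (br p) (dim p) X v φ D) S B :=
    mfits_scanAll hu hXfit hcard hD hMT hq hT hB
  unfold scan
  refine exec_two (P := fun c' => Holds c' fun m => X m + ∑ l ∈ Finset.range (D + 1),
    level (br p) (dim p) v l m + if (m : ℕ) % br p ^ 0 = 0 then prefixes (dim p) v φ m else 0)
    (exec_two (exec_two (exec_two (exec_scanInit hv hall hc) fun c' _ hc' => ?_)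
      fun c' _ hc' => exec_scanRoot hu hX hall hM hφ hc') fun c' _ hc' => ?_) fun c' _ hc' => ?_
  · refine exec_iterate (fun k => [scanUp br dim k]) (fun k c => Holds c fun m => X m +
      ∑ l ∈ Finset.range (k + 1), level (br p) (dim p) v l m) D
      (fun k hk c hc => exec_scanUp hu hX hall hqS hk hc) (fun c hc => hc.fits ?_) c' hc'
    refine hall.mono fun m => le_trans ?_ (Multiset.le_add_right _ _)
    exact add_le_add_right (Finset.sum_le_sum_of_subset (Finset.range_mono (by omega))) _
  · have hstep : ∀ j < D, ∀ c : Config M, (Holds c fun m => X m + ∑ l ∈ Finset.range (D + 1),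
        level (br p) (dim p) v l m +
          if (m : ℕ) % br p ^ (D - j) = 0 then prefixes (dim p) v φ m else 0) →
        ∃ c', Exec p S B [scanDown (D - 1 - j)] c c' ∧ Holds c' fun m => X m +
          ∑ l ∈ Finset.range (D + 1), level (br p) (dim p) v l m +
          if (m : ℕ) % br p ^ (D - (j + 1)) = 0 then prefixes (dim p) v φ m else 0 := by
      intro j hj c hc
      have e1 : D - j = (D - 1 - j) + 1 := by omega
      have e2 : D - (j + 1) = D - 1 - j := by omega
      rw [e1] at hc
      rw [e2]
      exact exec_scanDown hu hX hall (by omega) hc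
    obtain ⟨c'', h1, h2⟩ := exec_iterate (fun j => [scanDown (D - 1 - j)]) _ D hstep
      (fun c hc => hc.fits (hall.mono fun m => add_le_add_right (by split_ifs <;> simp) _)) c' hc'
    exact ⟨c'', h1, by simpa using h2⟩
  · have hfit := hall.mono (Y := fun m => X m + prefixes (dim p) v φ m) fun m => by
      rw [scanAll]
      exact add_le_add_left (Multiset.le_add_right _ _) _
    refine ⟨_, exec_local _ (hc'.fits (hall.mono fun m => ?_)) (fun m => rfl) (fun m => ?_) ?_⟩
    · simp [scanAll, Nat.mod_one]
    · simp only [scanClean]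
      rw [coe_filter, hc' m, Multiset.filter_add, Multiset.filter_add, Multiset.filter_eq_self.2,
        Multiset.filter_eq_nil.2, add_zero, Multiset.filter_eq_self.2]
      · simp [Nat.mod_one]
      · intro w hw
        simp [tag_prefixes (mem_ite_zero hw).2]
      · intro w hw
        obtain ⟨l, -, hw⟩ := Multiset.mem_sum.1 hw
        have := tag_level hw
        simp; omega
      · intro w hw
        simpa using (hX m w hw).1
    · exact hfit

end ScanSpec

end MPC

namespace MPC

/-! ### Ranks -/

section Rank

variable {ι α : Type*} [LinearOrder α]

/-- The number of elements of `E` that precede `e` in the order given by `f`. -/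
def rank (E : Finset ι) (f : ι → α) (e : ι) : ℕ := (E.filter fun e' => f e' < f e).card

variable {E : Finset ι} {f : ι → α}

theorem rank_lt_rank {e e' : ι} (he : e ∈ E) (h : f e < f e') : rank E f e < rank E f e' := by
  refine Finset.card_lt_card ⟨fun x hx => ?_, fun hss => ?_⟩
  · simp only [Finset.mem_filter] at hx ⊢
    exact ⟨hx.1, hx.2.trans h⟩
  · have := hss (Finset.mem_filter.2 ⟨he, h⟩)
    simp at this

theorem rank_injOn (hf : Set.InjOn f E) : Set.InjOn (rank E f) E := by
  intro e he e' he' h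
  by_contra hne
  rcases lt_or_gt_of_ne fun h' => hne (hf he he' h') with h' | h'
  · exact (rank_lt_rank he h').ne h
  · exact (rank_lt_rank he' h').ne' h

theorem rank_lt_card {e : ι} (he : e ∈ E) : rank E f e < E.card := by
  refine Finset.card_lt_card ⟨Finset.filter_subset _ _, fun hss => ?_⟩
  have := hss he
  simp at this

/-- If a numbering of `E` with the numbers below `b * n` is monotone in the keys, which are less
than `n`, and every key occurs `b` times, then the elements with key `i` have the numbers
`b * i, …, b * i + b - 1`. -/
theorem div_eq_key {E : Finset ι} {key pos : ι → ℕ} {n b : ℕ} (hinj : Set.InjOn pos E)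
    (hlt : ∀ e ∈ E, pos e < b * n) (hkey : ∀ e ∈ E, key e < n)
    (hmono : ∀ e ∈ E, ∀ e' ∈ E, key e < key e' → pos e < pos e')
    (hb : ∀ i < n, (E.filter fun e => key e = i).card = b) {e : ι} (he : e ∈ E) :
    pos e / b = key e := by
  have hcount : ∀ s : Finset ℕ, (∀ i ∈ s, i < n) →
      (E.filter fun e => key e ∈ s).card = b * s.card := by
    intro s hs
    rw [Finset.card_eq_sum_card_fiberwise (f := key) (t := s)]
    · rw [Finset.sum_congr rfl (g := fun _ => b), Finset.sum_const, smul_eq_mul, mul_comm]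
      intro i hi
      rw [← hb i (hs i hi), Finset.filter_filter]
      congr 1
      ext e
      simp only [Finset.mem_filter]
      constructor
      · rintro ⟨h1, -, h3⟩; exact ⟨h1, h3⟩
      · rintro ⟨h1, rfl⟩; exact ⟨h1, hi, rfl⟩
    · intro e he
      simpa using (Finset.mem_filter.1 he).2
  have hk := hkey e he
  -- The `b * key e` elements with smaller keys have distinct positions below `pos e`.
  have h1 : b * key e ≤ pos e := by
    have := hcount (Finset.range (key e)) fun i hi => (Finset.mem_range.1 hi).trans hk
    rw [Finset.card_range] at this
    rw [← this, ← Finset.card_range (pos e)]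
    refine Finset.card_le_card_of_injOn pos (fun x hx => ?_) (hinj.mono fun x hx => ?_)
    · have hx := Finset.mem_filter.1 hx
      simpa using hmono x hx.1 e he (by simpa using hx.2)
    · exact (Finset.mem_filter.1 hx).1
  -- Symmetrically, the elements with larger keys have distinct positions between `pos e` and `b *
  -- n`. The two bounds leave exactly `b` values for `pos e`.
  have h2 : b * (n - 1 - key e) ≤ b * n - 1 - pos e := by
    have := hcount (Finset.Ico (key e + 1) n) fun i hi => (Finset.mem_Ico.1 hi).2
    rw [Nat.card_Ico] at this
    have e1 : n - (key e + 1) = n - 1 - key e := by omega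
    have e2 : b * n - (pos e + 1) = b * n - 1 - pos e := by omega
    rw [← e1, ← this, ← e2, ← Nat.card_Ico]
    refine Finset.card_le_card_of_injOn pos (fun x hx => ?_) (hinj.mono fun x hx => ?_)
    · have hx := Finset.mem_filter.1 hx
      have h3 := Finset.mem_Ico.1 hx.2
      have := hmono e he x hx.1 (by omega)
      have := hlt x hx.1
      simp; omega
    · exact (Finset.mem_filter.1 hx).1
  have h3 := hlt e he
  have hb0 : 0 < b := by
    rcases Nat.eq_zero_or_pos b with rfl | h
    · simp at h3
    · exact h
  rw [Nat.div_eq_iff hb0]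
  have h4 : b * (n - 1 - key e) + b * (key e + 1) = b * n := by
    rw [← mul_add]
    congr 1
    omega
  rw [mul_comm (key e) b]
  rw [mul_add] at h4
  omega

end Rank

/-! ### Items placed on machines -/

section Placed

variable {ι : Type*} {M : ℕ}

/-- The memories that hold one word for every element `e` of `E`, on machine `loc e`. -/
def placed (E : Finset ι) (wd : ι → ℕ) (loc : ι → ℕ) (m : Fin M) : Multiset ℕ :=
  ∑ e ∈ E, if loc e = m then {wd e} else 0

theorem mem_placed {E : Finset ι} {wd loc : ι → ℕ} {m : Fin M} {w : ℕ} :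
    w ∈ placed E wd loc m ↔ ∃ e ∈ E, loc e = m ∧ wd e = w := by
  rw [placed, Multiset.mem_sum]
  refine exists_congr fun e => and_congr_right fun _ => ?_
  split_ifs with h <;> simp [h, eq_comm]

theorem card_placed (E : Finset ι) (wd loc : ι → ℕ) (m : Fin M) :
    (placed E wd loc m).card = (E.filter fun e => loc e = m).card := by
  rw [placed, Multiset.card_sum, Finset.card_filter]
  refine Finset.sum_congr rfl fun e _ => ?_
  split_ifs <;> simp

theorem tot_placed (P : ℕ → Bool) (g : ℕ → ℕ) (E : Finset ι) (wd loc : ι → ℕ) (m : Fin M) :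
    tot P g (placed E wd loc m) =
      ∑ e ∈ E, if loc e = m then (if P (wd e) then g (wd e) else 0) else 0 := by
  rw [placed, tot_sum]
  refine Finset.sum_congr rfl fun e _ => ?_
  split_ifs <;> simp_all

theorem map_placed (g : ℕ → ℕ) (E : Finset ι) (wd loc : ι → ℕ) (m : Fin M) :
    (placed E wd loc m).map g = placed E (fun e => g (wd e)) loc m := by
  rw [placed, placed, map_sum_multiset]
  refine Finset.sum_congr rfl fun e _ => ?_
  split_ifs <;> simp

theorem placed_congr {E : Finset ι} {wd wd' loc loc' : ι → ℕ} {m : Fin M}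
    (h : ∀ e ∈ E, loc e = loc' e) (h' : ∀ e ∈ E, loc e = m → wd e = wd' e) :
    placed E wd loc m = placed E wd' loc' m := by
  refine Finset.sum_congr rfl fun e he => ?_
  rw [← h e he]
  split_ifs with h1
  · rw [h' e he h1]
  · rfl

theorem mfits_placed {E : Finset ι} {wd loc : ι → ℕ} {S B : ℕ} (hw : ∀ e ∈ E, wd e < B)
    (hcard : ∀ m : Fin M, (E.filter fun e => loc e = m).card ≤ S) :
    MFits (fun m : Fin M => placed E wd loc m) S B := by
  refine fun m => ⟨by rw [card_placed]; exact hcard m, fun w h => ?_⟩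
  obtain ⟨e, he, -, rfl⟩ := mem_placed.1 h
  exact hw e he

theorem filter_placed (P : ℕ → Prop) [DecidablePred P] (E : Finset ι) (wd loc : ι → ℕ)
    (m : Fin M) : (placed E wd loc m).filter P = placed (E.filter fun e => P (wd e)) wd loc m := by
  rw [placed, placed, filter_sum, Finset.sum_filter]
  refine Finset.sum_congr rfl fun e _ => ?_
  split_ifs <;> simp [Multiset.filter_singleton, *]

/-- The number of elements on one machine, if machine `m` holds the numbers
`m * C, …, m * C + C - 1`. -/
theorem card_div_eq_le {E : Finset ι} {pos : ι → ℕ} (hinj : Set.InjOn pos E) {C : ℕ} (hC : 0 < C)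
    (m : ℕ) : (E.filter fun e => pos e / C = m).card ≤ C := by
  calc _ ≤ (Finset.Ico (m * C) (m * C + C)).card := by
        refine Finset.card_le_card_of_injOn pos (fun x hx => ?_) (hinj.mono fun x hx => ?_)
        · have hx := (Finset.mem_filter.1 hx).2
          rw [Nat.div_eq_iff hC] at hx
          simp; omega
        · exact (Finset.mem_filter.1 hx).1
    _ = C := by simp

/-- Every word with an admissible first component is sent to the machine computed from it. -/
def route (kp : List ℕ → ℕ → Bool) (ds : List ℕ → ℕ → ℕ) : Local := fun x =>
  ([], (x.2.2.filter fun w => kp x.1 (fx w)).map fun w => (ds x.1 (fx w), w))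

theorem primrec_route {kp : List ℕ → ℕ → Bool} {ds : List ℕ → ℕ → ℕ}
    (hkp : Primrec fun y : List ℕ × ℕ => kp y.1 y.2)
    (hds : Primrec fun y : List ℕ × ℕ => ds y.1 y.2) : Primrec (route kp ds) := by
  have h1 {α : Type} [Primcodable α] {f : α → List ℕ} {g : α → ℕ} (hf : Primrec f)
    (hg : Primrec g) : Primrec fun a => kp (f a) (g a) := hkp.comp (hf.pair hg)
  have h2 {α : Type} [Primcodable α] {f : α → List ℕ} {g : α → ℕ} (hf : Primrec f)
    (hg : Primrec g) : Primrec fun a => ds (f a) (g a) := hds.comp (hf.pair hg)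
  unfold route; fun_prop

theorem exec_route {kp : List ℕ → ℕ → Bool} {ds : List ℕ → ℕ → ℕ} {p : List ℕ} {S B : ℕ}
    {c : Config M} {E : Finset ι} {wd loc : ι → ℕ} (hc : Holds c fun m => placed E wd loc m)
    (hloc : ∀ e ∈ E, loc e < M) (hfit : MFits (fun m : Fin M => placed E wd loc m) S B)
    (hds : ∀ e ∈ E, kp p (fx (wd e)) = true → ds p (fx (wd e)) < M)
    (hfit' : MFits (fun m : Fin M => placed (E.filter fun e => kp p (fx (wd e)) = true) wd
      (fun e => ds p (fx (wd e))) m) S B) :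
    ∃ c', Exec p S B [route kp ds] c c' ∧ Holds c' fun m =>
      placed (E.filter fun e => kp p (fx (wd e)) = true) wd (fun e => ds p (fx (wd e))) m := by
  refine ⟨_, exec_round _ (hc.fits hfit) (fun m => ?_) (fun m => ?_) hfit'⟩
  · simp only [route, List.length_map, List.mem_map, List.mem_filter]
    refine ⟨(List.length_filter_le _ _).trans (hc.fits hfit m).1, ?_⟩
    rintro _ ⟨w, ⟨hw, hk⟩, rfl⟩
    obtain ⟨e, he, -, rfl⟩ := mem_placed.1 ((hc.mem_iff m w).1 hw)
    exact hds e he hk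
  · have h1 : ∀ m' : Fin M, (((route kp ds (p, m', c m')).2 : Multiset (ℕ × ℕ)).filter
        fun msg => msg.1 = (m : ℕ)).map Prod.snd = ∑ e ∈ E.filter fun e => kp p (fx (wd e)) = true,
          if loc e = m' then (if ds p (fx (wd e)) = m then {wd e} else 0) else 0 := by
      intro m'
      simp only [route]
      rw [← Multiset.map_coe, coe_filter, hc m', filter_placed, placed, map_sum_multiset,
        filter_sum, map_sum_multiset]
      refine Finset.sum_congr rfl fun e _ => ?_
      split_ifs with h h' <;> simp [Multiset.filter_singleton, *]
    rw [inbox, Finset.sum_congr rfl fun m' _ => h1 m', Finset.sum_comm, placed]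
    simp only [route, Multiset.coe_nil, zero_add]
    refine Finset.sum_congr rfl fun e he => ?_
    have he' := (Finset.mem_filter.1 he).1
    rw [Finset.sum_eq_single (⟨loc e, hloc e he'⟩ : Fin M)]
    · simp
    · intro b _ hb
      rw [if_neg]
      exact fun h => hb (Fin.ext h.symm)
    · simp

end Placed

/-! ### Radix sort -/

theorem sum_map_range (n : ℕ) (g : ℕ → ℕ) :
    ((List.range n).map g).sum = ∑ i ∈ Finset.range n, g i := by
  rw [← Multiset.sum_coe, ← Multiset.map_coe]
  rfl

section Radix

variable (br dim cap : List ℕ → ℕ)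

/-- The digit number `k` of the key in base `dim`. -/
def digit (q k i : ℕ) : ℕ := i / q ^ k % q

/-- The histogram of the digits. -/
def histogram (k : ℕ) : List ℕ × ℕ × List ℕ → ℕ → ℕ := fun x c =>
  ((x.2.2.filter fun w => decide (digit (dim x.1) k (fy w) = c)).map fun _ => 1).sum

/-- The sums of the totals of the smaller digits. -/
def smallerTotals : List ℕ × List ℕ → ℕ → ℕ := fun y c =>
  ((List.range c).map fun c' => y.2.getD c' 0).sum

/-- Every item gets its new position. -/
def relabel (k : ℕ) : Local := fun x =>
  ((x.2.2.filter fun w => decide (tag w = 0)).map fun w => word 0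
    (((x.2.2.filter fun w' => decide (tag w' = 1) &&
        decide (fx w' = digit (dim x.1) k (fy w))).map fy).sum +
      ((x.2.2.filter fun w' => decide (tag w' = 0) &&
        (decide (digit (dim x.1) k (fy w') = digit (dim x.1) k (fy w)) &&
          decide (fx w' < fx w))).map fun _ => 1).sum) (fy w) (fz w), [])

/-- One pass of radix sort. -/
def radixPass (D k : ℕ) : List Local :=
  scan br dim (histogram dim k) smallerTotals D ++ [relabel dim k] ++
    [route (fun _ _ => true) fun p i => i / cap p]

variable {br dim cap}

theorem primrec_radixPass (hbr : Primrec br) (hdim : Primrec dim) (hcap : Primrec cap)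
    (D k : ℕ) : ∀ f ∈ radixPass br dim cap D k, Primrec f := by
  have hd {α : Type} [Primcodable α] {f : α → List ℕ} (hf : Primrec f) :
    Primrec fun a => dim (f a) := hdim.comp hf
  have hp {α : Type} [Primcodable α] {f : α → List ℕ} (hf : Primrec f) :
    Primrec fun a => cap (f a) := hcap.comp hf
  intro f hf
  simp only [radixPass, List.mem_append, List.mem_singleton] at hf
  rcases hf with (hf | rfl) | rfl
  · refine primrec_scan hbr hdim ?_ ?_ D f hf
    · unfold histogram digit; fun_prop
    · unfold smallerTotals; fun_prop
  · unfold relabel digit; fun_prop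
  · exact primrec_route (by fun_prop) (by fun_prop)

variable {ι : Type*} {p : List ℕ} {M S B D T H : ℕ} {c : Config M} {E : Finset ι}
  {key val pos loc : ι → ℕ}

/-- The word that stores an item. -/
def item (pos key val : ι → ℕ) (e : ι) : ℕ := word 0 (pos e) (key e) (val e)

/-- The elements before `e` in the order by digit and then position are of three kinds: smaller
digit anywhere, equal digit on an earlier machine, equal digit and smaller position on the same
machine. The first two counts come from a scan, with the first as initial value, and the third is
local. -/
theorem rank_lex_eq (dig : ι → ℕ)
    (hloc : ∀ e ∈ E, ∀ e' ∈ E, loc e < loc e' → pos e < pos e')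
    (hM : ∀ e ∈ E, loc e < M) {e : ι} (he : e ∈ E) :
    (∑ c' ∈ Finset.range (dig e), ∑ x : Fin M,
        ∑ e' ∈ E, if loc e' = x then (if dig e' = c' then 1 else 0) else 0) +
      (∑ x : Fin M, if (x : ℕ) < loc e then
        (∑ e' ∈ E, if loc e' = x then (if dig e' = dig e then 1 else 0) else 0) else 0) +
      (∑ e' ∈ E, if loc e' = loc e then (if dig e' = dig e ∧ pos e' < pos e then 1 else 0) else 0) =
    rank E (fun e => toLex (dig e, pos e)) e := by
  have hfin : ∀ (e' : ι) (g : ℕ → ℕ), e' ∈ E →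
      (∑ x : Fin M, if loc e' = (x : ℕ) then g x else 0) = g (loc e') := by
    intro e' g he'
    rw [Finset.sum_eq_single (⟨loc e', hM e' he'⟩ : Fin M)]
    · simp
    · intro b _ hb
      rw [if_neg]
      exact fun h => hb (Fin.ext h.symm)
    · simp
  have h1 : (∑ c' ∈ Finset.range (dig e), ∑ x : Fin M,
      ∑ e' ∈ E, if loc e' = x then (if dig e' = c' then 1 else 0) else 0) =
      ∑ e' ∈ E, if dig e' < dig e then 1 else 0 := by
    have : ∀ c' ∈ Finset.range (dig e), (∑ x : Fin M,
        ∑ e' ∈ E, if loc e' = x then (if dig e' = c' then 1 else 0) else 0) =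
        ∑ e' ∈ E, if dig e' = c' then 1 else 0 := by
      intro c' _
      rw [Finset.sum_comm]
      exact Finset.sum_congr rfl fun e' he' => hfin e' (fun _ => if dig e' = c' then 1 else 0) he'
    rw [Finset.sum_congr rfl this, Finset.sum_comm]
    refine Finset.sum_congr rfl fun e' _ => ?_
    simp
  have h2 : (∑ x : Fin M, if (x : ℕ) < loc e then
        (∑ e' ∈ E, if loc e' = x then (if dig e' = dig e then 1 else 0) else 0) else 0) =
      ∑ e' ∈ E, if loc e' < loc e ∧ dig e' = dig e then 1 else 0 := by
    have : ∀ x : Fin M, (if (x : ℕ) < loc e then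
        (∑ e' ∈ E, if loc e' = x then (if dig e' = dig e then 1 else 0) else 0) else 0) =
        ∑ e' ∈ E, if loc e' = x then (if (x : ℕ) < loc e ∧ dig e' = dig e then 1 else 0)
          else 0 := by
      intro x
      split_ifs with h <;> simp [h]
    rw [Finset.sum_congr rfl fun x _ => this x, Finset.sum_comm]
    exact Finset.sum_congr rfl fun e' he' =>
      hfin e' (fun x => if x < loc e ∧ dig e' = dig e then 1 else 0) he'
  rw [h1, h2, rank, Finset.card_filter, ← Finset.sum_add_distrib, ← Finset.sum_add_distrib]
  refine Finset.sum_congr rfl fun e' he' => ?_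
  simp only [Prod.Lex.toLex_lt_toLex]
  have h3 := hloc e' he' e he
  have h4 := hloc e he e' he'
  by_cases hd : dig e' < dig e
  · simp [hd, hd.ne]
  · by_cases hd' : dig e' = dig e
    · rcases lt_trichotomy (loc e') (loc e) with h | h | h
      · simp [hd', h, h.ne, h3 h]
      · simp [hd', h]
      · have := h4 h
        simp [hd', h.not_gt, h.ne', this.le]
    · simp [hd, hd']

/-- The new positions are ranks, hence distinct and below `E.card`. Dividing by `cap p` therefore
puts at most `cap p` items on a machine. -/
theorem exec_radixPass (hu : 0 < br p) (hd : 0 < dim p) (hcap : 0 < cap p)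
    (hM : M ≤ br p ^ D) (hinj : Set.InjOn pos E)
    (hloc : ∀ e ∈ E, ∀ e' ∈ E, loc e < loc e' → pos e < pos e') (hlocM : ∀ e ∈ E, loc e < M)
    (hEM : E.card ≤ cap p * M)
    (hcard : ∀ m : Fin M, (E.filter fun e => loc e = m).card ≤ H) (hcapH : cap p ≤ H)
    (hS : H + ((D + 1) * (br p * dim p) + dim p) ≤ S)
    (hD : 3 + D < T) (hMT : M ≤ T) (hqT : dim p ≤ T) (hET : E.card < T)
    (hT : ∀ e ∈ E, pos e < T ∧ key e < T ∧ val e < T) (hB : T ^ 8 ≤ B)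
    (hc : Holds c fun m => placed E (item pos key val) loc m) (k : ℕ) :
    ∃ c', Exec p S B (radixPass br dim cap D k) c c' ∧ Holds c' fun m =>
      placed E (item (rank E fun e => toLex (digit (dim p) k (key e), pos e)) key val)
        (fun e => rank E (fun e => toLex (digit (dim p) k (key e), pos e)) e / cap p) m := by
  set dig : ι → ℕ := fun e => digit (dim p) k (key e) with hdig
  set npos := rank E fun e => toLex (dig e, pos e) with hnpos
  have hdlt : ∀ e, dig e < dim p := fun e => Nat.mod_lt _ hd
  set v : Fin M → ℕ → ℕ := fun m i =>
    ∑ e ∈ E, if loc e = m then (if dig e = i then 1 else 0) else 0 with hv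
  -- The guard `c' < dim p` reproduces the default value `0` of `getD` beyond the end of the list of
  -- totals.
  set φ : ℕ → ℕ := fun i => ∑ c' ∈ Finset.range i, (if c' < dim p then ∑ x, v x c' else 0) with hφ
  have hfit : MFits (fun m : Fin M => placed E (item pos key val) loc m) S B :=
    mfits_placed (fun e he => (word_lt (by omega) (hT e he).1 (hT e he).2.1
      (hT e he).2.2).trans_le hB) fun m => (hcard m).trans (by omega)
  have hrank : ∀ e ∈ E, prefixSum v φ (loc e) (dig e) +
      (∑ e' ∈ E, if loc e' = loc e then (if dig e' = dig e ∧ pos e' < pos e then 1 else 0)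
        else 0) = npos e := by
    intro e he
    rw [hnpos, ← rank_lex_eq dig hloc hlocM he, prefixSum]
    congr 2
    refine Finset.sum_congr rfl fun c' hc' => ?_
    rw [if_pos ((Finset.mem_range.1 hc').trans (hdlt e))]
  have hvtot : ∀ i, ∑ x, v x i = ∑ e ∈ E, if dig e = i then 1 else 0 := by
    intro i
    simp only [hv]
    rw [Finset.sum_comm]
    refine Finset.sum_congr rfl fun e he => ?_
    rw [Finset.sum_eq_single (⟨loc e, hlocM e he⟩ : Fin M)]
    · simp
    · intro b _ hb
      rw [if_neg]
      exact fun h => hb (Fin.ext h.symm)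
    · simp
  have hφT : ∀ i < dim p, φ i + ∑ x, v x i < T := by
    intro i hi
    refine lt_of_le_of_lt ?_ hET
    have h1 : φ i + ∑ x, v x i = ∑ c' ∈ Finset.range (i + 1),
        ∑ e ∈ E, if dig e = c' then 1 else 0 := by
      rw [Finset.sum_range_succ, hvtot]
      congr 1
      refine Finset.sum_congr rfl fun c' hc' => ?_
      rw [if_pos ((Finset.mem_range.1 hc').trans hi), hvtot]
    rw [h1, Finset.sum_comm, Finset.card_eq_sum_ones]
    refine Finset.sum_le_sum fun e _ => ?_
    simp only [Finset.sum_ite_eq]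
    split_ifs <;> simp
  have hnpos_lt : ∀ e ∈ E, npos e < E.card := fun e he => rank_lt_card he
  have hninj : Set.InjOn npos E := rank_injOn fun e he e' he' h => by
    simp only [EmbeddingLike.apply_eq_iff_eq, Prod.mk.injEq] at h
    exact hinj he he' h.2
  have hfit1 : MFits (fun m : Fin M => placed E (item npos key val) loc m) S B :=
    mfits_placed (fun e he => (word_lt (by omega) ((hnpos_lt e he).trans hET) (hT e he).2.1
      (hT e he).2.2).trans_le hB) fun m => (hcard m).trans (by omega)
  have hfit2 : MFits (fun m : Fin M => placed E (item npos key val)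
      (fun e => npos e / cap p) m) S B :=
    mfits_placed (fun e he => (word_lt (by omega) ((hnpos_lt e he).trans hET) (hT e he).2.1
      (hT e he).2.2).trans_le hB) fun m => (card_div_eq_le hninj hcap m).trans (by omega)
  unfold radixPass
  refine exec_two (P := fun c' => Holds c' fun m => placed E (item npos key val) loc m)
    (exec_two (exec_scan (v := v) (φ := φ) hu ?_ hM ?_ ?_ hfit ?_ hD hMT hqT ?_ hφT
    hB hc) fun c' hf' hc' => ?_) fun c' _ hc' => ?_
  · intro m w hw
    obtain ⟨e, -, -, rfl⟩ := mem_placed.1 hw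
    simp [item]
  · intro m i
    simp only [histogram]
    rw [sum_map_filter, hc m, tot_placed]
    simp [item, hv, hdig]
  · intro i
    simp only [smallerTotals, hφ]
    rw [sum_map_range]
    refine Finset.sum_congr rfl fun c' _ => ?_
    split_ifs with h <;> simp [h]
  · intro m
    rw [card_placed]
    exact (Nat.add_le_add_right (hcard m) _).trans hS
  · omega
  · refine ⟨_, exec_local _ hf' (fun m => rfl) (fun m => ?_) hfit1⟩
    · simp only [relabel]
      rw [← Multiset.map_coe, coe_filter, hc' m, Multiset.filter_add, Multiset.filter_eq_self.2,
        Multiset.filter_eq_nil.2, add_zero, map_placed]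
      · refine placed_congr (fun _ _ => rfl) fun e he hem => ?_
        simp only [item, fy_word, fz_word, fx_word]
        congr 1
        rw [← hrank e he, sum_map_filter, sum_map_filter, hc' m, tot_add, tot_add,
          tot_prefixes _ _ (hdlt e), tot_eq_zero, zero_add, tot_eq_zero (X := prefixes _ _ _ _),
          add_zero, tot_placed, hem]
        · simp [item, hdig]
        · intro w hw
          simp [tag_prefixes hw]
        · intro w hw
          obtain ⟨e, -, -, rfl⟩ := mem_placed.1 hw
          simp [item]
      · intro w hw
        simp [tag_prefixes hw]
      · intro w hw
        obtain ⟨e, -, -, rfl⟩ := mem_placed.1 hw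
        simp [item]
  · have h := exec_route (p := p) (kp := fun _ _ => true) (ds := fun p i => i / cap p)
      hc' hlocM hfit1
    simp only [item, fx_word, Finset.filter_true] at h hfit2 ⊢
    refine h (fun e he _ => ?_) hfit2
    rw [Nat.div_lt_iff_lt_mul hcap, mul_comm]
    exact (hnpos_lt e he).trans_le hEM

end Radix

end MPC

/-! ### Sorting by all digits, and decoding of the input. -/

namespace MPC

section Sorting

variable {br dim cap : List ℕ → ℕ} {p : List ℕ} {M S B D T H : ℕ}

theorem exec_radixSort {ι : Type*} {c : Config M} {E : Finset ι} {key val pos loc : ι → ℕ}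
    (hu : 0 < br p) (hd : 0 < dim p) (hcap : 0 < cap p)
    (hM : M ≤ br p ^ D) (hinj : Set.InjOn pos E)
    (hloc : ∀ e ∈ E, ∀ e' ∈ E, loc e < loc e' → pos e < pos e') (hlocM : ∀ e ∈ E, loc e < M)
    (hEM : E.card ≤ cap p * M)
    (hcard : ∀ m : Fin M, (E.filter fun e => loc e = m).card ≤ H) (hcapH : cap p ≤ H)
    (hS : H + ((D + 1) * (br p * dim p) + dim p) ≤ S)
    (hD : 3 + D < T) (hMT : M ≤ T) (hqT : dim p ≤ T) (hET : E.card < T)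
    (hT : ∀ e ∈ E, pos e < T ∧ key e < T ∧ val e < T) (hB : T ^ 8 ≤ B)
    (hkey : ∀ e ∈ E, key e < dim p ^ D) (hD0 : 0 < D)
    (hc : Holds c fun m => placed E (item pos key val) loc m) :
    ∃ c', Exec p S B ((List.range D).flatMap (radixPass br dim cap D)) c c' ∧
      ∃ pos' : ι → ℕ, Set.InjOn pos' E ∧ (∀ e ∈ E, pos' e < E.card) ∧
        (∀ e ∈ E, ∀ e' ∈ E, key e < key e' → pos' e < pos' e') ∧
        Holds c' fun m => placed E (item pos' key val) (fun e => pos' e / cap p) m := by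
  -- After `k` passes the positions respect the order of the keys modulo `dim p ^ k`. The placement
  -- `pos / cap` holds only after some pass, because the input is distributed arbitrarily; hence `0
  -- < D` is needed.
  refine Exists.elim (exec_iterate
    (p := p) (S := S) (B := B) (radixPass br dim cap D)
    (fun k c => ∃ pos loc : ι → ℕ, (Holds c fun m => placed E (item pos key val) loc m) ∧
      Set.InjOn pos E ∧ (∀ e ∈ E, ∀ e' ∈ E, loc e < loc e' → pos e < pos e') ∧
      (∀ e ∈ E, loc e < M) ∧ (∀ m : Fin M, (E.filter fun e => loc e = m).card ≤ H) ∧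
      (∀ e ∈ E, pos e < T) ∧
      (∀ e ∈ E, ∀ e' ∈ E, key e % dim p ^ k < key e' % dim p ^ k → pos e < pos e') ∧
      (0 < k → ∀ e ∈ E, pos e < E.card ∧ loc e = pos e / cap p)) D
    (fun k hk c hI => ?_) (fun c hI => ?_) c
    ⟨pos, loc, hc, hinj, hloc, hlocM, hcard, fun e he => (hT e he).1, by simp [Nat.mod_one],
      fun h => absurd h (by simp)⟩) ?_
  · obtain ⟨pos, loc, hc, hinj, hloc, hlocM, hcard, hpT, hmono, -⟩ := hI
    obtain ⟨c', hx, hc'⟩ := exec_radixPass hu hd hcap hM hinj hloc hlocM hEM hcard hcapH hS hD hMT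
      hqT hET (fun e he => ⟨hpT e he, (hT e he).2⟩) hB hc k
    have hlt : ∀ e ∈ E, rank E (fun e => toLex (digit (dim p) k (key e), pos e)) e < E.card :=
      fun e he => rank_lt_card he
    have hinj' : Set.InjOn (rank E fun e => toLex (digit (dim p) k (key e), pos e)) E :=
      rank_injOn fun e he e' he' h => by
        simp only [EmbeddingLike.apply_eq_iff_eq, Prod.mk.injEq] at h
        exact hinj he he' h.2
    refine ⟨c', hx, _, _, hc', hinj', fun e _ e' _ h => ?_, fun e he => ?_,
      fun m => (card_div_eq_le hinj' hcap m).trans hcapH, fun e he => (hlt e he).trans hET,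
      fun e he e' he' h => rank_lt_rank he ?_, fun _ e he => ⟨hlt e he, rfl⟩⟩
    · by_contra h'
      exact absurd (Nat.div_le_div_right (not_lt.1 h')) (not_le.2 h)
    · rw [Nat.div_lt_iff_lt_mul hcap, mul_comm]
      exact (hlt e he).trans_le hEM
    · rw [Prod.Lex.toLex_lt_toLex]
      -- Digit number `k` decides first. If it is equal, the lower digits decide, and the pass
      -- preserves their order because ties are broken by the old position.
      rw [Nat.mod_pow_succ, Nat.mod_pow_succ] at h
      have hpos : 0 < dim p ^ k := pow_pos hd k
      change key e % dim p ^ k + dim p ^ k * digit (dim p) k (key e) <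
        key e' % dim p ^ k + dim p ^ k * digit (dim p) k (key e') at h
      rcases lt_trichotomy (digit (dim p) k (key e)) (digit (dim p) k (key e')) with h1 | h1 | h1
      · exact Or.inl h1
      · rw [h1] at h
        exact Or.inr ⟨h1, hmono e he e' he' (by omega)⟩
      · have h2 := Nat.mul_le_mul_left (dim p ^ k) h1
        have h3 := Nat.mod_lt (key e') hpos
        rw [Nat.succ_eq_add_one, mul_add, mul_one] at h2
        generalize key e % dim p ^ k = a at h
        generalize key e' % dim p ^ k = a' at h h3
        omega
  · obtain ⟨pos, loc, hc, -, -, -, hcard, hpT, -⟩ := hI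
    exact hc.fits (mfits_placed (fun e he => (word_lt (by omega) (hpT e he) (hT e he).2.1
      (hT e he).2.2).trans_le hB) fun m => (hcard m).trans (by omega))
  · rintro c' ⟨h1, pos', loc', h2, h3, -, -, -, -, h4, h5⟩
    have h6 := h5 hD0
    refine ⟨c', h1, pos', h3, fun e he => (h6 e he).1, fun e he e' he' h => ?_, fun m => ?_⟩
    · refine h4 e he e' he' ?_
      rwa [Nat.mod_eq_of_lt (hkey e he), Nat.mod_eq_of_lt (hkey e' he')]
    · rw [h2 m]
      exact placed_congr (fun e he => (h6 e he).2) fun _ _ _ => rfl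

/-- The pairs in the memory are turned into items. -/
def decodeInput : Local := fun x =>
  ((List.range (x.2.2.length / 2)).map fun k => word 0 (x.2.1 * x.1.getD 2 0 + k)
    (x.2.2.getD (2 * k) 0) (x.2.2.getD (2 * k + 1) 0), [])

theorem primrec_decodeInput : Primrec decodeInput := by
  unfold decodeInput; fun_prop

theorem length_encode {n : ℕ} (l : List (Fin n × Fin n)) :
    (Leaders.encode l).length = 2 * l.length := by
  induction l with
  | nil => rfl
  | cons a l ih =>
    simp only [Leaders.encode, List.flatMap_cons, List.length_append, List.length_cons] at ih ⊢
    simp [ih]; omega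

theorem getD_encode {n : ℕ} (l : List (Fin n × Fin n)) (k : ℕ) (hk : k < l.length) :
    (Leaders.encode l).getD (2 * k) 0 = l[k].1 ∧
      (Leaders.encode l).getD (2 * k + 1) 0 = l[k].2 := by
  induction l generalizing k with
  | nil => simp at hk
  | cons a l ih =>
    cases k with
    | zero => simp [Leaders.encode]
    | succ k =>
      have := ih k (by simpa using hk)
      simpa [Leaders.encode, mul_add] using this

/-- The decoded items and their initial positions. -/
theorem exec_decodeInput {n : ℕ} {F : Fin n → Finset (Fin n)}
    {inp : Fin M → List (Fin n × Fin n)} (hinp : Leaders.IsDistribution F inp)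
    (hlen : ∀ m, (Leaders.encode (inp m)).length ≤ S) (hpS : p.getD 2 0 = S)
    (hnT : n ≤ T) (hT : S * M ≤ T) (hT0 : 0 < T) (hB : T ^ 8 ≤ B) :
    ∃ c', Exec p S B [decodeInput] (fun m => Leaders.encode (inp m)) c' ∧
      ∃ pos loc : Fin n × Fin n → ℕ,
        let E := Finset.univ.filter fun e : Fin n × Fin n => e.2 ∈ F e.1
        (Holds c' fun m => placed E (item pos (fun e => e.1) (fun e => e.2)) loc m) ∧
        Set.InjOn pos E ∧ (∀ e ∈ E, ∀ e' ∈ E, loc e < loc e' → pos e < pos e') ∧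
        (∀ e ∈ E, loc e < M) ∧ (∀ e ∈ E, pos e < S * M) ∧
        ∀ m : Fin M, (E.filter fun e => loc e = m).card ≤ S / 2 := by
  classical
  set E := Finset.univ.filter fun e : Fin n × Fin n => e.2 ∈ F e.1 with hE
  have hcount : ∀ e ∈ E, ∑ m, Multiset.count e (inp m : Multiset (Fin n × Fin n)) = 1 := by
    intro e he
    have := congrArg (Multiset.count e) hinp
    rw [Multiset.count_sum'] at this
    exact this.trans (Multiset.count_eq_one_of_mem E.nodup he)
  have hmemE : ∀ m, ∀ e ∈ inp m, e ∈ E := by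
    intro m e he
    have h1 : e ∈ ∑ m, (inp m : Multiset (Fin n × Fin n)) :=
      Multiset.mem_sum.2 ⟨m, Finset.mem_univ m, he⟩
    rw [hinp] at h1
    exact h1
  have hex : ∀ e, ∃ m : ℕ, e ∈ E → ∃ h : m < M, e ∈ inp ⟨m, h⟩ := by
    intro e
    by_cases he : e ∈ E
    · have := hcount e he
      obtain ⟨m, -, hm⟩ := Finset.exists_ne_zero_of_sum_ne_zero (this.trans_ne one_ne_zero)
      exact ⟨m, fun _ => ⟨m.2, Multiset.count_pos.1 (Nat.pos_of_ne_zero hm)⟩⟩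
    · exact ⟨0, fun h => absurd h he⟩
  choose loc hloc using hex
  have hle1 : ∀ m e, Multiset.count e (inp m : Multiset (Fin n × Fin n)) ≤ 1 := by
    intro m e
    by_cases he : e ∈ E
    · rw [← hcount e he]
      exact Finset.single_le_sum (f := fun m => Multiset.count e (inp m : Multiset (Fin n × Fin n)))
        (fun _ _ => Nat.zero_le _)
        (Finset.mem_univ m)
    · rw [Multiset.count_eq_zero_of_notMem fun h => he (hmemE m e h)]
      exact Nat.zero_le _
  have hnodup : ∀ m, (inp m).Nodup := fun m => 
    Multiset.coe_nodup.1 (Multiset.nodup_iff_count_le_one.2 fun e => hle1 m e)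
  have hmem : ∀ m : Fin M, ∀ e, e ∈ inp m ↔ e ∈ E ∧ loc e = m := by
    intro m e
    constructor
    · intro he
      have heE := hmemE m e he
      refine ⟨heE, ?_⟩
      by_contra hne
      obtain ⟨h, he'⟩ := hloc e heE
      have hne' : (⟨loc e, h⟩ : Fin M) ≠ m := fun h' => hne (congrArg Fin.val h')
      have h2 : ∑ x ∈ {(⟨loc e, h⟩ : Fin M), m},
            Multiset.count e (inp x : Multiset (Fin n × Fin n)) ≤
          ∑ x, Multiset.count e (inp x : Multiset (Fin n × Fin n)) :=
        Finset.sum_le_sum_of_subset (Finset.subset_univ _)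
      rw [Finset.sum_pair hne', hcount e heE] at h2
      have h3 := Multiset.count_pos.2 (Multiset.mem_coe.2 he)
      have h4 := Multiset.count_pos.2 (Multiset.mem_coe.2 he')
      omega
    · rintro ⟨heE, h⟩
      obtain ⟨h', he⟩ := hloc e heE
      have : (⟨loc e, h'⟩ : Fin M) = m := Fin.ext h
      rwa [this] at he
  have hfilter : ∀ m : Fin M, (E.filter fun e => loc e = m) = (inp m).toFinset := by
    intro m
    ext e
    rw [Finset.mem_filter, List.mem_toFinset, hmem]
  have hlen' : ∀ m, 2 * (inp m).length ≤ S := fun m => by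
    rw [← length_encode]
    exact hlen m
  set idx : Fin n × Fin n → ℕ := fun e =>
    if h : loc e < M then (inp ⟨loc e, h⟩).idxOf e else 0 with hidx
  have hidx' : ∀ m : Fin M, ∀ e ∈ inp m, idx e = (inp m).idxOf e := by
    intro m e he
    have h1 := ((hmem m e).1 he).2
    have h2 : loc e < M := h1 ▸ m.2
    simp only [hidx, dif_pos h2]
    congr 2
    exact Fin.ext h1
  have hlocM : ∀ e ∈ E, loc e < M := fun e he => (hloc e he).1
  have hidxS : ∀ e ∈ E, idx e < S := by
    intro e he
    obtain ⟨h, he'⟩ := hloc e he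
    rw [hidx' ⟨loc e, h⟩ e he']
    have h1 := List.idxOf_lt_length_of_mem he'
    have h2 := hlen' ⟨loc e, h⟩
    omega
  -- Initial positions need not be consecutive: each machine owns `S` numbers, which makes positions
  -- distinct and monotone in the machine without communication.
  set pos : Fin n × Fin n → ℕ := fun e => loc e * S + idx e with hpos
  have hposlt : ∀ e ∈ E, pos e < S * M := by
    intro e he
    have h1 := hidxS e he
    have h2 := Nat.mul_le_mul_right S (hlocM e he)
    rw [Nat.succ_mul] at h2
    simp only [hpos]
    rw [mul_comm S M]
    omega
  have hcard : ∀ m : Fin M, (E.filter fun e => loc e = m).card ≤ S / 2 := by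
    intro m
    rw [hfilter, List.toFinset_card_of_nodup (hnodup m)]
    have := hlen' m
    omega
  have hfit : MFits (fun m : Fin M => placed E (item pos (fun e => e.1) (fun e => e.2)) loc m)
      S B :=
    mfits_placed (fun e he => (word_lt hT0 ((hposlt e he).trans_le hT) (e.1.2.trans_le hnT)
      (e.2.2.trans_le hnT)).trans_le hB) fun m => (hcard m).trans (Nat.div_le_self _ _)
  have hfit0 : Fits (fun m => Leaders.encode (inp m)) S B := by
    refine fun m => ⟨hlen m, fun w hw => ?_⟩
    have hTB : T ≤ B := (Nat.le_self_pow (by norm_num) T).trans hB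
    simp only [Leaders.encode, List.mem_flatMap] at hw
    obtain ⟨e, -, hw⟩ := hw
    have h1 := e.1.2
    have h2 := e.2.2
    simp only [List.mem_cons, List.not_mem_nil, or_false] at hw
    omega
  have hret : ∀ m : Fin M, ((decodeInput (p, m, Leaders.encode (inp m))).1 : Multiset ℕ) =
      placed E (item pos (fun e => e.1) (fun e => e.2)) loc m := by
    intro m
    simp only [decodeInput, hpS, length_encode]
    rw [Nat.mul_div_cancel_left _ two_pos, placed, ← Finset.sum_filter, hfilter m,
      List.sum_toFinset _ (hnodup m)]
    have h1 : (inp m).map (item pos (fun e => (e.1 : ℕ)) fun e => (e.2 : ℕ)) =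
        (List.range (inp m).length).map fun k => word 0 (m * S + k)
          ((Leaders.encode (inp m)).getD (2 * k) 0)
          ((Leaders.encode (inp m)).getD (2 * k + 1) 0) := by
      refine List.ext_getElem (by simp) fun k hk _ => ?_
      have hk' : k < (inp m).length := by simpa using hk
      have h2 := getD_encode (inp m) k hk'
      have h3 := (hmem m _).1 (List.getElem_mem hk')
      simp only [List.getElem_map, List.getElem_range, h2, item, hpos,
        hidx' m _ (List.getElem_mem hk'), h3.2, (hnodup m).idxOf_getElem]
    rw [← h1]
    induction inp m with
    | nil => rfl
    | cons a l ih => simp [← ih]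
  obtain ⟨h1, h2⟩ := exec_local (p := p) (f := decodeInput)
    (fun m : Fin M => placed E (item pos (fun e => e.1) (fun e => e.2)) loc m) hfit0
    (fun m => rfl) hret hfit
  refine ⟨_, h1, pos, loc, h2, ?_, ?_, hlocM, hposlt, hcard⟩
  · intro e he e' he' h
    have hS : 0 < S := (Nat.zero_le _).trans_lt (hidxS e he)
    have hl : loc e = loc e' := by
      have h3 : pos e / S = loc e := by
        simp only [hpos]
        rw [mul_comm, Nat.mul_add_div hS, Nat.div_eq_of_lt (hidxS e he), add_zero]
      have h4 : pos e' / S = loc e' := by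
        simp only [hpos]
        rw [mul_comm, Nat.mul_add_div hS, Nat.div_eq_of_lt (hidxS e' he'), add_zero]
      rw [← h3, ← h4, h]
    have hi : idx e = idx e' := by
      simp only [hpos, hl] at h
      omega
    obtain ⟨hl1, hm1⟩ := hloc e he
    have hm2 : e' ∈ inp ⟨loc e, hl1⟩ := (hmem _ _).2 ⟨he', hl.symm⟩
    rw [hidx' _ e hm1, hidx' _ e' hm2] at hi
    exact (List.idxOf_inj hm1).1 hi
  · intro e he e' he' h
    have h3 := hidxS e he
    have h4 := Nat.mul_le_mul_right S h
    rw [Nat.succ_mul] at h4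
    simp only [hpos]
    omega

end Sorting

end MPC

/-! ### Equally many elements of every set, gathered on one machine. -/

namespace MPC

/-- The pairs are sorted by their first components, and of every set some elements are collected on
one machine. -/
def sortSets (br dim cap trim grp : List ℕ → ℕ) (D : ℕ) : List Local :=
  [decodeInput] ++ (List.range D).flatMap (radixPass br dim cap D) ++
    [route (fun p i => decide (i % p.getD 1 0 < trim p)) fun p i => i / p.getD 1 0 / grp p]

variable {br dim cap trim grp : List ℕ → ℕ} {p : List ℕ} {M S B D T H : ℕ}

theorem primrec_sortSets (hbr : Primrec br) (hdim : Primrec dim) (hcap : Primrec cap)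
    (htrim : Primrec trim) (hgrp : Primrec grp) (D : ℕ) :
    ∀ f ∈ sortSets br dim cap trim grp D, Primrec f := by
  intro f hf
  simp only [sortSets, List.mem_append, List.mem_singleton, List.mem_flatMap] at hf
  rcases hf with (rfl | ⟨k, -, hf⟩) | rfl
  · exact primrec_decodeInput
  · exact primrec_radixPass hbr hdim hcap D k f hf
  · have h1 {α : Type} [Primcodable α] {f : α → List ℕ} (hf : Primrec f) :
      Primrec fun a => trim (f a) := htrim.comp hf
    have h2 {α : Type} [Primcodable α] {f : α → List ℕ} (hf : Primrec f) :
      Primrec fun a => grp (f a) := hgrp.comp hf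
    exact primrec_route (by fun_prop) (by fun_prop)

/-- The `b` elements with key `i` occupy all positions from `i * b` to `i * b + b - 1`, so exactly
`t` of them have a remainder below `t`. -/
theorem card_fiber_trim {ι : Type*} {E : Finset ι} {key pos : ι → ℕ} {b t : ℕ} (htb : t ≤ b)
    (hinj : Set.InjOn pos E) (hpos : ∀ e ∈ E, pos e / b = key e) {i : ℕ}
    (hi : (E.filter fun e => key e = i).card = b) :
    ((E.filter fun e => pos e % b < t).filter fun e => key e = i).card = t := by
  classical
  rcases Nat.eq_zero_or_pos b with rfl | hb
  · have := Finset.card_le_card (s := ((E.filter fun e => pos e % 0 < t).filter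
      fun e => key e = i)) (t := E.filter fun e => key e = i)
      (Finset.filter_subset_filter _ (Finset.filter_subset _ _))
    omega
  have hinj' : Set.InjOn pos (E.filter fun e => key e = i) :=
    hinj.mono fun x hx => (Finset.mem_filter.1 hx).1
  have himg : (E.filter fun e => key e = i).image pos = Finset.Ico (i * b) (i * b + b) := by
    refine Finset.eq_of_subset_of_card_le (fun x hx => ?_) ?_
    · obtain ⟨e, he, rfl⟩ := Finset.mem_image.1 hx
      obtain ⟨h1, h2⟩ := Finset.mem_filter.1 he
      have h3 := hpos e h1
      rw [h2, Nat.div_eq_iff hb] at h3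
      simp; omega
    · rw [Finset.card_image_of_injOn hinj', hi]
      simp
  have himg' : ((E.filter fun e => pos e % b < t).filter fun e => key e = i).image pos =
      Finset.Ico (i * b) (i * b + t) := by
    ext x
    simp only [Finset.mem_image, Finset.mem_filter]
    constructor
    · rintro ⟨e, ⟨⟨h1, h2⟩, h3⟩, rfl⟩
      have h4 := hpos e h1
      have h5 := Nat.div_add_mod (pos e) b
      rw [h4, h3, mul_comm] at h5
      simp; omega
    · intro hx
      have hx' := Finset.mem_Ico.1 hx
      have h1 : x ∈ (E.filter fun e => key e = i).image pos := by
        rw [himg]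
        simp; omega
      obtain ⟨e, he, rfl⟩ := Finset.mem_image.1 h1
      obtain ⟨h2, h3⟩ := Finset.mem_filter.1 he
      have h4 := hpos e h2
      have h5 := Nat.div_add_mod (pos e) b
      rw [h4, h3, mul_comm] at h5
      exact ⟨e, ⟨⟨h2, by omega⟩, h3⟩, rfl⟩
  have := congrArg Finset.card himg'
  rw [Finset.card_image_of_injOn] at this
  · simpa using this
  · refine hinj.mono fun x hx => ?_
    have hx : x ∈ (E.filter fun e => pos e % b < t).filter fun e => key e = i := hx
    exact (Finset.mem_filter.1 (Finset.mem_filter.1 hx).1).1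

theorem card_grouped_le {n t g : ℕ} {E : Finset (Fin n × Fin n)} (hg : 0 < g)
    (h : ∀ i, (E.filter fun e => e.1 = i).card ≤ t) (m : ℕ) :
    (E.filter fun e => (e.1 : ℕ) / g = m).card ≤ g * t := by
  classical
  have h1 := Finset.card_le_mul_card_image_of_maps_to (f := fun e : Fin n × Fin n => e.1)
    (s := E.filter fun e : Fin n × Fin n => (e.1 : ℕ) / g = m)
    (t := Finset.univ.filter fun i : Fin n => (i : ℕ) / g = m) (fun e he => by
      simpa using (Finset.mem_filter.1 he).2) t (fun i _ => (Finset.card_le_card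
        (Finset.filter_subset_filter _ (Finset.filter_subset _ _))).trans (h i))
  refine h1.trans ?_
  rw [mul_comm]
  exact Nat.mul_le_mul_right t (card_div_eq_le (Fin.val_injective.injOn) hg m)

/-- After sorting, the position `i` alone reveals the key as `i / b`. The route can therefore trim a
set by `i % b` and send what is left to the machine of its group of `grp p` consecutive indices. -/
theorem exec_sortSets {n b : ℕ} {F : Fin n → Finset (Fin n)} (hF : ∀ i, (F i).card = b)
    {inp : Fin M → List (Fin n × Fin n)} (hinp : Leaders.IsDistribution F inp)
    (hlen : ∀ m, (Leaders.encode (inp m)).length ≤ S)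
    (hpb : p.getD 1 0 = b) (hpS : p.getD 2 0 = S)
    (hu : 0 < br p) (hd : 0 < dim p) (hcap : 0 < cap p) (hgrp : 0 < grp p)
    (hM : M ≤ br p ^ D) (hEM : n * b ≤ cap p * M) (hgM : n ≤ grp p * M)
    (hSH : S / 2 ≤ H) (hcapH : cap p ≤ H) (htrim : trim p ≤ b) (hgrpS : grp p * trim p ≤ S)
    (hS : H + ((D + 1) * (br p * dim p) + dim p) ≤ S)
    (hD : 3 + D < T) (hMT : M ≤ T) (hqT : dim p ≤ T) (hET : n * b < T) (hnT : n ≤ T)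
    (hT : S * M ≤ T) (hB : T ^ 8 ≤ B) (hkey : n ≤ dim p ^ D) (hD0 : 0 < D) :
    ∃ c', Exec p S B (sortSets br dim cap trim grp D) (fun m => Leaders.encode (inp m)) c' ∧
      ∃ (pos : Fin n × Fin n → ℕ) (E : Finset (Fin n × Fin n)), (∀ e ∈ E, e.2 ∈ F e.1) ∧
        (∀ e ∈ E, pos e < T) ∧ (∀ i, (E.filter fun e => e.1 = i).card = trim p) ∧
        Holds c' fun m => placed E (item pos (fun e => e.1) fun e => e.2)
          (fun e => (e.1 : ℕ) / grp p) m := by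
  set E := Finset.univ.filter fun e : Fin n × Fin n => e.2 ∈ F e.1 with hE
  have hfib : ∀ i : Fin n, (E.filter fun e => e.1 = i).card = b := by
    intro i
    rw [← hF i]
    refine Finset.card_bij (fun e _ => e.2) (fun e he => ?_) (fun e he e' he' h => ?_)
      fun j hj => ⟨(i, j), by simp [hE, hj], rfl⟩
    · obtain ⟨h1, rfl⟩ := Finset.mem_filter.1 he
      simpa [hE] using h1
    · have h1 := (Finset.mem_filter.1 he).2
      have h2 := (Finset.mem_filter.1 he').2
      exact Prod.ext (h1.trans h2.symm) h
  have hEcard : E.card = n * b := by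
    rw [Finset.card_eq_sum_card_fiberwise (f := Prod.fst) (t := Finset.univ) (by simp)]
    simp [hfib]
  have hfib' : ∀ i < n, (E.filter fun e => (e.1 : ℕ) = i).card = b := by
    intro i hi
    rw [← hfib ⟨i, hi⟩]
    congr 1
    ext e
    simp [Fin.ext_iff]
  unfold sortSets
  refine exec_two (P := fun c' => ∃ pos' : Fin n × Fin n → ℕ, Set.InjOn pos' E ∧
    (∀ e ∈ E, pos' e < E.card) ∧
    (∀ e ∈ E, ∀ e' ∈ E, (e.1 : ℕ) < (e'.1 : ℕ) → pos' e < pos' e') ∧ Holds c' fun m =>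
      placed E (item pos' (fun e => e.1) fun e => e.2) (fun e => pos' e / cap p) m)
    (exec_two (exec_decodeInput hinp hlen hpS hnT hT (by omega) hB) ?_) ?_
  · rintro c' - ⟨pos, loc, hc, hinj, hloc, hlocM, hpos, hcard⟩
    exact exec_radixSort hu hd hcap hM hinj hloc hlocM (hEcard.trans_le hEM)
      (fun m => (hcard m).trans hSH) hcapH hS hD hMT hqT (hEcard.trans_lt hET)
      (fun e he => ⟨(hpos e he).trans_le hT, e.1.2.trans_le hnT, e.2.2.trans_le hnT⟩) hB
      (fun e _ => e.1.2.trans_le hkey) hD0 hc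
  · rintro c' hf' ⟨pos, hinj, hpos, hmono, hc⟩
    have hdiv : ∀ e ∈ E, pos e / b = (e.1 : ℕ) := fun e he =>
      div_eq_key (n := n) hinj (fun e he => by rw [mul_comm, ← hEcard]; exact hpos e he)
        (fun e _ => e.1.2) hmono hfib' he
    have hposT : ∀ e ∈ E, pos e < T := fun e he => (hpos e he).trans (hEcard.trans_lt hET)
    have hwd : ∀ e ∈ E, item pos (fun e => (e.1 : ℕ)) (fun e => (e.2 : ℕ)) e < B := fun e he =>
      (word_lt (by omega) (hposT e he) (e.1.2.trans_le hnT) (e.2.2.trans_le hnT)).trans_le hB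
    have hlocM : ∀ e ∈ E, pos e / cap p < M := fun e he => by
      rw [Nat.div_lt_iff_lt_mul hcap, mul_comm]
      exact (hpos e he).trans_le (hEcard.trans_le hEM)
    have hfit : MFits (fun m : Fin M => placed E (item pos (fun e => e.1) fun e => e.2)
        (fun e => pos e / cap p) m) S B := hc.mfits hf'
    have hfib2 : ∀ i, ((E.filter fun e => pos e % b < trim p).filter
        fun e => e.1 = i).card = trim p := by
      intro i
      refine Eq.trans (congrArg Finset.card ?_)
        (card_fiber_trim (i := i) htrim hinj hdiv (hfib' i i.2))
      ext e
      simp [Fin.ext_iff]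
    have hfit' : MFits (fun m : Fin M => placed (E.filter fun e => pos e % b < trim p)
        (item pos (fun e => e.1) fun e => e.2) (fun e => pos e / b / grp p) m) S B := by
      refine mfits_placed (fun e he => hwd e (Finset.mem_filter.1 he).1) fun m => ?_
      refine le_trans (le_of_eq ?_) ((card_grouped_le hgrp (fun i => (hfib2 i).le) m).trans hgrpS)
      congr 1
      refine Finset.filter_congr fun e he => ?_
      rw [hdiv e (Finset.mem_filter.1 he).1]
    have h := exec_route (p := p) (kp := fun p i => decide (i % p.getD 1 0 < trim p))
      (ds := fun p i => i / p.getD 1 0 / grp p) hc hlocM hfit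
    simp only [item, fx_word, hpb, decide_eq_true_eq] at h hfit' ⊢
    obtain ⟨c'', h1, h2⟩ := h (fun e he _ => by
      rw [hdiv e he, Nat.div_lt_iff_lt_mul hgrp, mul_comm]
      exact e.1.2.trans_le hgM) hfit'
    refine ⟨c'', h1, pos, _, fun e he => ?_, fun e he => hposT e (Finset.mem_filter.1 he).1,
      hfib2, fun m => ?_⟩
    · simpa [hE] using (Finset.mem_filter.1 he).1
    · rw [h2 m]
      exact placed_congr (fun e he => by rw [hdiv e (Finset.mem_filter.1 he).1]) fun _ _ _ => rfl

end MPC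

namespace MPC

/-! ### Families of sets that hit most sets of a given size -/

/-- A function `g` picks one residue in every block, independently. To avoid `X`, it has to avoid in
each block the residues of the elements of `X` there, so the count is a product over the blocks. -/
theorem card_avoiding_le {n d nb : ℕ} (hd : 0 < d) (hnb : ∀ j : Fin n, (j : ℕ) / d < nb)
    (X : Finset (Fin n)) :
    ((Finset.univ.filter fun g : Fin nb → Fin d =>
      ∀ j ∈ X, (g ⟨(j : ℕ) / d, hnb j⟩ : ℕ) ≠ j % d).card : ℝ) ≤
      d ^ nb * Real.exp (-(X.card / d)) := by
  classical
  set A : Fin nb → Finset (Fin d) := fun B =>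
    Finset.univ.filter fun a : Fin d => ∀ j ∈ X, (j : ℕ) / d = B → (a : ℕ) ≠ j % d with hA
  set x : Fin nb → ℕ := fun B => (X.filter fun j : Fin n => (j : ℕ) / d = B).card with hx
  have h1 : (Finset.univ.filter fun g : Fin nb → Fin d =>
      ∀ j ∈ X, (g ⟨(j : ℕ) / d, hnb j⟩ : ℕ) ≠ j % d) = Fintype.piFinset A := by
    ext g
    simp only [Finset.mem_filter, Finset.mem_univ, true_and, Fintype.mem_piFinset, hA]
    constructor
    · intro h B j hj hB
      have : (⟨(j : ℕ) / d, hnb j⟩ : Fin nb) = B := Fin.ext hB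
      rw [← this]
      exact h j hj
    · intro h j hj
      exact h _ j hj rfl
  have h2 : ∀ B, (A B).card + x B ≤ d := by
    intro B
    have hinj : Set.InjOn (fun j : Fin n => (⟨(j : ℕ) % d, Nat.mod_lt _ hd⟩ : Fin d))
        (X.filter fun j : Fin n => (j : ℕ) / d = B) := by
      intro j hj j' hj' h
      have e1 : (j : ℕ) / d = B := (Finset.mem_filter.1 hj).2
      have e2 : (j' : ℕ) / d = B := (Finset.mem_filter.1 hj').2
      have e3 : (j : ℕ) % d = j' % d := congrArg Fin.val h
      refine Fin.ext ?_
      rw [← Nat.div_add_mod (j : ℕ) d, ← Nat.div_add_mod (j' : ℕ) d, e1, e2, e3]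
    rw [hx]
    simp only
    rw [← Finset.card_image_of_injOn hinj, ← Finset.card_union_of_disjoint]
    · exact (Finset.card_le_univ _).trans (by simp)
    · rw [Finset.disjoint_left]
      intro a ha ha'
      obtain ⟨j, hj, rfl⟩ := Finset.mem_image.1 ha'
      obtain ⟨hj1, hj2⟩ := Finset.mem_filter.1 hj
      exact (Finset.mem_filter.1 ha).2 j hj1 hj2 rfl
  have h3 : ∑ B, x B = X.card := by
    rw [Finset.card_eq_sum_card_fiberwise (f := fun j : Fin n => (⟨(j : ℕ) / d, hnb j⟩ : Fin nb))
      (t := Finset.univ) (by simp)]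
    simp [hx, Fin.ext_iff]
  have hd' : (0 : ℝ) < d := by exact_mod_cast hd
  have h4 : ∀ B, ((A B).card : ℝ) ≤ d * Real.exp (-(x B / d)) := by
    intro B
    -- The factor of one block is `d (1 - x/d)`, and `1 - t ≤ exp (-t)`.
    have h5 : ((A B).card : ℝ) + x B ≤ d := by exact_mod_cast h2 B
    have h6 := Real.add_one_le_exp (-((x B : ℝ) / d))
    have h7 : (d : ℝ) * (-((x B : ℝ) / d) + 1) = d - x B := by field_simp; ring
    have h8 := mul_le_mul_of_nonneg_left h6 hd'.le
    linarith
  rw [h1, Fintype.card_piFinset, Nat.cast_prod]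
  calc ∏ B, ((A B).card : ℝ) ≤ ∏ B : Fin nb, (d * Real.exp (-(x B / d))) :=
        Finset.prod_le_prod (fun _ _ => by positivity) fun B _ => h4 B
    _ = d ^ nb * Real.exp (-(X.card / d)) := by
        rw [Finset.prod_mul_distrib, ← Real.exp_sum]
        simp only [Finset.prod_const, Finset.card_univ, Fintype.card_fin]
        rw [Finset.sum_neg_distrib, ← Finset.sum_div, ← Nat.cast_sum, h3]

/-- The probabilistic method with an exponential moment: each miss is given the weight `exp (d /
2)`, and the total weight is summed over all families and all `X`. As `|X| = d ^ 2`, a single random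
set misses `X` with probability at most `exp (-d)`. -/
theorem exists_family {n d q nb : ℕ} (hnb : ∀ j : Fin n, (j : ℕ) / d < nb)
    (hd : 2 * Real.log n + 2 < d) (hq : (q : ℝ) ≤ Real.exp (d / 2)) :
    ∃ G : Fin q → Fin nb → Fin d, ∀ X : Finset (Fin n), X.card = d ^ 2 →
      (Finset.univ.filter fun c => ∀ j ∈ X,
        (G c ⟨(j : ℕ) / d, hnb j⟩ : ℕ) ≠ j % d).card ≤ d ^ 2 := by
  classical
  have hlog : 0 ≤ Real.log n := Real.log_natCast_nonneg n
  have hd' : (0 : ℝ) < d := by linarith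
  have hd0 : 0 < d := by exact_mod_cast hd'
  by_contra! hcon
  set y : ℝ := Real.exp (d / 2) with hy
  have hy1 : 1 ≤ y := Real.one_le_exp (by positivity)
  set P : Finset (Finset (Fin n)) := Finset.univ.powersetCard (d ^ 2) with hP
  set miss : Finset (Fin n) → (Fin nb → Fin d) → Prop := fun X g =>
    ∀ j ∈ X, (g ⟨(j : ℕ) / d, hnb j⟩ : ℕ) ≠ j % d with hmiss
  set wt : Finset (Fin n) → (Fin q → Fin nb → Fin d) → ℝ := fun X G =>
    ∏ c, if miss X (G c) then y else 1 with hwt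
  have hwt0 : ∀ X G, 0 ≤ wt X G := fun X G =>
    Finset.prod_nonneg fun c _ => by split_ifs <;> linarith
  set N : ℝ := (d : ℝ) ^ nb with hN
  have hN0 : 0 < N := by positivity
  -- the lower bound
  have hlow : ∀ G, y ^ (d ^ 2) ≤ ∑ X ∈ P, wt X G := by
    intro G
    obtain ⟨X, hX, hlt⟩ := hcon G
    have hXP : X ∈ P := by simp [hP, Finset.mem_powersetCard, hX]
    refine le_trans ?_ (Finset.single_le_sum (f := fun X => wt X G) (fun X _ => hwt0 X G) hXP)
    simp only [hwt]
    rw [Finset.prod_ite, Finset.prod_const, Finset.prod_const_one, mul_one]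
    exact pow_le_pow_right₀ hy1 hlt.le
  -- the upper bound
  have hup : ∀ X ∈ P, ∑ G, wt X G ≤ N ^ q * Real.exp 1 := by
    intro X hX
    have hXc : X.card = d ^ 2 := (Finset.mem_powersetCard.1 hX).2
    -- The mean weight of one set is at most `1 + exp (-d) * y = 1 + 1 / y`. The `q ≤ y` sets are
    -- independent, which bounds the mean of the product by `exp 1`.
    have h1 : ∑ g : Fin nb → Fin d, (if miss X g then y else 1) ≤ N * (1 + 1 / y) := by
      have h2 : ∑ g : Fin nb → Fin d, (if miss X g then y else 1) ≤
          ∑ g : Fin nb → Fin d, (1 + if miss X g then y else 0) := by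
        refine Finset.sum_le_sum fun g _ => ?_
        split_ifs <;> linarith
      refine h2.trans ?_
      rw [Finset.sum_add_distrib, ← Finset.sum_filter, Finset.sum_const, Finset.sum_const,
        nsmul_eq_mul, nsmul_eq_mul, mul_one]
      have h3 := card_avoiding_le hd0 hnb X
      rw [hXc] at h3
      have h4 : (((d ^ 2 : ℕ) : ℝ) / d) = d := by push_cast; field_simp
      rw [h4] at h3
      have h5 : Real.exp (-(d : ℝ)) * y = 1 / y := by
        rw [hy, ← Real.exp_add, one_div, ← Real.exp_neg]
        congr 1
        ring
      have h6 := mul_le_mul_of_nonneg_right h3 (by linarith : 0 ≤ y)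
      rw [mul_assoc, h5] at h6
      simp only [Finset.card_univ, Fintype.card_pi, Fintype.card_fin, Finset.prod_const,
        Nat.cast_pow]
      rw [mul_add, mul_one]
      exact add_le_add le_rfl h6
    have h7 : ∑ G, wt X G = (∑ g : Fin nb → Fin d, (if miss X g then y else 1)) ^ q := by
      rw [Fintype.sum_pow]
    rw [h7]
    calc _ ≤ (N * (1 + 1 / y)) ^ q :=
          pow_le_pow_left₀ (Finset.sum_nonneg fun g _ => by split_ifs <;> linarith) h1 q
      _ = N ^ q * (1 + 1 / y) ^ q := mul_pow _ _ _
      _ ≤ N ^ q * Real.exp 1 := by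
          refine mul_le_mul_of_nonneg_left ?_ (by positivity)
          have h8 : 1 + 1 / y ≤ Real.exp (1 / y) := by
            have := Real.add_one_le_exp (1 / y)
            linarith
          calc (1 + 1 / y) ^ q ≤ Real.exp (1 / y) ^ q := pow_le_pow_left₀ (by positivity) h8 q
            _ = Real.exp (q * (1 / y)) := (Real.exp_nat_mul _ _).symm
            _ ≤ Real.exp 1 := by
                refine Real.exp_le_exp.2 ?_
                rw [mul_one_div, div_le_one (by linarith)]
                exact hq
  have hcard : (P.card : ℝ) ≤ Real.exp (d ^ 2 * Real.log n) := by
    rw [hP, Finset.card_powersetCard, Finset.card_univ, Fintype.card_fin]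
    rcases Nat.eq_zero_or_pos n with rfl | hn
    · have : (Nat.choose 0 (d ^ 2) : ℝ) = 0 := by
        rw [Nat.choose_eq_zero_of_lt (by positivity)]
        simp
      rw [this]
      positivity
    · have h1 : ((n.choose (d ^ 2) : ℕ) : ℝ) ≤ (n : ℝ) ^ (d ^ 2) := by
        exact_mod_cast Nat.choose_le_pow n (d ^ 2)
      refine h1.trans (le_of_eq ?_)
      have hn' : (0 : ℝ) < n := by exact_mod_cast hn
      have := Real.exp_nat_mul (Real.log n) (d ^ 2)
      rw [Real.exp_log hn'] at this
      rw [← this]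
      push_cast
      rfl
  have htotal : N ^ q * y ^ (d ^ 2) ≤ Real.exp (d ^ 2 * Real.log n) * (N ^ q * Real.exp 1) := by
    calc N ^ q * y ^ (d ^ 2) = ∑ G : Fin q → Fin nb → Fin d, y ^ (d ^ 2) := by
          rw [Finset.sum_const, nsmul_eq_mul]
          simp [hN]
      _ ≤ ∑ G : Fin q → Fin nb → Fin d, ∑ X ∈ P, wt X G := Finset.sum_le_sum fun G _ => hlow G
      _ = ∑ X ∈ P, ∑ G, wt X G := Finset.sum_comm
      _ ≤ ∑ X ∈ P, N ^ q * Real.exp 1 := Finset.sum_le_sum hup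
      _ = P.card * (N ^ q * Real.exp 1) := by rw [Finset.sum_const, nsmul_eq_mul]
      _ ≤ _ := mul_le_mul_of_nonneg_right hcard (by positivity)
  have hNq : 0 < N ^ q := by positivity
  -- If every family were bad, comparing exponents would give `d ^ 3 / 2 ≤ d ^ 2 * log n + 1`, which
  -- contradicts `d > 2 log n + 2`.
  have h1 : y ^ (d ^ 2) ≤ Real.exp (d ^ 2 * Real.log n + 1) := by
    rw [Real.exp_add]
    refine le_of_mul_le_mul_left ?_ hNq
    linarith
  rw [hy, ← Real.exp_nat_mul, Real.exp_le_exp] at h1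
  push_cast at h1
  have h2 : (1 : ℝ) ≤ (d : ℝ) ^ 2 := by
    have : (1 : ℝ) ≤ d := by exact_mod_cast hd0
    nlinarith
  nlinarith

/-! ### The family as a number -/

/-- Membership of `j` in the set number `c` of the family given by the number `code`. -/
def pick (d nb code c j : ℕ) : Bool := decide (code / d ^ (c * nb + j / d) % d = j % d)

/-- All sets of `d ^ 2` numbers below `n` are missed by at most `d ^ 2` of the `q` sets of the
family `code`. -/
def isGood (n d q nb code : ℕ) : Bool := (List.range (2 ^ n)).all fun X =>
  !decide (((List.range n).filter fun j => decide (X / 2 ^ j % 2 = 1)).length = d ^ 2) ||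
    decide (((List.range q).filter fun c => (List.range n).all fun j =>
      !decide (X / 2 ^ j % 2 = 1) || !pick d nb code c j).length ≤ d ^ 2)

/-- A good family, if there is one. -/
def family (n d q nb : ℕ) : ℕ :=
  Nat.findGreatest (fun code => isGood n d q nb code = true) (d ^ (q * nb))

section
variable {α : Type*} [Primcodable α] {f g h k l : α → ℕ}

@[fun_prop] theorem primrec_pick (hf : Primrec f) (hg : Primrec g) (hh : Primrec h)
    (hk : Primrec k) (hl : Primrec l) :
    Primrec fun a => pick (f a) (g a) (h a) (k a) (l a) := by
  unfold pick; fun_prop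

@[fun_prop] theorem primrec_family (hf : Primrec f) (hg : Primrec g) (hh : Primrec h)
    (hk : Primrec k) : Primrec fun a => family (f a) (g a) (h a) (k a) := by
  unfold family isGood; fun_prop
end

theorem length_filter_range (q : ℕ) (P : ℕ → Bool) :
    ((List.range q).filter P).length = (Finset.univ.filter fun c : Fin q => P c = true).card := by
  rw [Finset.card_filter, Fin.sum_univ_eq_sum_range fun c => if P c = true then 1 else 0]
  induction q with
  | zero => rfl
  | succ q ih =>
    rw [List.range_succ, List.filter_append, List.length_append, ih, Finset.sum_range_succ]
    cases h : P q <;> simp [h]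

theorem div_pow_mod_finFunctionFinEquiv {m k : ℕ} (f : Fin k → Fin m) (i : Fin k) :
    (finFunctionFinEquiv f : ℕ) / m ^ (i : ℕ) % m = f i := by
  conv_rhs => rw [← finFunctionFinEquiv.symm_apply_apply f]
  rfl

/-- `exists_family` guarantees that the exhaustive search succeeds: a family is a number with `q *
nb` digits in base `d`, and the sets to be tested are the numbers below `2 ^ n` in binary. -/
theorem family_spec {n d q nb : ℕ} (hnb : ∀ j : Fin n, (j : ℕ) / d < nb)
    (hd : 2 * Real.log n + 2 < d) (hq : (q : ℝ) ≤ Real.exp (d / 2))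
    (X : Finset (Fin n)) (hX : X.card = d ^ 2) :
    (Finset.univ.filter fun c : Fin q => ∀ j ∈ X,
      pick d nb (family n d q nb) c j = false).card ≤ d ^ 2 := by
  classical
  obtain ⟨G, hG⟩ := exists_family hnb hd hq
  have hgood : isGood n d q nb (family n d q nb) = true := by
    -- The digit at place `c * nb + B` is the residue that the set number `c` picks in block `B`.
    set G' : Fin (q * nb) → Fin d := fun i =>
      G (finProdFinEquiv.symm i).1 (finProdFinEquiv.symm i).2 with hG'
    refine Nat.findGreatest_spec (P := fun code => isGood n d q nb code = true)
      (m := finFunctionFinEquiv G') (finFunctionFinEquiv G').2.le ?_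
    simp only [isGood, List.all_eq_true, Bool.or_eq_true, Bool.not_eq_true',
      decide_eq_false_iff_not,
      decide_eq_true_eq]
    intro Y _
    by_cases hY : ((List.range n).filter fun j => decide (Y / 2 ^ j % 2 = 1)).length = d ^ 2
    · right
      rw [length_filter_range] at hY
      rw [length_filter_range]
      refine le_trans (Finset.card_le_card fun c hc => ?_) (hG _ hY)
      simp only [Finset.mem_filter, Finset.mem_univ, true_and, List.all_eq_true, Bool.or_eq_true,
        Bool.not_eq_true',
      decide_eq_false_iff_not, decide_eq_true_eq, List.mem_range] at hc ⊢
      intro j hj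
      have h1 := (hc j j.2).resolve_left (not_not.2 hj)
      have h2 : (finProdFinEquiv (c, (⟨(j : ℕ) / d, hnb j⟩ : Fin nb)) : ℕ) =
          (c : ℕ) * nb + (j : ℕ) / d := by
        simp [finProdFinEquiv, mul_comm, add_comm]
      have h3 := div_pow_mod_finFunctionFinEquiv G'
        (finProdFinEquiv (c, (⟨(j : ℕ) / d, hnb j⟩ : Fin nb)))
      rw [h2] at h3
      simp only [pick, decide_eq_false_iff_not] at h1
      rw [h3] at h1
      simp only [hG', Equiv.symm_apply_apply] at h1
      exact h1
    · left; exact hY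
  set Y : Fin n → Fin 2 := fun j => if j ∈ X then 1 else 0 with hYdef
  have hY : ∀ j : Fin n, (finFunctionFinEquiv Y : ℕ) / 2 ^ (j : ℕ) % 2 = 1 ↔ j ∈ X := by
    intro j
    rw [div_pow_mod_finFunctionFinEquiv Y j]
    by_cases h : j ∈ X <;> simp [hYdef, h]
  simp only [isGood, List.all_eq_true, Bool.or_eq_true, Bool.not_eq_true',
      decide_eq_false_iff_not,
      decide_eq_true_eq, List.mem_range] at hgood
  have h1 := hgood (finFunctionFinEquiv Y) (finFunctionFinEquiv Y).2
  rw [length_filter_range, length_filter_range] at h1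
  have h2 : (Finset.univ.filter fun j : Fin n =>
      decide ((finFunctionFinEquiv Y : ℕ) / 2 ^ (j : ℕ) % 2 = 1) = true) = X := by
    ext j
    rw [Finset.mem_filter, decide_eq_true_eq, hY]
    simp
  rw [h2] at h1
  refine le_trans (Finset.card_le_card fun c hc => ?_) (h1.resolve_left (not_not.2 hX))
  simp only [Finset.mem_filter, Finset.mem_univ, true_and, List.all_eq_true, Bool.or_eq_true,
    Bool.not_eq_true',
      decide_eq_false_iff_not, List.mem_range] at hc ⊢
  intro j hj
  by_cases h : (⟨j, hj⟩ : Fin n) ∈ X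
  · exact Or.inr (hc _ h)
  · exact Or.inl fun h' => h ((hY ⟨j, hj⟩).1 h')

end MPC

theorem Primrec.cons' {α σ : Type*} [Primcodable α] [Primcodable σ] {f : α → σ} {g : α → List σ}
    (hf : Primrec f) (hg : Primrec g) : Primrec fun a => f a :: g a := list_cons.comp hf hg

attribute [fun_prop] Primrec.cons'

namespace MPC

/-! ### Greedy phases: choice of the best set of the family. -/

section Phase

variable (br dim : List ℕ → ℕ) (pk : List ℕ → ℕ → ℕ → Bool)

/-- The words `w'` with the same key as `w` avoid the set number `c`. -/
def avoids (x : List ℕ × ℕ × List ℕ) (i c : ℕ) : Bool :=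
  x.2.2.all fun w => !(decide (tag w = 0) && decide (fy w = i)) || !pk x.1 c (fz w)

/-- The number of sets on the machine that avoid the set number `c` of the family. -/
def missCount (x : List ℕ × ℕ × List ℕ) (c : ℕ) : ℕ :=
  ((List.range (x.1.getD 0 0)).filter fun i =>
    (x.2.2.any fun w => decide (tag w = 0) && decide (fy w = i)) && avoids pk x i c).length

/-- An index of a smallest entry. -/
def argmin (y : List ℕ × List ℕ) : ℕ := Nat.findGreatest (fun c =>
  ((List.range (dim y.1)).all fun c' => decide (y.2.getD c 0 ≤ y.2.getD c' 0)) = true) (dim y.1 - 1)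

/-- The best set number as an initial value for a scan of numbers that are at most `n`. -/
def bestValue (y : List ℕ × List ℕ) (_ : ℕ) : ℕ := (y.1.getD 0 0 + 1) * argmin dim y

/-- The number of the best set, read off from the result of the scan. -/
def readBest (x : List ℕ × ℕ × List ℕ) : ℕ :=
  ((x.2.2.filter fun w => decide (tag w = 1) && decide (fx w = 0)).map fy).sum / (x.1.getD 0 0 + 1)

/-- The best set is recorded and the sets that it hits are dropped. -/
def dropHit : Local := fun x =>
  (word 2 (readBest x) 0 0 :: (x.2.2.filter fun w => decide (tag w = 2) ||
    (decide (tag w = 0) && avoids pk x (fy w) (readBest x))), [])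

/-- The best set of the family is found and the sets that it hits are dropped. -/
def phase (D : ℕ) : List Local :=
  scan br dim (missCount pk) (bestValue dim) D ++ [dropHit pk]

variable {br dim pk}

theorem primrec_avoids (hpk : Primrec fun y : List ℕ × ℕ × ℕ => pk y.1 y.2.1 y.2.2) :
    Primrec fun y : (List ℕ × ℕ × List ℕ) × ℕ × ℕ => avoids pk y.1 y.2.1 y.2.2 := by
  have hp {α : Type} [Primcodable α] {f : α → List ℕ} {g h : α → ℕ} (hf : Primrec f)
    (hg : Primrec g) (hh : Primrec h) : Primrec fun a => pk (f a) (g a) (h a) :=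
    hpk.comp (hf.pair (hg.pair hh))
  unfold avoids; fun_prop

theorem primrec_argmin (hdim : Primrec dim) : Primrec (argmin dim) := by
  have hd {α : Type} [Primcodable α] {f : α → List ℕ} (hf : Primrec f) :
    Primrec fun a => dim (f a) := hdim.comp hf
  exact Primrec.findGreatest' (by fun_prop) (Primrec.all' (by fun_prop) (by fun_prop))

@[fun_prop] theorem primrec_readBest : Primrec readBest := by
  unfold readBest; fun_prop

theorem primrec_phase (hbr : Primrec br) (hdim : Primrec dim)
    (hpk : Primrec fun y : List ℕ × ℕ × ℕ => pk y.1 y.2.1 y.2.2) (D : ℕ) :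
    ∀ f ∈ phase br dim pk D, Primrec f := by
  have ha {α : Type} [Primcodable α] {f : α → List ℕ × ℕ × List ℕ} {g h : α → ℕ} (hf : Primrec f)
    (hg : Primrec g) (hh : Primrec h) : Primrec fun a => avoids pk (f a) (g a) (h a) :=
    (primrec_avoids hpk).comp (hf.pair (hg.pair hh))
  have hm := primrec_argmin hdim
  intro f hf
  simp only [phase, List.mem_append, List.mem_singleton] at hf
  rcases hf with hf | rfl
  · refine primrec_scan hbr hdim ?_ ?_ D f hf
    · unfold missCount; fun_prop
    · unfold bestValue; fun_prop
  · unfold dropHit; fun_prop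

theorem argmin_spec {p : List ℕ} (hd : 0 < dim p) (tots : List ℕ) :
    argmin dim (p, tots) < dim p ∧
      ∀ c < dim p, tots.getD (argmin dim (p, tots)) 0 ≤ tots.getD c 0 := by
  obtain ⟨c, hc, hmin⟩ := Finset.exists_min_image (Finset.range (dim p))
    (fun c => tots.getD c 0) ⟨0, by simpa using hd⟩
  have hle : c ≤ dim p - 1 := by
    have := Finset.mem_range.1 hc
    omega
  constructor
  · exact (Nat.findGreatest_le (P := fun c => ((List.range (dim p)).all fun c' =>
      decide (tots.getD c 0 ≤ tots.getD c' 0)) = true) (dim p - 1)).trans_lt (by omega)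
  · have h : ((List.range (dim p)).all fun c' =>
        decide (tots.getD (argmin dim (p, tots)) 0 ≤ tots.getD c' 0)) = true :=
      Nat.findGreatest_spec (P := fun c => ((List.range (dim p)).all fun c' =>
        decide (tots.getD c 0 ≤ tots.getD c' 0)) = true) hle (by
          simpa using fun c' hc' => hmin c' (by simpa using hc'))
    simpa using h

/-- The words that record the chosen sets. -/
def chosen (Cs : List ℕ) : Multiset ℕ := ((Cs.map fun c => word 2 c 0 0 : List ℕ) : Multiset ℕ)

theorem mem_chosen {Cs : List ℕ} {w : ℕ} : w ∈ chosen Cs ↔ ∃ c ∈ Cs, word 2 c 0 0 = w := by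
  simp [chosen]

variable {n : ℕ} {p : List ℕ} {M S B D T H g s : ℕ} {c : Config M}
  {E : Finset (Fin n × Fin n)} {pos : Fin n × Fin n → ℕ}

/-- The memories during the phases: the items of the sets with index in `Al` and the numbers of
the chosen sets. -/
def phaseState (g : ℕ) (E : Finset (Fin n × Fin n)) (pos : Fin n × Fin n → ℕ)
    (Al : Finset (Fin n)) (Cs : List ℕ) (m : Fin M) : Multiset ℕ :=
  placed (E.filter fun e => e.1 ∈ Al) (item pos (fun e => e.1) fun e => e.2)
    (fun e => (e.1 : ℕ) / g) m + chosen Cs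

theorem mem_phaseState {Al : Finset (Fin n)} {Cs : List ℕ} {m : Fin M} {w : ℕ} :
    w ∈ phaseState g E pos Al Cs m ↔
      (∃ e ∈ E, e.1 ∈ Al ∧ (e.1 : ℕ) / g = m ∧ word 0 (pos e) e.1 e.2 = w) ∨
        ∃ c ∈ Cs, word 2 c 0 0 = w := by
  rw [phaseState, Multiset.mem_add, mem_placed, mem_chosen]
  simp [item, and_assoc]

theorem mfits_phaseState (hg : 0 < g) {t k : ℕ} (hE : ∀ i, (E.filter fun e => e.1 = i).card ≤ t)
    (hS : g * t + k ≤ S) (hposT : ∀ e ∈ E, pos e < T) (hnT : n ≤ T) (hT : 2 < T)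
    (hB : T ^ 8 ≤ B) {Al : Finset (Fin n)} {Cs : List ℕ} (hk : Cs.length ≤ k)
    (hCs : ∀ c ∈ Cs, c < T) : MFits (fun m : Fin M => phaseState g E pos Al Cs m) S B := by
  refine fun m => ⟨?_, fun w hw => ?_⟩
  · change (phaseState g E pos Al Cs m).card ≤ S
    rw [phaseState, Multiset.card_add, card_placed]
    have h1 := card_grouped_le (E := E.filter fun e => e.1 ∈ Al) hg (fun i =>
      (Finset.card_le_card (Finset.filter_subset_filter _
        (Finset.filter_subset _ _))).trans
        (hE i)) m
    have h2 : (chosen Cs).card = Cs.length := by simp [chosen]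
    omega
  · refine lt_of_lt_of_le ?_ hB
    rcases mem_phaseState.1 hw with ⟨e, he, -, -, rfl⟩ | ⟨c, hc, rfl⟩
    · exact word_lt (by omega) (hposT e he) (e.1.2.trans_le hnT) (e.2.2.trans_le hnT)
    · exact word_lt hT (hCs c hc) (by omega) (by omega)

/-- All items of one set lie on the machine of its group, so a local test decides whether the set is
hit. The extra words `Y` are the results of the scan, still in memory when the test is made. -/
theorem avoids_iff {Al : Finset (Fin n)} {Cs : List ℕ} {Y : Multiset ℕ} {m : Fin M}
    {mem : List ℕ} (hY : ∀ w ∈ Y, tag w = 1)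
    (hm : (mem : Multiset ℕ) = phaseState g E pos Al Cs m + Y) (a : ℕ) {i : Fin n} (hi : i ∈ Al)
    (him : (i : ℕ) / g = m) (k : ℕ) :
    avoids pk (p, a, mem) i k = true ↔ ∀ e ∈ E, e.1 = i → pk p k e.2 = false := by
  have hmem : ∀ w, w ∈ mem ↔ w ∈ phaseState g E pos Al Cs m + Y := fun w => by
    rw [← hm, Multiset.mem_coe]
  simp only [avoids, List.all_eq_true, Bool.or_eq_true, Bool.not_eq_true', Bool.and_eq_false_iff,
    decide_eq_false_iff_not]
  constructor
  · rintro h e he rfl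
    have h1 := h (word 0 (pos e) e.1 e.2) ((hmem _).2 (Multiset.mem_add.2
      (Or.inl (mem_phaseState.2 (Or.inl ⟨e, he, hi, him, rfl⟩)))))
    simpa using h1
  · intro h w hw
    rcases Multiset.mem_add.1 ((hmem w).1 hw) with hw | hw
    · rcases mem_phaseState.1 hw with ⟨e, he, -, -, rfl⟩ | ⟨c, hc, rfl⟩
      · by_cases h1 : e.1 = i
        · right
          simpa using h e he h1
        · left; right
          simpa using fun h2 => h1 (Fin.ext h2)
      · simp
    · simp [hY w hw]

theorem missCount_eq {Al : Finset (Fin n)} {Cs : List ℕ} {m : Fin M} {mem : List ℕ}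
    (hpn : p.getD 0 0 = n) (hE : ∀ i, ∃ e ∈ E, e.1 = i)
    (hm : (mem : Multiset ℕ) = phaseState g E pos Al Cs m) (k : ℕ) :
    missCount pk (p, m, mem) k = (Al.filter fun i : Fin n => (i : ℕ) / g = m ∧
      ∀ e ∈ E, e.1 = i → pk p k e.2 = false).card := by
  have hmem : ∀ w, w ∈ mem ↔ w ∈ phaseState g E pos Al Cs m := fun w => by
    rw [← hm, Multiset.mem_coe]
  have hany : ∀ i : Fin n, (mem.any fun w => decide (tag w = 0) && decide (fy w = i)) = true ↔
      i ∈ Al ∧ (i : ℕ) / g = m := by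
    intro i
    simp only [List.any_eq_true, Bool.and_eq_true, decide_eq_true_eq]
    constructor
    · rintro ⟨w, hw, h1, h2⟩
      rcases mem_phaseState.1 ((hmem w).1 hw) with ⟨e, he, h3, h4, rfl⟩ | ⟨c, hc, rfl⟩
      · have : e.1 = i := Fin.ext (by simpa using h2)
        rw [← this]
        exact ⟨h3, h4⟩
      · simp at h1
    · rintro ⟨h1, h2⟩
      obtain ⟨e, he, rfl⟩ := hE i
      exact ⟨_, (hmem _).2 (mem_phaseState.2 (Or.inl ⟨e, he, h1, h2, rfl⟩)), by simp⟩
  simp only [missCount, hpn]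
  rw [length_filter_range]
  congr 1
  ext i
  simp only [Finset.mem_filter, Finset.mem_univ, true_and, Bool.and_eq_true, hany]
  constructor
  · rintro ⟨⟨h1, h2⟩, h3⟩
    exact ⟨h1, h2, (avoids_iff (Y := 0) (by simp) (by rw [add_zero, hm]) m h1 h2 k).1 h3⟩
  · rintro ⟨h1, h2, h3⟩
    exact ⟨⟨h1, h2⟩, (avoids_iff (Y := 0) (by simp) (by rw [add_zero, hm]) m h1 h2 k).2 h3⟩

/-- Every set is missed by at most `s` of the `dim p` candidates. Double counting of the missed
pairs shows that the candidate with the fewest misses leaves at most the share `s / dim p` of `Al`.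
-/
theorem exec_phase {t k : ℕ} {Al : Finset (Fin n)} {Cs : List ℕ}
    (hpn : p.getD 0 0 = n) (hu : 0 < br p) (hd : 0 < dim p) (hg : 0 < g) (hM : M ≤ br p ^ D)
    (hgM : n ≤ g * M)
    (hE1 : ∀ i, ∃ e ∈ E, e.1 = i) (hE : ∀ i, (E.filter fun e => e.1 = i).card ≤ t)
    (hS : g * t + k + 1 + ((D + 1) * (br p * dim p) + dim p) ≤ S)
    (hposT : ∀ e ∈ E, pos e < T) (hnT : n ≤ T) (hMT : M ≤ T) (hqT : dim p ≤ T)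
    (hT : (n + 1) * dim p + n < T) (hD : 3 + D < T) (hB : T ^ 8 ≤ B)
    (hgood : ∀ i, (Finset.univ.filter fun c : Fin (dim p) =>
      ∀ e ∈ E, e.1 = i → pk p c e.2 = false).card ≤ s)
    (hk : Cs.length ≤ k) (hCs : ∀ c ∈ Cs, c < dim p)
    (hc : Holds c fun m => phaseState g E pos Al Cs m) :
    ∃ c', Exec p S B (phase br dim pk D) c c' ∧ ∃ b < dim p, ∃ Al' ⊆ Al,
      (∀ i ∈ Al, i ∉ Al' → ∃ e ∈ E, e.1 = i ∧ pk p b e.2 = true) ∧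
      dim p * Al'.card ≤ Al.card * s ∧
      Holds c' fun m => phaseState g E pos Al' (b :: Cs) m := by
  classical
  set missed : ℕ → Finset (Fin n) := fun k =>
    Al.filter fun i : Fin n => ∀ e ∈ E, e.1 = i → pk p k e.2 = false with hmissed
  set v : Fin M → ℕ → ℕ := fun m k => (Al.filter fun i : Fin n => (i : ℕ) / g = m ∧
      ∀ e ∈ E, e.1 = i → pk p k e.2 = false).card with hv
  set tots : List ℕ := (List.range (dim p)).map fun c' => ∑ x, v x c' with htots
  set b := argmin dim (p, tots) with hb
  obtain ⟨hbq, hbmin⟩ : b < dim p ∧ ∀ c < dim p, tots.getD b 0 ≤ tots.getD c 0 :=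
    argmin_spec (dim := dim) hd tots
  have hvtot : ∀ k, ∑ x, v x k = (missed k).card := by
    intro k
    simp only [hv, hmissed, Finset.card_filter]
    rw [Finset.sum_comm]
    refine Finset.sum_congr rfl fun i _ => ?_
    have hi : (i : ℕ) / g < M := by
      rw [Nat.div_lt_iff_lt_mul hg, mul_comm]
      exact i.2.trans_le hgM
    rw [Finset.sum_eq_single (⟨(i : ℕ) / g, hi⟩ : Fin M)]
    · simp
    · intro m _ hm
      rw [if_neg]
      rintro ⟨h, -⟩
      exact hm (Fin.ext h.symm)
    · simp
  have hmissn : ∀ k, (missed k).card ≤ n := fun k =>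
    (Finset.card_le_univ _).trans (by simp)
  have hfit : MFits (fun m : Fin M => phaseState g E pos Al Cs m) S B :=
    mfits_phaseState hg hE (by omega) hposT hnT (by omega) hB hk fun c hc => (hCs c hc).trans_le hqT
  have hfit' : MFits (fun m : Fin M => phaseState g E pos (missed b) (b :: Cs) m) S B :=
    mfits_phaseState (k := k + 1) hg hE (by omega) hposT hnT (by omega) hB (by simpa using hk)
      fun c hc => by
        rcases List.mem_cons.1 hc with rfl | hc
        · exact hbq.trans_le hqT
        · exact (hCs c hc).trans_le hqT
  -- The root starts the scan from `(n + 1) * b`. The partial counts added to it are at most `n`, so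
  -- division by `n + 1` recovers `b` on every machine.
  have hpre : ∀ m i, prefixSum v (fun _ => (n + 1) * b) m i / (n + 1) = b := by
    intro m i
    have h1 : (∑ x : Fin M, if (x : ℕ) < m then v x i else 0) ≤ n := by
      refine le_trans (Finset.sum_le_sum (g := fun x => v x i) fun x _ => ?_)
        ((hvtot i).le.trans (hmissn i))
      split_ifs <;> simp
    rw [prefixSum, Nat.mul_add_div (by omega), Nat.div_eq_of_lt (by omega), add_zero]
  unfold phase
  refine exec_two (exec_scan (v := v) (φ := fun _ => (n + 1) * b) hu ?_ hM ?_ ?_ hfit ?_ hD hMT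
    hqT ?_ ?_ hB hc) fun c' hf' hc' => ?_
  · intro m w hw
    rcases mem_phaseState.1 hw with ⟨e, -, -, -, rfl⟩ | ⟨c, -, rfl⟩ <;> simp
  · intro m i
    exact missCount_eq hpn hE1 (hc m) i
  · intro i
    simp only [bestValue, hpn, ← htots, ← hb]
  · intro m
    have h1 := (mfits_phaseState (S := g * t + k) (M := M) (Al := Al) hg hE le_rfl hposT hnT
      (by omega) hB hk
      fun c hc => (hCs c hc).trans_le hqT) m
    have h2 : (phaseState g E pos Al Cs m).card ≤ g * t + k := h1.1
    omega
  · omega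
  · intro i _
    rw [hvtot]
    have h1 := hmissn i
    have h2 := Nat.mul_le_mul_left (n + 1) hbq.le
    omega
  · have hbest : ∀ m : Fin M, readBest (p, m, c' m) = b := by
      intro m
      simp only [readBest, hpn]
      rw [sum_map_filter, hc' m, tot_add, tot_prefixes _ _ hd, tot_eq_zero, zero_add, hpre]
      intro w hw
      rcases mem_phaseState.1 hw with ⟨e, -, -, -, rfl⟩ | ⟨c, -, rfl⟩ <;> simp
    obtain ⟨h1, h2⟩ := exec_local (f := dropHit pk) (p := p)
      (fun m : Fin M => phaseState g E pos (missed b) (b :: Cs) m) hf' (fun m => rfl) (fun m => by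
        simp only [dropHit, hbest]
        have hfp : ∀ (P : ℕ → Prop) [DecidablePred P], (∀ w, tag w = 1 → ¬ P w) →
            (prefixes (dim p) v (fun _ => (n + 1) * b) m).filter P = 0 := fun P _ hP =>
          Multiset.filter_eq_nil.2 fun w hw => hP w (tag_prefixes hw)
        have hfc : ∀ (P : ℕ → Prop) [DecidablePred P], (∀ w, tag w = 2 → P w) →
            (chosen Cs).filter P = chosen Cs := fun P _ hP =>
          Multiset.filter_eq_self.2 fun w hw => hP w (by
            obtain ⟨c, -, rfl⟩ := mem_chosen.1 hw
            simp)
        rw [← Multiset.cons_coe, coe_filter, hc' m, Multiset.filter_add, phaseState,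
          Multiset.filter_add, hfp, add_zero, hfc, filter_placed, Finset.filter_filter, phaseState]
        · rw [show chosen (b :: Cs) = word 2 b 0 0 ::ₘ chosen Cs from rfl, Multiset.add_cons]
          congr 2
          simp only [placed, Finset.sum_filter]
          refine Finset.sum_congr rfl fun e he => ?_
          by_cases hm : (e.1 : ℕ) / g = m
          · have h3 := fun h => avoids_iff (pk := pk) (p := p) (fun w hw => tag_prefixes hw)
              (hc' m) m (i := e.1) h hm b
            by_cases h4 : e.1 ∈ Al
            · simp only [item, tag_word, fy_word, hmissed, Finset.mem_filter, h4, true_and]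
              simp [h3 h4]
            · simp [h4, hmissed]
          · simp [hm]
        · intro w hw
          simp [hw]
        · intro w hw
          simp [hw]) hfit'
    refine ⟨_, h1, b, hbq, missed b, Finset.filter_subset _ _, fun i hi hi' => ?_, ?_, h2⟩
    · by_contra! hcon
      refine hi' (Finset.mem_filter.2 ⟨hi, fun e he hei => ?_⟩)
      simpa using hcon e he hei
    · have h3 : ∀ c' ∈ Finset.range (dim p), (missed b).card ≤ (missed c').card := by
        intro c' hc'
        have hc'' := Finset.mem_range.1 hc'
        have h4 := hbmin c' hc''
        rw [htots] at h4
        simpa [List.getD_eq_getElem?_getD, hc'', hbq, hvtot] using h4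
      -- The minimum is at most the average, and the sum over the candidates is exchanged with the
      -- sum over the sets.
      calc dim p * (missed b).card = ∑ c' ∈ Finset.range (dim p), (missed b).card := by simp
        _ ≤ ∑ c' ∈ Finset.range (dim p), (missed c').card := Finset.sum_le_sum h3
        _ = ∑ c' : Fin (dim p), (missed c').card :=
            (Fin.sum_univ_eq_sum_range (fun c' => (missed c').card) _).symm
        _ = ∑ i ∈ Al, (Finset.univ.filter fun c : Fin (dim p) =>
              ∀ e ∈ E, e.1 = i → pk p c e.2 = false).card := by
            simp only [hmissed, Finset.card_filter]
            rw [Finset.sum_comm]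
        _ ≤ ∑ i ∈ Al, s := Finset.sum_le_sum fun i _ => hgood i
        _ = Al.card * s := by simp

end Phase

end MPC

/-! ### Output of the union, and the hitting set algorithm with its parameters left open. -/

namespace MPC

/-- Every machine outputs the elements of the union of the chosen sets that belong to its part. -/
def collect (grp : List ℕ → ℕ) (pk : List ℕ → ℕ → ℕ → Bool) : Local := fun x =>
  (((List.range (grp x.1)).map fun k => x.2.1 * grp x.1 + k).filter fun j =>
    decide (j < x.1.getD 0 0) && x.2.2.any fun w => decide (tag w = 2) && pk x.1 (fx w) j, [])

/-- The algorithm for hitting sets: sorting, choice of sets from the family, and output. -/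
def hitSets (br dim cap trim grp : List ℕ → ℕ) (pk : List ℕ → ℕ → ℕ → Bool) (D : ℕ) : List Local :=
  sortSets br dim cap trim grp D ++ (List.range D).flatMap (fun _ => phase br dim pk D) ++
    [collect grp pk]

variable {br dim cap trim grp : List ℕ → ℕ} {pk : List ℕ → ℕ → ℕ → Bool} {p : List ℕ}
  {M S B D T H : ℕ}

theorem primrec_hitSets (hbr : Primrec br) (hdim : Primrec dim) (hcap : Primrec cap)
    (htrim : Primrec trim) (hgrp : Primrec grp)
    (hpk : Primrec fun y : List ℕ × ℕ × ℕ => pk y.1 y.2.1 y.2.2) (D : ℕ) :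
    ∀ f ∈ hitSets br dim cap trim grp pk D, Primrec f := by
  intro f hf
  simp only [hitSets, List.mem_append, List.mem_singleton, List.mem_flatMap] at hf
  rcases hf with (hf | ⟨k, -, hf⟩) | rfl
  · exact primrec_sortSets hbr hdim hcap htrim hgrp D f hf
  · exact primrec_phase hbr hdim hpk D f hf
  · have h1 {α : Type} [Primcodable α] {f : α → List ℕ} (hf : Primrec f) :
      Primrec fun a => grp (f a) := hgrp.comp hf
    have h2 {α : Type} [Primcodable α] {f : α → List ℕ} {g h : α → ℕ} (hf : Primrec f)
      (hg : Primrec g) (hh : Primrec h) : Primrec fun a => pk (f a) (g a) (h a) :=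
      hpk.comp (hf.pair (hg.pair hh))
    unfold collect; fun_prop

theorem sum_blocks {α : Type*} [AddCommMonoid α] (f : ℕ → α) (M g : ℕ) :
    ∑ m : Fin M, ∑ k ∈ Finset.range g, f (m * g + k) = ∑ x ∈ Finset.range (M * g), f x := by
  rw [Fin.sum_univ_eq_sum_range fun m => ∑ k ∈ Finset.range g, f (m * g + k)]
  induction M with
  | zero => simp
  | succ M ih => rw [Finset.sum_range_succ, ih, Nat.succ_mul, Finset.sum_range_add]

/-- Every machine knows all chosen numbers and can decide membership in the family by itself. The
blocks of `grp p` numbers are disjoint and cover all numbers below `n`, so each element appears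
exactly once. -/
theorem exec_collect {n : ℕ} {E : Finset (Fin n × Fin n)} {pos : Fin n × Fin n → ℕ}
    {Cs : List ℕ} {c : Config M} {g : ℕ} (hpn : p.getD 0 0 = n) (hgM : n ≤ grp p * M)
    (hgS : grp p ≤ S) (hnB : n ≤ B) (hf : Fits c S B)
    (hc : Holds c fun m => phaseState g E pos ∅ Cs m) :
    ∃ c', Exec p S B [collect grp pk] c c' ∧
      Leaders.Outputs c' (Finset.univ.filter fun j : Fin n => ∃ k ∈ Cs, pk p k j = true) := by
  classical
  have hmem : ∀ m w, w ∈ c m ↔ ∃ k ∈ Cs, word 2 k 0 0 = w := by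
    intro m w
    rw [hc.mem_iff, mem_phaseState]
    simp
  set Y : Fin M → Multiset ℕ := fun m => ∑ k ∈ Finset.range (grp p),
    if m * grp p + k < n ∧ ∃ a ∈ Cs, pk p a (m * grp p + k) = true then {m * grp p + k} else 0
    with hY
  have hret : ∀ m : Fin M, ((collect grp pk (p, m, c m)).1 : Multiset ℕ) = Y m := by
    intro m
    simp only [collect, hpn, hY]
    rw [coe_filter, coe_map_range, filter_sum]
    refine Finset.sum_congr rfl fun k _ => ?_
    rw [Multiset.filter_singleton]
    refine if_congr ?_ rfl rfl
    simp only [Bool.and_eq_true, decide_eq_true_eq, List.any_eq_true, hmem]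
    refine and_congr_right fun _ => ⟨?_, ?_⟩
    · rintro ⟨w, ⟨a, ha, rfl⟩, -, h⟩
      exact ⟨a, ha, by simpa using h⟩
    · rintro ⟨a, ha, h⟩
      exact ⟨_, ⟨a, ha, rfl⟩, by simp, by simpa using h⟩
  have hfit : MFits Y S B := by
    refine fun m => ⟨le_trans ?_ hgS, fun w hw => ?_⟩
    · simp only [hY]
      rw [Multiset.card_sum]
      refine (Finset.sum_le_card_nsmul _ _ 1 fun k _ => ?_).trans (by simp)
      split_ifs <;> simp
    · obtain ⟨k, -, hw⟩ := Multiset.mem_sum.1 hw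
      obtain ⟨⟨h1, -⟩, h2⟩ := mem_ite_zero hw
      rw [Multiset.mem_singleton] at h2
      omega
  obtain ⟨h1, h2⟩ := exec_local (p := p) (f := collect grp pk) Y hf (fun m => rfl) hret hfit
  refine ⟨_, h1, ?_⟩
  rw [Leaders.Outputs, Finset.sum_congr rfl fun m _ => h2 m]
  simp only [hY]
  rw [sum_blocks (fun x => if x < n ∧ ∃ a ∈ Cs, pk p a x = true then ({x} : Multiset ℕ) else 0)]
  have hsub : Finset.range n ⊆ Finset.range (M * grp p) :=
    Finset.range_mono (by rw [mul_comm]; exact hgM)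
  rw [← Finset.sum_subset hsub]
  · rw [← Fin.sum_univ_eq_sum_range fun x =>
      if x < n ∧ ∃ a ∈ Cs, pk p a x = true then ({x} : Multiset ℕ) else 0]
    simp only [Fin.is_lt, true_and]
    rw [← Finset.sum_filter, ← Finset.sum_multiset_singleton (Finset.univ.filter _),
      map_sum_multiset]
    simp
  · intro x _ hx
    rw [if_neg]
    rintro ⟨h, -⟩
    exact hx (Finset.mem_range.2 h)

/-- With `dim p = s * br p`, each phase divides the number of sets not yet hit by at least `br p`.
The summand `D` in `hgrpH` reserves room for the numbers of the chosen sets. -/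
theorem exec_hitSets {n b s : ℕ} {F : Fin n → Finset (Fin n)} (hF : ∀ i, (F i).card = b)
    {inp : Fin M → List (Fin n × Fin n)} (hinp : Leaders.IsDistribution F inp)
    (hlen : ∀ m, (Leaders.encode (inp m)).length ≤ S)
    (hpn : p.getD 0 0 = n) (hpb : p.getD 1 0 = b) (hpS : p.getD 2 0 = S)
    (hu : 0 < br p) (hs : 0 < s) (hdim : dim p = s * br p) (hcap : 0 < cap p) (hgrp : 0 < grp p)
    (hM : M ≤ br p ^ D) (hn : n < br p ^ D) (hEM : n * b ≤ cap p * M) (hgM : n ≤ grp p * M)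
    (hSH : S / 2 ≤ H) (hcapH : cap p ≤ H) (htrim0 : 0 < trim p) (htrim : trim p ≤ b)
    (hgrpH : grp p * trim p + D ≤ H)
    (hS : H + ((D + 1) * (br p * dim p) + dim p) ≤ S)
    (hD : 3 + D < T) (hMT : M ≤ T) (hqT : dim p ≤ T) (hET : n * b < T) (hnT : n ≤ T)
    (hSMT : S * M ≤ T) (hT : (n + 1) * dim p + n < T) (hB : T ^ 8 ≤ B) (hD0 : 0 < D)
    (hgood : ∀ X : Finset (Fin n), X.card = trim p → (Finset.univ.filter fun c : Fin (dim p) =>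
      ∀ j ∈ X, pk p c j = false).card ≤ s) :
    ∃ c', Exec p S B (hitSets br dim cap trim grp pk D) (fun m => Leaders.encode (inp m)) c' ∧
      ∃ L : Finset (Fin n), Leaders.Outputs c' L ∧ (∀ i, (F i ∩ L).Nonempty) ∧
        ∃ Cs : List ℕ, Cs.length = D ∧ ∀ j ∈ L, ∃ k ∈ Cs, pk p k j = true := by
  classical
  have hd : 0 < dim p := by rw [hdim]; positivity
  have hle : br p ≤ dim p := by rw [hdim]; exact Nat.le_mul_of_pos_left _ hs
  have hgS : grp p ≤ S := by
    have := Nat.le_mul_of_pos_right (grp p) htrim0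
    omega
  have hTB : T ≤ B := (Nat.le_self_pow (by norm_num) T).trans hB
  unfold hitSets
  refine exec_two (exec_two (exec_sortSets hF hinp hlen hpb hpS hu hd hcap hgrp hM hEM hgM hSH hcapH
    htrim (by omega) hS hD hMT hqT hET hnT hSMT hB (hn.le.trans (Nat.pow_le_pow_left hle D)) hD0) ?_
    (Q := fun c => ∃ (pos : Fin n × Fin n → ℕ) (E : Finset (Fin n × Fin n)) (Cs : List ℕ),
      (∀ e ∈ E, e.2 ∈ F e.1) ∧ Cs.length = D ∧
      (∀ i, ∃ k ∈ Cs, ∃ e ∈ E, e.1 = i ∧ pk p k e.2 = true) ∧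
      Holds c fun m => phaseState (grp p) E pos ∅ Cs m)) ?_
  · rintro c hf ⟨pos, E, hEF, hposT, hfib, hc⟩
    have hfib1 : ∀ i, ∃ e ∈ E, e.1 = i := by
      intro i
      have h1 : 0 < (E.filter fun e => e.1 = i).card := by rw [hfib]; exact htrim0
      obtain ⟨e, he⟩ := Finset.card_pos.1 h1
      exact ⟨e, (Finset.mem_filter.1 he).1, (Finset.mem_filter.1 he).2⟩
    have hgood' : ∀ i, (Finset.univ.filter fun c : Fin (dim p) =>
        ∀ e ∈ E, e.1 = i → pk p c e.2 = false).card ≤ s := by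
      intro i
      have hX : ((E.filter fun e => e.1 = i).image Prod.snd).card = trim p := by
        rw [Finset.card_image_of_injOn, hfib]
        intro e he e' he' h
        exact Prod.ext ((Finset.mem_filter.1 he).2.trans (Finset.mem_filter.1 he').2.symm) h
      refine le_trans (Finset.card_le_card fun c hc => ?_) (hgood _ hX)
      simp only [Finset.mem_filter, Finset.mem_univ, true_and] at hc ⊢
      intro j hj
      obtain ⟨e, he, rfl⟩ := Finset.mem_image.1 hj
      exact hc e (Finset.mem_filter.1 he).1 (Finset.mem_filter.1 he).2
    have hstep : ∀ k < D, ∀ c : Config M, (∃ (Al : Finset (Fin n)) (Cs : List ℕ),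
          Cs.length = k ∧ (∀ a ∈ Cs, a < dim p) ∧ Al.card * br p ^ k ≤ n ∧
          (∀ i, i ∉ Al → ∃ a ∈ Cs, ∃ e ∈ E, e.1 = i ∧ pk p a e.2 = true) ∧
          Holds c fun m => phaseState (grp p) E pos Al Cs m) →
        ∃ c', Exec p S B (phase br dim pk D) c c' ∧ ∃ (Al : Finset (Fin n)) (Cs : List ℕ),
          Cs.length = k + 1 ∧ (∀ a ∈ Cs, a < dim p) ∧ Al.card * br p ^ (k + 1) ≤ n ∧
          (∀ i, i ∉ Al → ∃ a ∈ Cs, ∃ e ∈ E, e.1 = i ∧ pk p a e.2 = true) ∧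
          Holds c' fun m => phaseState (grp p) E pos Al Cs m := by
      rintro k hk c ⟨Al, Cs, h1, h2, h3, h4, h5⟩
      obtain ⟨c', h6, b', h7, Al', h8, h9, h10, h11⟩ :=
        exec_phase (S := S) (k := k) (t := trim p) hpn hu hd hgrp
        hM hgM
        hfib1 (fun i => (hfib i).le) (by omega) hposT hnT hMT hqT hT hD hB hgood' h1.le h2 h5
      refine ⟨c', h6, Al', b' :: Cs, by simp [h1], ?_, ?_, ?_, h11⟩
      · intro a ha
        rcases List.mem_cons.1 ha with rfl | ha
        · exact h7
        · exact h2 a ha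
      · rw [hdim, mul_assoc, mul_comm _ s] at h10
        have h12 := Nat.le_of_mul_le_mul_left h10 hs
        calc Al'.card * br p ^ (k + 1) = br p * Al'.card * br p ^ k := by ring
          _ ≤ Al.card * br p ^ k := Nat.mul_le_mul_right _ h12
          _ ≤ n := h3
      · intro i hi
        by_cases hi' : i ∈ Al
        · obtain ⟨e, he, h12, h13⟩ := h9 i hi' hi
          exact ⟨b', by simp, e, he, h12, h13⟩
        · obtain ⟨a, ha, h12⟩ := h4 i hi'
          exact ⟨a, by simp [ha], h12⟩
    have hfit0 : ∀ c : Config M, (∃ (Al : Finset (Fin n)) (Cs : List ℕ),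
          Cs.length = 0 ∧ (∀ a ∈ Cs, a < dim p) ∧ Al.card * br p ^ 0 ≤ n ∧
          (∀ i, i ∉ Al → ∃ a ∈ Cs, ∃ e ∈ E, e.1 = i ∧ pk p a e.2 = true) ∧
          Holds c fun m => phaseState (grp p) E pos Al Cs m) → Fits c S B := by
      rintro c ⟨Al, Cs, h1, h2, -, -, h5⟩
      exact h5.fits (mfits_phaseState (k := 0) hgrp (fun i => (hfib i).le) (by omega) hposT hnT
        (by omega) hB h1.le fun a ha => (h2 a ha).trans_le hqT)
    obtain ⟨c', h1, Al, Cs, h2, -, h3, h4, h5⟩ :=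
      exec_iterate (fun _ => phase br dim pk D) _ D hstep
      hfit0 c ⟨Finset.univ, [], rfl, by simp, by simp, by simp, fun m => by
        rw [hc m]
        simp [phaseState, chosen]⟩
    -- A surviving set would give `br p ^ D ≤ Al.card * br p ^ D ≤ n`, against `hn`.
    have hAl : Al = ∅ := by
      rw [← Finset.card_eq_zero]
      by_contra h
      have := Nat.le_mul_of_pos_left (br p ^ D) (Nat.pos_of_ne_zero h)
      omega
    subst hAl
    exact ⟨c', h1, pos, E, Cs, hEF, h2, fun i => h4 i (by simp), h5⟩
  · rintro c hf ⟨pos, E, Cs, hEF, hCs, hhit, hc⟩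
    obtain ⟨c', h1, h2⟩ := exec_collect (grp := grp) (pk := pk) hpn hgM hgS (hnT.trans hTB) hf hc
    refine ⟨c', h1, _, h2, fun i => ?_, Cs, hCs, fun j hj => by simpa using hj⟩
    obtain ⟨k, hk, e, he, rfl, h3⟩ := hhit i
    exact ⟨e.2, Finset.mem_inter.2 ⟨hEF e he, by simpa using ⟨k, hk, h3⟩⟩⟩

end MPC

namespace MPC

/-! ### The parameters of the algorithm, as functions of `[n, b, S, M]` -/

/-- The integer part of the eighth root of `S`. -/
def branching (p : List ℕ) : ℕ := Nat.sqrt (Nat.sqrt (Nat.sqrt (p.getD 2 0)))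

/-- The integer part of the fifth root of `min b S`. -/
def density (p : List ℕ) : ℕ :=
  Nat.findGreatest (fun d => decide (d ^ 5 ≤ min (p.getD 1 0) (p.getD 2 0)) = true)
    (min (p.getD 1 0) (p.getD 2 0))

def trimSize (p : List ℕ) : ℕ := density p ^ 2

def familySize (p : List ℕ) : ℕ := density p ^ 2 * branching p

def capacity (p : List ℕ) : ℕ := p.getD 0 0 * p.getD 1 0 / p.getD 3 0 + 1

def groupSize (p : List ℕ) : ℕ := p.getD 0 0 / p.getD 3 0 + 1

def blocks (p : List ℕ) : ℕ := p.getD 0 0 / density p + 1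

/-- Membership in the sets of the good family. -/
def pickSet (p : List ℕ) (c j : ℕ) : Bool :=
  pick (density p) (blocks p) (family (p.getD 0 0) (density p) (familySize p) (blocks p)) c j

theorem primrec_branching : Primrec branching := by unfold branching; fun_prop

theorem primrec_density : Primrec density := by unfold density; fun_prop

theorem primrec_trimSize : Primrec trimSize := by
  have := primrec_density
  unfold trimSize; fun_prop

theorem primrec_familySize : Primrec familySize := by
  have := primrec_density
  have := primrec_branching
  unfold familySize; fun_prop

theorem primrec_capacity : Primrec capacity := by unfold capacity; fun_prop

theorem primrec_groupSize : Primrec groupSize := by unfold groupSize; fun_prop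

theorem primrec_blocks : Primrec blocks := by
  have := primrec_density
  unfold blocks; fun_prop

theorem primrec_pickSet : Primrec fun y : List ℕ × ℕ × ℕ => pickSet y.1 y.2.1 y.2.2 := by
  have hd {α : Type} [Primcodable α] {f : α → List ℕ} (hf : Primrec f) :
    Primrec fun a => density (f a) := primrec_density.comp hf
  have hb {α : Type} [Primcodable α] {f : α → List ℕ} (hf : Primrec f) :
    Primrec fun a => blocks (f a) := primrec_blocks.comp hf
  have hs {α : Type} [Primcodable α] {f : α → List ℕ} (hf : Primrec f) :
    Primrec fun a => familySize (f a) := primrec_familySize.comp hf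
  unfold pickSet; fun_prop

theorem branching_pow_le (p : List ℕ) : branching p ^ 8 ≤ p.getD 2 0 := by
  have h1 := Nat.sqrt_le' (p.getD 2 0)
  have h2 := Nat.sqrt_le' (Nat.sqrt (p.getD 2 0))
  have h3 := Nat.sqrt_le' (Nat.sqrt (Nat.sqrt (p.getD 2 0)))
  calc branching p ^ 8 = ((branching p ^ 2) ^ 2) ^ 2 := by ring
    _ ≤ ((Nat.sqrt (Nat.sqrt (p.getD 2 0))) ^ 2) ^ 2 :=
        Nat.pow_le_pow_left (Nat.pow_le_pow_left h3 2) 2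
    _ ≤ (Nat.sqrt (p.getD 2 0)) ^ 2 := Nat.pow_le_pow_left h2 2
    _ ≤ _ := h1

theorem lt_branching_pow (p : List ℕ) : p.getD 2 0 < (branching p + 1) ^ 8 := by
  have h1 : p.getD 2 0 + 1 ≤ (Nat.sqrt (p.getD 2 0) + 1) ^ 2 := Nat.lt_succ_sqrt' _
  have h2 : Nat.sqrt (p.getD 2 0) + 1 ≤ (Nat.sqrt (Nat.sqrt (p.getD 2 0)) + 1) ^ 2 :=
    Nat.lt_succ_sqrt' _
  have h3 : Nat.sqrt (Nat.sqrt (p.getD 2 0)) + 1 ≤ (branching p + 1) ^ 2 := Nat.lt_succ_sqrt' _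
  calc p.getD 2 0 + 1 ≤ (Nat.sqrt (p.getD 2 0) + 1) ^ 2 := h1
    _ ≤ ((Nat.sqrt (Nat.sqrt (p.getD 2 0)) + 1) ^ 2) ^ 2 := Nat.pow_le_pow_left h2 2
    _ ≤ (((branching p + 1) ^ 2) ^ 2) ^ 2 :=
        Nat.pow_le_pow_left (Nat.pow_le_pow_left h3 2) 2
    _ = _ := by ring

theorem density_pow_le (p : List ℕ) : density p ^ 5 ≤ min (p.getD 1 0) (p.getD 2 0) := by
  have := Nat.findGreatest_spec (P := fun d =>
    decide (d ^ 5 ≤ min (p.getD 1 0) (p.getD 2 0)) = true)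
    (Nat.zero_le (min (p.getD 1 0) (p.getD 2 0))) (by simp)
  exact of_decide_eq_true this

theorem lt_density_pow (p : List ℕ) : min (p.getD 1 0) (p.getD 2 0) < (density p + 1) ^ 5 := by
  by_contra! h
  have h1 : density p + 1 ≤ min (p.getD 1 0) (p.getD 2 0) :=
    (Nat.le_self_pow (by norm_num) _).trans h
  have := Nat.le_findGreatest (P := fun d =>
    decide (d ^ 5 ≤ min (p.getD 1 0) (p.getD 2 0)) = true) h1
    (by simpa only [decide_eq_true_eq] using h)
  change density p + 1 ≤ density p at this
  omega

/-- A set of the family has at most one element in each block, because the digit of the block fixes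
the residue modulo `d`. -/
theorem card_pickSet_le (n b S M c : ℕ) :
    (Finset.univ.filter fun j : Fin n => pickSet [n, b, S, M] c j = true).card ≤
      n / density [n, b, S, M] + 1 := by
  set d := density [n, b, S, M]
  calc _ ≤ (Finset.range (n / d + 1)).card := by
        refine Finset.card_le_card_of_injOn (fun j => (j : ℕ) / d) (fun j _ => ?_) ?_
        · have := Nat.div_le_div_right (c := d) j.2.le
          simp only [Finset.coe_range, Set.mem_Iio]
          omega
        · intro j hj j' hj' h
          have h1 := (Finset.mem_filter.1 hj).2
          have h2 := (Finset.mem_filter.1 hj').2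
          simp only at h
          simp only [pickSet, pick, decide_eq_true_eq] at h1 h2
          rw [h] at h1
          refine Fin.ext ?_
          rw [← Nat.div_add_mod (j : ℕ) d, ← Nat.div_add_mod (j' : ℕ) d, h, ← h1, h2]
    _ = _ := by simp

/-! ### The asymptotic conditions -/

theorem exists_threshold {δ : ℝ} (hδ : 0 < δ) (C a D : ℕ) : ∃ n₀ : ℕ, ∀ n ≥ n₀,
    C ≤ n ∧ 2 ≤ n ∧ 3 + D < n ∧ (2 : ℝ) ≤ (n : ℝ) ^ (δ / 16) ∧
      (((2 * (D + 2)) ^ 20 + 16 * D : ℕ) : ℝ) ≤ (n : ℝ) ^ δ ∧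
      (4 * (a + 2) + 1 : ℝ) ≤ Real.log n ∧ Real.log n ^ 10 ≤ (n : ℝ) ^ δ := by
  have hnat := tendsto_natCast_atTop_atTop (R := ℝ)
  have h1 := ((tendsto_rpow_atTop (by positivity : 0 < δ / 16)).comp hnat).eventually_ge_atTop 2
  have h2 := ((tendsto_rpow_atTop hδ).comp hnat).eventually_ge_atTop
    (((2 * (D + 2)) ^ 20 + 16 * D : ℕ) : ℝ)
  have h3 := (Real.tendsto_log_atTop.comp hnat).eventually_ge_atTop (4 * (a + 2) + 1 : ℝ)
  have h4 := hnat.eventually ((isLittleO_log_rpow_rpow_atTop (10 : ℝ) hδ).bound one_pos)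
  have h5 := Filter.eventually_ge_atTop (C + 2 + (4 + D))
  obtain ⟨n₀, h⟩ := Filter.eventually_atTop.1 (h1.and (h2.and (h3.and (h4.and h5))))
  refine ⟨n₀, fun n hn => ?_⟩
  obtain ⟨h1, h2, h3, h4, h5⟩ := h n hn
  refine ⟨by omega, by omega, by omega, h1, h2, h3, ?_⟩
  rw [one_mul] at h4
  have h6 : Real.log n ^ (10 : ℝ) = Real.log n ^ 10 := by
    exact_mod_cast Real.rpow_natCast (Real.log n) 10
  rw [h6, Real.norm_of_nonneg (pow_nonneg (Real.log_natCast_nonneg n) 10),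
    Real.norm_of_nonneg (by positivity)] at h4
  exact h4

section Bounds

variable {δ : ℝ} {n b S M D a : ℕ}

/-- With `x = n ^ (δ / 16)`, the bound on `S` gives `x ^ 2 < u + 1`, hence `x ≤ u` because `2 ≤ x`.
Then `64 / δ ≤ D` yields `n ^ 4 ≤ u ^ D`. The power `n ^ 3` later dominates both `M` and `n`. -/
theorem branching_large (hδ : 0 < δ) (hn : 2 ≤ n) (hx : (2 : ℝ) ≤ (n : ℝ) ^ (δ / 16))
    (hS : (n : ℝ) ^ δ ≤ S) (hD : 64 / δ ≤ D) : n ^ 3 < branching [n, b, S, M] ^ D := by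
  set u := branching [n, b, S, M] with hu
  have h1 : S < (u + 1) ^ 8 := lt_branching_pow [n, b, S, M]
  have h2 : (S : ℝ) < ((u : ℝ) + 1) ^ 8 := by exact_mod_cast h1
  set x : ℝ := (n : ℝ) ^ (δ / 16) with hxdef
  have hn0 : (0 : ℝ) ≤ n := by positivity
  have h3 : (n : ℝ) ^ δ = (x ^ 2) ^ 8 := by
    rw [hxdef, ← pow_mul, ← Real.rpow_natCast, ← Real.rpow_mul hn0]
    congr 1
    push_cast
    ring
  have h4 : x ^ 2 < u + 1 :=
    lt_of_pow_lt_pow_left₀ 8 (by positivity) (by rw [← h3]; exact hS.trans_lt h2)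
  have h5 : x ≤ u := by nlinarith
  have hn1 : (1 : ℝ) < n := by exact_mod_cast hn
  have h6 : (n : ℝ) ^ 4 ≤ (u : ℝ) ^ D := by
    calc (n : ℝ) ^ 4 = (n : ℝ) ^ (4 : ℝ) := by exact_mod_cast (Real.rpow_natCast (n : ℝ) 4).symm
      _ ≤ (n : ℝ) ^ (δ / 16 * D) := by
          refine Real.rpow_le_rpow_of_exponent_le hn1.le ?_
          rw [div_le_iff₀ hδ] at hD
          linarith
      _ = x ^ D := by rw [hxdef, Real.rpow_mul hn0, Real.rpow_natCast]
      _ ≤ (u : ℝ) ^ D := pow_le_pow_left₀ (by positivity) h5 D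
  have h7 : (n : ℝ) ^ 3 < (n : ℝ) ^ 4 := pow_lt_pow_right₀ hn1 (by norm_num)
  exact_mod_cast h7.trans_le h6

/-- From `log n ^ 10 ≤ min b S` one gets `log n ^ 2 < d + 1`, which beats any fixed multiple of `log
n` once `n` is large. -/
theorem density_large (hb : Real.log n ^ 10 ≤ b) (hS : Real.log n ^ 10 ≤ S)
    (hl : (4 * (a + 2) + 1 : ℝ) ≤ Real.log n) :
    2 * (a + 2) * (Real.log n + 1) < density [n, b, S, M] := by
  set d := density [n, b, S, M] with hd
  set l := Real.log n with hldef
  have h1 : min b S < (d + 1) ^ 5 := lt_density_pow [n, b, S, M]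
  have h2 : ((min b S : ℕ) : ℝ) < ((d : ℝ) + 1) ^ 5 := by exact_mod_cast h1
  have h3 : l ^ 10 ≤ ((min b S : ℕ) : ℝ) := by
    push_cast
    exact le_min hb hS
  have h4 : l ^ 2 < d + 1 := by
    refine lt_of_pow_lt_pow_left₀ 5 (by positivity) ?_
    rw [← pow_mul]
    exact h3.trans_lt h2
  have ha : (0 : ℝ) ≤ a := by positivity
  nlinarith

theorem scan_space (hS : (2 * (D + 2)) ^ 20 + 16 * D ≤ S) :
    2 * ((D + 1) * (branching [n, b, S, M] * familySize [n, b, S, M]) +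
      familySize [n, b, S, M]) ≤ S := by
  have h1 : branching [n, b, S, M] ^ 8 ≤ S := branching_pow_le [n, b, S, M]
  have h2 : density [n, b, S, M] ^ 5 ≤ S := (density_pow_le [n, b, S, M]).trans (min_le_right _ _)
  unfold familySize
  set u := branching [n, b, S, M]
  set d := density [n, b, S, M]
  have h3 : 2 * ((D + 1) * (u * (d ^ 2 * u)) + d ^ 2 * u) ≤ 2 * (D + 2) * (d ^ 2 * u ^ 2) := by
    have : d ^ 2 * u ≤ d ^ 2 * u ^ 2 :=
      Nat.mul_le_mul_left _ (Nat.le_self_pow two_ne_zero u)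
    nlinarith
  refine h3.trans ?_
  by_contra! h4
  have hS0 : 0 < S := lt_of_lt_of_le (by positivity) hS
  -- Here `d ^ 2 * u ^ 2` is at most `S ^ (2 / 5 + 2 / 8) = S ^ (13 / 20)`; the power `20` clears
  -- the denominators.
  have h5 : S ^ 20 < (2 * (D + 2)) ^ 20 * S ^ 13 := by
    calc S ^ 20 < (2 * (D + 2) * (d ^ 2 * u ^ 2)) ^ 20 := Nat.pow_lt_pow_left h4 (by norm_num)
      _ = (2 * (D + 2)) ^ 20 * ((d ^ 5) ^ 8 * (u ^ 8) ^ 5) := by ring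
      _ ≤ (2 * (D + 2)) ^ 20 * (S ^ 8 * S ^ 5) := Nat.mul_le_mul_left _
          (Nat.mul_le_mul (Nat.pow_le_pow_left h2 8) (Nat.pow_le_pow_left h1 5))
      _ = (2 * (D + 2)) ^ 20 * S ^ 13 := by ring
  have h6 : (2 * (D + 2)) ^ 20 * S ^ 13 ≤ S ^ 20 := by
    calc (2 * (D + 2)) ^ 20 * S ^ 13 ≤ S ^ 7 * S ^ 13 := Nat.mul_le_mul_right _
          (((Nat.le_add_right _ _).trans hS).trans (Nat.le_self_pow (by norm_num) S))
      _ = S ^ 20 := by ring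
  omega

/-- Half of the memory is for data, the other half for the scans. The factor `16` makes the average
load `n * b / M` at most `S / 16`. The trimmed groups are smaller still, since `d ^ 2 ≤ b` and `27 *
d ^ 2 ≤ S`. -/
theorem group_space (hM : 0 < M) (hSM : 16 * (n * b) ≤ S * M) (hd : 3 ≤ density [n, b, S, M])
    (hD : 16 * D ≤ S) (hS : 16 ≤ S) : capacity [n, b, S, M] ≤ S / 2 ∧
      groupSize [n, b, S, M] * trimSize [n, b, S, M] + D ≤ S / 2 := by
  have h2 : density [n, b, S, M] ^ 5 ≤ min b S := density_pow_le [n, b, S, M]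
  have hdS := h2.trans (min_le_right _ _)
  have hdb := h2.trans (min_le_left _ _)
  change n * b / M + 1 ≤ S / 2 ∧ (n / M + 1) * density [n, b, S, M] ^ 2 + D ≤ S / 2
  set d := density [n, b, S, M]
  have h3 : 27 ≤ d ^ 3 := Nat.pow_le_pow_left hd 3
  have h4 : d ^ 5 = d ^ 2 * d ^ 3 := by ring
  have h5 : 27 * d ^ 2 ≤ d ^ 5 := by rw [h4, mul_comm]; exact Nat.mul_le_mul_left _ h3
  have h6 : 16 * (n * b / M) ≤ S := by
    refine Nat.le_of_mul_le_mul_right ?_ hM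
    have := Nat.div_mul_le_self (n * b) M
    calc 16 * (n * b / M) * M = 16 * (n * b / M * M) := by ring
      _ ≤ _ := by omega
  have h7 : n / M * d ^ 2 ≤ n * b / M := by
    rw [Nat.le_div_iff_mul_le hM]
    calc n / M * d ^ 2 * M = n / M * M * d ^ 2 := by ring
      _ ≤ n * b := Nat.mul_le_mul (Nat.div_mul_le_self n M) (by omega)
  rw [add_mul, one_mul]
  omega

end Bounds

end MPC

namespace MPC

/-! ### Small inputs, and the choice between two algorithms -/

variable {p : List ℕ} {M S B T : ℕ}

/-- After `decodeInput`, keep the element `i` of every pair `(i, i)`. -/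
def keepDiag : Local := fun x =>
  ((x.2.2.filter fun w => decide (fy w = fz w)).map fy, [])

theorem primrec_keepDiag : Primrec keepDiag := by unfold keepDiag; fun_prop

/-- The local computation which does nothing. -/
def idle : Local := fun x => (x.2.2, [])

theorem primrec_idle : Primrec idle := by unfold idle; fun_prop

theorem next_idle (p : List ℕ) (c : Config M) : next idle p c = c := by
  funext m
  simp [next, idle]

/-- Perform `f` if the first parameter is less than `n₀`, and `g` otherwise. -/
def branch (n₀ : ℕ) (f g : Local) : Local := fun x =>
  bif decide (x.1.getD 0 0 < n₀) then f x else g x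

theorem primrec_branch (n₀ : ℕ) {f g : Local} (hf : Primrec f) (hg : Primrec g) :
    Primrec (branch n₀ f g) := by
  unfold branch
  exact Primrec.cond' (by fun_prop) hf hg

theorem Exec.congr {c c' : Config M} {ι : Type*} {f g : ι → Local}
    (hfg : ∀ i, ∀ y, f i (p, y) = g i (p, y)) {l : List ι} (h : Exec p S B (l.map f) c c') :
    Exec p S B (l.map g) c c' := by
  induction l generalizing c with
  | nil => exact h
  | cons i l ih =>
    obtain ⟨h1, h2, h3⟩ := h
    have h4 : next (g i) p c = next (f i) p c := by
      funext m
      simp only [next, hfg]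
    refine ⟨h1, fun m => by rw [← hfg]; exact h2 m, ?_⟩
    rw [h4]
    exact ih h3

theorem exec_idle {c : Config M} (hc : Fits c S B) {ι : Type*} (l : List ι) :
    Exec p S B (l.map fun _ => idle) c c := by
  induction l with
  | nil => exact ⟨hc, rfl⟩
  | cons i l ih =>
    refine ⟨hc, fun m => by simp [idle], ?_⟩
    rw [next_idle]
    exact ih

/-- Each pair `(i, i)` occurs exactly once in the input because `i ∈ F i`. Keeping these pairs
outputs every number exactly once, without communication. -/
theorem exec_keepDiag {n : ℕ} {F : Fin n → Finset (Fin n)} (hF : ∀ i, i ∈ F i)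
    {inp : Fin M → List (Fin n × Fin n)} (hinp : Leaders.IsDistribution F inp)
    (hlen : ∀ m, (Leaders.encode (inp m)).length ≤ S) (hpS : p.getD 2 0 = S)
    (hnT : n ≤ T) (hT : S * M ≤ T) (hT0 : 0 < T) (hB : T ^ 8 ≤ B) :
    ∃ c', Exec p S B [decodeInput, keepDiag] (fun m => Leaders.encode (inp m)) c' ∧
      Leaders.Outputs c' (Finset.univ : Finset (Fin n)) := by
  classical
  refine exec_two (fs := [decodeInput]) (gs := [keepDiag])
    (exec_decodeInput hinp hlen hpS hnT hT hT0 hB) ?_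
  rintro c hf ⟨pos, loc, hc, -, -, hlocM, -, hcard⟩
  set E := Finset.univ.filter fun e : Fin n × Fin n => e.2 ∈ F e.1 with hE
  set E' := E.filter fun e => e.1 = e.2 with hE'
  have hTB : T ≤ B := (Nat.le_self_pow (by norm_num) T).trans hB
  have hret : ∀ m : Fin M, ((keepDiag (p, m, c m)).1 : Multiset ℕ) =
      placed E' (fun e => (e.1 : ℕ)) loc m := by
    intro m
    simp only [keepDiag]
    rw [← Multiset.map_coe, coe_filter, hc m, filter_placed, map_placed]
    simp [item, hE', Fin.ext_iff]
  have h := exec_local (p := p) (f := keepDiag)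
    (fun m : Fin M => placed E' (fun e => (e.1 : ℕ)) loc m)
    hf (fun m => rfl) hret (mfits_placed (fun e _ => (e.1.2.trans_le hnT).trans_le hTB)
      fun m => (Finset.card_le_card (Finset.filter_subset_filter _
        (Finset.filter_subset _ _))).trans
        ((hcard m).trans (Nat.div_le_self S 2)))
  refine ⟨_, h.1, ?_⟩
  rw [Leaders.Outputs, Finset.sum_congr rfl fun m _ => h.2 m]
  simp only [placed]
  rw [Finset.sum_comm]
  have h1 : ∀ e ∈ E', (∑ m : Fin M, if loc e = m then ({(e.1 : ℕ)} : Multiset ℕ) else 0) =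
      {(e.1 : ℕ)} := by
    intro e he
    have hm := hlocM e (Finset.mem_filter.1 he).1
    rw [Finset.sum_eq_single ⟨loc e, hm⟩]
    · simp
    · intro m _ hm'
      rw [if_neg]
      exact fun h => hm' (Fin.ext h.symm)
    · simp
  rw [Finset.sum_congr rfl h1]
  have h2 : E' = Finset.univ.image fun i : Fin n => (i, i) := by
    ext ⟨i, j⟩
    simp only [hE', hE, Finset.mem_filter, Finset.mem_univ, true_and, Finset.mem_image,
      Prod.mk.injEq]
    constructor
    · rintro ⟨-, rfl⟩
      exact ⟨i, rfl, rfl⟩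
    · rintro ⟨k, rfl, rfl⟩
      exact ⟨hF _, rfl⟩
  rw [h2, Finset.sum_image fun i _ j _ h => (Prod.ext_iff.1 h).1]
  rw [← Finset.sum_multiset_singleton, map_sum_multiset]
  rfl

end MPC

/-! ### The whole algorithm and the verification of its resources. -/

namespace MPC

/-- The whole algorithm: the elements of the diagonal for small `n`, and `hitSets` for large `n`. -/
def leaders (n₀ D : ℕ) : List Local :=
  [decodeInput, keepDiag].map (fun f => branch n₀ f idle) ++
    (hitSets branching familySize capacity trimSize groupSize pickSet D).map
      fun f => branch n₀ idle f

theorem primrec_leaders (n₀ D : ℕ) : ∀ f ∈ leaders n₀ D, Primrec f := by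
  intro f hf
  simp only [leaders, List.map_cons, List.map_nil, List.mem_append, List.mem_cons,
    List.not_mem_nil, or_false, List.mem_map] at hf
  rcases hf with (rfl | rfl) | ⟨g, hg, rfl⟩
  · exact primrec_branch n₀ primrec_decodeInput primrec_idle
  · exact primrec_branch n₀ primrec_keepDiag primrec_idle
  · exact primrec_branch n₀ primrec_idle (primrec_hitSets primrec_branching primrec_familySize
      primrec_capacity primrec_trimSize primrec_groupSize primrec_pickSet D g hg)

variable {p : List ℕ} {M S B : ℕ}

theorem exec_leaders_of_lt {n₀ D : ℕ} (hp : p.getD 0 0 < n₀) {c c' : Config M}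
    (h : Exec p S B [decodeInput, keepDiag] c c') : Exec p S B (leaders n₀ D) c c' := by
  refine Exec.append (Exec.congr (f := id) (fun f y => ?_) (by simpa using h))
    (Exec.congr (f := fun _ => idle) (fun f y => ?_) (exec_idle h.fits_end _))
  · simp only [branch, hp, decide_true, cond_true, id]
  · simp only [branch, hp, decide_true, cond_true]

theorem exec_leaders_of_le {n₀ D : ℕ} (hp : n₀ ≤ p.getD 0 0) {c c' : Config M}
    (h : Exec p S B (hitSets branching familySize capacity trimSize groupSize pickSet D) c c') :
    Exec p S B (leaders n₀ D) c c' := by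
  refine Exec.append (Exec.congr (f := fun _ => idle) (fun f y => ?_) (exec_idle h.fits _))
    (Exec.congr (f := id) (fun f y => ?_) (by simpa using h))
  · simp only [branch, hp.not_gt, decide_false, cond_false]
  · simp only [branch, hp.not_gt, decide_false, cond_false, id]

variable {n b : ℕ}

theorem natCast_le_pow {C : ℕ} (hn : 1 ≤ n) : C ≤ (n + 1) ^ C :=
  Nat.lt_two_pow_self.le.trans (Nat.pow_le_pow_left (by omega) C)

/-- From `m < (d + 1) ^ 5 ≤ (2 * d) ^ 5` one gets `1 / d ≤ 2 * m ^ (-1 / 5)`. A second factor `2`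
absorbs the rounding, as `d ≤ n`. -/
theorem min_rpow_le {d m K : ℕ} (hm : m < (d + 1) ^ 5) (hd : 0 < d) (hm0 : 0 < m) (hn : d ≤ n)
    {l : ℕ} (hl : l ≤ K * (n / d + 1)) : (l : ℝ) ≤ 4 * K * (n * (m : ℝ) ^ (-(1 / 5) : ℝ)) := by
  have hd' : (0 : ℝ) < d := by exact_mod_cast hd
  have hd1 : (1 : ℝ) ≤ d := by exact_mod_cast hd
  have hm' : (0 : ℝ) < m := by exact_mod_cast hm0
  have h1 : (m : ℝ) ≤ (2 * d) ^ 5 := by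
    have : (m : ℝ) ≤ ((d : ℝ) + 1) ^ 5 := by exact_mod_cast hm.le
    exact this.trans (pow_le_pow_left₀ (by positivity) (by linarith) 5)
  have h2 : (m : ℝ) ^ (1 / 5 : ℝ) ≤ 2 * d := by
    calc (m : ℝ) ^ (1 / 5 : ℝ) ≤ ((2 * (d : ℝ)) ^ 5) ^ (1 / 5 : ℝ) :=
          Real.rpow_le_rpow hm'.le h1 (by norm_num)
      _ = 2 * d := by
          rw [← Real.rpow_natCast, ← Real.rpow_mul (by positivity)]
          norm_num
  have h3 : 1 / (2 * d : ℝ) ≤ (m : ℝ) ^ (-(1 / 5) : ℝ) := by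
    rw [Real.rpow_neg hm'.le, ← one_div]
    exact one_div_le_one_div_of_le (Real.rpow_pos_of_pos hm' _) h2
  have h4 : ((n / d : ℕ) : ℝ) ≤ n / d := Nat.cast_div_le
  have h5 : (1 : ℝ) ≤ n / d := by
    rw [le_div_iff₀ hd', one_mul]
    exact_mod_cast hn
  have h6 : (l : ℝ) ≤ K * ((n / d : ℕ) + 1) := by exact_mod_cast hl
  calc (l : ℝ) ≤ K * (2 * (n / d)) := h6.trans (by gcongr; linarith)
    _ = 4 * K * (n * (1 / (2 * d))) := by field_simp; ring
    _ ≤ _ := by gcongr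

/-- The general bounds on the resources, for integers. -/
theorem resource_bounds {δ C₁ : ℝ} {C a : ℕ} (hC : C₁ ≤ C) (ha : δ ≤ a) (hn : 1 ≤ n)
    (hbn : b ≤ n) (hS : (S : ℝ) ≤ C₁ * (n : ℝ) ^ δ) (hSM : (S : ℝ) * M ≤ C₁ * (n * b)) :
    S ≤ C * n ^ a ∧ S * M ≤ C * (n * n) := by
  have hn' : (1 : ℝ) ≤ n := by exact_mod_cast hn
  have hb' : (b : ℝ) ≤ n := by exact_mod_cast hbn
  constructor
  · have h : (S : ℝ) ≤ C * (n : ℝ) ^ (a : ℝ) := hS.trans (by gcongr)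
    rw [Real.rpow_natCast] at h
    exact_mod_cast h
  · have h : (S : ℝ) * M ≤ C * (n * n) := hSM.trans (by gcongr)
    exact_mod_cast h

theorem exec_large {δ C₁ : ℝ} (hδ : 0 < δ) {C a D : ℕ} (hC : C₁ ≤ C) (ha : δ ≤ a)
    (hD : 64 / δ ≤ D) (hCn : C ≤ n) (hn2 : 2 ≤ n) (hDn : 3 + D < n)
    (hx : (2 : ℝ) ≤ (n : ℝ) ^ (δ / 16))
    (hDδ : (((2 * (D + 2)) ^ 20 + 16 * D : ℕ) : ℝ) ≤ (n : ℝ) ^ δ)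
    (hl : (4 * (a + 2) + 1 : ℝ) ≤ Real.log n) (hlδ : Real.log n ^ 10 ≤ (n : ℝ) ^ δ)
    (hb1 : 1 ≤ b) (hbn : b ≤ n) (hlb : Real.log n ^ 10 ≤ b)
    (hS : 16 * (n : ℝ) ^ δ ≤ S) (hS' : (S : ℝ) ≤ C₁ * (n : ℝ) ^ δ)
    (hSM : 16 * (n * b : ℝ) ≤ (S : ℝ) * M) (hSM' : (S : ℝ) * M ≤ C₁ * (n * b))
    {F : Fin n → Finset (Fin n)} (hF : ∀ i, (F i).card = b)
    {inp : Fin M → List (Fin n × Fin n)} (hinp : Leaders.IsDistribution F inp)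
    (hlen : ∀ m, (Leaders.encode (inp m)).length ≤ S) :
    ∃ c', Exec [n, b, S, M] S (((n + 1) ^ (C + a + 4)) ^ 8)
        (hitSets branching familySize capacity trimSize groupSize pickSet D)
        (fun m => Leaders.encode (inp m)) c' ∧
      ∃ L : Finset (Fin n), Leaders.Outputs c' L ∧ (∀ i, (F i ∩ L).Nonempty) ∧
        (L.card : ℝ) ≤ 4 * D * (n * ((min b S : ℕ) : ℝ) ^ (-(1 / 5) : ℝ)) := by
  classical
  -- `T` bounds all components of words: addresses, positions, `S * M`, and the values `(n + 1) *
  -- argmin + n` that occur in a phase.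
  set T := (n + 1) ^ (C + a + 4) with hT
  obtain ⟨hSn, hSMn⟩ := resource_bounds hC ha (by omega) hbn hS' hSM'
  have hδpos : (0 : ℝ) ≤ (n : ℝ) ^ δ := by positivity
  have hSge : (n : ℝ) ^ δ ≤ S := by linarith
  have hSD : (2 * (D + 2)) ^ 20 + 16 * D ≤ S := by exact_mod_cast hDδ.trans hSge
  have hSM16 : 16 * (n * b) ≤ S * M := by exact_mod_cast hSM
  have hnb : 0 < n * b := Nat.mul_pos (by omega) hb1
  have hM0 : 0 < M := Nat.pos_of_ne_zero fun h => by rw [h] at hSM16; omega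
  have hS16 : 16 ≤ S := by
    have : (2 * (0 + 2)) ^ 20 ≤ (2 * (D + 2)) ^ 20 := Nat.pow_le_pow_left (by omega) 20
    omega
  have hD0 : 0 < D := by
    have : (0 : ℝ) < D := lt_of_lt_of_le (by positivity) hD
    exact_mod_cast this
  have hbr := branching_large (b := b) (M := M) hδ hn2 hx hSge hD
  have hden := density_large (M := M) hlb (hlδ.trans hSge) hl
  have hscan := scan_space (n := n) (b := b) (M := M) hSD
  have hd5 : density [n, b, S, M] ^ 5 ≤ min b S := density_pow_le [n, b, S, M]
  have hd6 : min b S < (density [n, b, S, M] + 1) ^ 5 := lt_density_pow [n, b, S, M]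
  have hcard := card_pickSet_le n b S M
  have hfam : familySize [n, b, S, M] =
    trimSize [n, b, S, M] * branching [n, b, S, M] := rfl
  have htrim : trimSize [n, b, S, M] = density [n, b, S, M] ^ 2 := rfl
  have hl0 : 0 ≤ Real.log n := Real.log_natCast_nonneg n
  have ha0 : (0 : ℝ) ≤ a := by positivity
  have hd2 : 2 * Real.log n + 2 < density [n, b, S, M] := by nlinarith
  have hd3 : 3 ≤ density [n, b, S, M] := by
    have : (2 : ℝ) < density [n, b, S, M] := by linarith
    exact_mod_cast this
  obtain ⟨hcapS, hgrpS⟩ := group_space (D := D) hM0 hSM16 hd3 (by omega) hS16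
  have hqS : familySize [n, b, S, M] ≤ S := by omega
  have hSa : S ≤ n ^ (a + 1) := hSn.trans (by rw [pow_succ']; exact Nat.mul_le_mul_right _ hCn)
  -- The family is no larger than `S ≤ n ^ (a + 1)`, and `density_large` provides `d / 2 ≥ (a + 1) *
  -- log n`.
  have hq : (familySize [n, b, S, M] : ℝ) ≤ Real.exp ((density [n, b, S, M] : ℝ) / 2) := by
    calc (familySize [n, b, S, M] : ℝ) ≤ ((n ^ (a + 1) : ℕ) : ℝ) := by exact_mod_cast hqS.trans hSa
      _ = Real.exp ((a + 1 : ℕ) * Real.log n) := by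
          rw [Real.exp_nat_mul, Real.exp_log (by positivity)]
          push_cast
          rfl
      _ ≤ _ := by
          refine Real.exp_le_exp.2 ?_
          push_cast
          nlinarith
  have hgood := fun X => family_spec (n := n) (nb := blocks [n, b, S, M])
    (fun j => Nat.lt_succ_of_le (Nat.div_le_div_right j.2.le)) hd2 hq X
  have htrim_b : trimSize [n, b, S, M] ≤ b := by
    rw [htrim]
    exact (Nat.pow_le_pow_right (by omega) (by norm_num)).trans (hd5.trans (min_le_left _ _))
  have htrim0 : 0 < trimSize [n, b, S, M] := by rw [htrim]; positivity
  have hdn : density [n, b, S, M] ≤ n :=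
    (Nat.le_self_pow (by norm_num) _).trans (hd5.trans ((min_le_left _ _).trans hbn))
  have hcap : n * b < capacity [n, b, S, M] * M := by
    have := Nat.lt_div_mul_add (a := n * b) hM0
    change n * b < (n * b / M + 1) * M
    rwa [add_mul, one_mul]
  have hgrp : n < groupSize [n, b, S, M] * M := by
    have := Nat.lt_div_mul_add (a := n) hM0
    change n < (n / M + 1) * M
    rwa [add_mul, one_mul]
  have hSM3 : S * M ≤ n ^ 3 := hSMn.trans (by
    calc C * (n * n) ≤ n * (n * n) := Nat.mul_le_mul_right _ hCn
      _ = n ^ 3 := by ring)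
  have hMSM : M ≤ S * M := Nat.le_mul_of_pos_left M (by omega)
  have hn3 : n ≤ n ^ 3 := Nat.le_self_pow (by norm_num) n
  have hbranch0 : 0 < branching [n, b, S, M] := by
    refine Nat.pos_of_ne_zero fun h => ?_
    rw [h, zero_pow (by omega)] at hbr
    omega
  have hn3T : n ^ 3 < T := by
    calc n ^ 3 < (n + 1) ^ 3 := Nat.pow_lt_pow_left (by omega) (by norm_num)
      _ ≤ T := Nat.pow_le_pow_right (by omega) (by omega)
  have hbig : (n + 1) * familySize [n, b, S, M] + n < T := by
    have h1 : (n + 1) * familySize [n, b, S, M] ≤ (n + 1) ^ (a + 2) := by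
      rw [pow_succ']
      exact Nat.mul_le_mul_left _ (hqS.trans (hSa.trans (Nat.pow_le_pow_left (by omega) _)))
    have h2 : n < (n + 1) ^ (a + 2) :=
      (Nat.lt_succ_self n).trans_le (Nat.le_self_pow (by omega) _)
    calc (n + 1) * familySize [n, b, S, M] + n < (n + 1) ^ (a + 2) * 2 := by omega
      _ ≤ (n + 1) ^ (a + 2) * (n + 1) := Nat.mul_le_mul_left _ (by omega)
      _ = (n + 1) ^ (a + 3) := by ring
      _ ≤ T := Nat.pow_le_pow_right (by omega) (by omega)
  have hqT : familySize [n, b, S, M] ≤ T := by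
    have := Nat.le_mul_of_pos_left (familySize [n, b, S, M]) (Nat.succ_pos n)
    have : familySize [n, b, S, M] ≤ (n + 1) * familySize [n, b, S, M] := this
    omega
  have key := exec_hitSets (p := [n, b, S, M]) (M := M) (S := S) (H := S / 2) (D := D) (T := T)
    (B := T ^ 8) (s := trimSize [n, b, S, M]) (br := branching) (dim := familySize)
    (cap := capacity) (trim := trimSize) (grp := groupSize) (pk := pickSet)
    hF hinp hlen rfl rfl rfl hbranch0 htrim0 hfam (Nat.succ_pos _) (Nat.succ_pos _)
    (by omega) (by omega) hcap.le hgrp.le le_rfl hcapS htrim0 htrim_b hgrpS (by omega) (by omega)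
    (by omega) hqT (by omega) (by omega) (by omega) hbig le_rfl hD0 (fun X hX => hgood X hX)
  obtain ⟨c', hc', L, hL1, hL2, Cs, hCs, hL3⟩ := key
  refine ⟨c', hc', L, hL1, hL2, min_rpow_le hd6 (by omega) (by omega) hdn ?_⟩
  calc L.card ≤ (Cs.toFinset.biUnion fun k =>
        Finset.univ.filter fun j : Fin n => pickSet [n, b, S, M] k j = true).card := by
        refine Finset.card_le_card fun j hj => ?_
        obtain ⟨k, hk, h⟩ := hL3 j hj
        exact Finset.mem_biUnion.2 ⟨k, List.mem_toFinset.2 hk, by simp [h]⟩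
    _ ≤ Cs.toFinset.card * (n / density [n, b, S, M] + 1) :=
        Finset.card_biUnion_le_card_mul _ _ _ fun k _ => hcard k
    _ ≤ D * (n / density [n, b, S, M] + 1) :=
        Nat.mul_le_mul_right _ ((List.toFinset_card_le Cs).trans hCs.le)

end MPC

theorem mainTheorem4 (δ : ℝ) (hδ : 0 < δ) :
    ∃ C₀ : ℝ, 0 < C₀ ∧ ∀ C₁ : ℝ, ∃ (A : MPC.Algorithm) (R W : ℕ) (K : ℝ),
      ∀ n b S M : ℕ, 1 ≤ b → b ≤ n → Real.log n ^ 10 ≤ b →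
        -- local space `S = Θ(n ^ δ)`, global space `S * M = Θ(n * b)`
        C₀ * (n : ℝ) ^ δ ≤ S → (S : ℝ) ≤ C₁ * (n : ℝ) ^ δ →
        C₀ * (n * b) ≤ (S : ℝ) * M → (S : ℝ) * M ≤ C₁ * (n * b) →
        ∀ F : Fin n → Finset (Fin n), (∀ i, (F i).card = b ∧ i ∈ F i) →
        ∀ inp : Fin M → List (Fin n × Fin n), Leaders.IsDistribution F inp →
          (∀ m, (Leaders.encode (inp m)).length ≤ S) →
          -- words of `O(log n)` bits, `R` rounds
          A.Respects [n, b, S, M] (fun m => Leaders.encode (inp m)) S ((n + 1) ^ W) R ∧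
          ∃ L : Finset (Fin n),
            Leaders.Outputs (A.run [n, b, S, M] (fun m => Leaders.encode (inp m)) R) L ∧
            (∀ i, (F i ∩ L).Nonempty) ∧
            (L.card : ℝ) ≤ K * (n * ((min b S : ℕ) : ℝ) ^ (-(1 / 5) : ℝ)) := by
  refine ⟨16, by norm_num, fun C₁ => ?_⟩
  have hC : C₁ ≤ (⌈C₁⌉₊ : ℕ) := Nat.le_ceil C₁
  have ha : δ ≤ (⌈δ⌉₊ : ℕ) := Nat.le_ceil δ
  have hD : 64 / δ ≤ (⌈64 / δ⌉₊ : ℕ) := Nat.le_ceil _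
  generalize (⌈C₁⌉₊ : ℕ) = C at hC
  generalize (⌈δ⌉₊ : ℕ) = a at ha
  generalize (⌈64 / δ⌉₊ : ℕ) = D at hD
  obtain ⟨n₀, hn₀⟩ := MPC.exists_threshold hδ C a D
  -- The factor `8` in the word length comes from `word_lt`. The summand `4 * D` pays for the `D`
  -- chosen sets, and `n₀` for the small inputs.
  refine ⟨MPC.ofList (MPC.leaders n₀ D) (MPC.primrec_leaders n₀ D), (MPC.leaders n₀ D).length,
    (C + a + 4) * 8, 4 * D + n₀, ?_⟩
  intro n b S M hb1 hbn hlb hS hS' hSM hSM' F hF inp hinp hlen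
  have hx : (0 : ℝ) ≤ n * ((min b S : ℕ) : ℝ) ^ (-(1 / 5) : ℝ) := by positivity
  suffices h : ∃ c', MPC.Exec [n, b, S, M] S ((n + 1) ^ ((C + a + 4) * 8)) (MPC.leaders n₀ D)
      (fun m => Leaders.encode (inp m)) c' ∧ ∃ L : Finset (Fin n), Leaders.Outputs c' L ∧
        (∀ i, (F i ∩ L).Nonempty) ∧
        (L.card : ℝ) ≤ (4 * D + n₀) * (n * ((min b S : ℕ) : ℝ) ^ (-(1 / 5) : ℝ)) by
    obtain ⟨c', hc', hL⟩ := h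
    obtain ⟨h1, h2⟩ := hc'.respects (MPC.primrec_leaders n₀ D)
    exact ⟨h1, by rw [h2]; exact hL⟩
  rw [pow_mul]
  rcases lt_or_ge n n₀ with hn | hn
  · obtain ⟨-, hSMn⟩ := MPC.resource_bounds hC ha (by omega) hbn hS' hSM'
    have hnT : n + 1 ≤ (n + 1) ^ (C + a + 4) := Nat.le_self_pow (by omega) _
    have hT : S * M ≤ (n + 1) ^ (C + a + 4) := by
      calc S * M ≤ (n + 1) ^ C * ((n + 1) * (n + 1)) :=
            hSMn.trans (Nat.mul_le_mul (MPC.natCast_le_pow (by omega))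
              (Nat.mul_le_mul (by omega) (by omega)))
        _ = (n + 1) ^ (C + 2) := by ring
        _ ≤ _ := Nat.pow_le_pow_right (by omega) (by omega)
    have h := MPC.exec_keepDiag (p := [n, b, S, M]) (fun i => (hF i).2) hinp hlen rfl
      (by omega : n ≤ (n + 1) ^ (C + a + 4)) hT (by omega) le_rfl
    obtain ⟨c', hc', hout⟩ := h
    refine ⟨c', MPC.exec_leaders_of_lt hn hc', Finset.univ, hout,
      fun i => ⟨i, by simp [(hF i).2]⟩, ?_⟩
    have hn1 : (1 : ℝ) ≤ n := by exact_mod_cast hb1.trans hbn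
    have hS0 : 0 < S := by
      have : (0 : ℝ) < S := lt_of_lt_of_le (by positivity) hS
      exact_mod_cast this
    have hm0 : (0 : ℝ) < (min b S : ℕ) := by exact_mod_cast lt_min hb1 hS0
    -- For `n < n₀` the whole set is output. As `m = min b S` satisfies `1 ≤ m ≤ n₀`, the inequality
    -- follows from `1 ≤ m ^ (4 / 5) = m * m ^ (-1 / 5)`.
    have hm : (1 : ℝ) ≤ n₀ * ((min b S : ℕ) : ℝ) ^ (-(1 / 5) : ℝ) := by
      have h1 : ((min b S : ℕ) : ℝ) ≤ n₀ := by
        exact_mod_cast (min_le_left b S).trans (hbn.trans hn.le)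
      calc (1 : ℝ) ≤ ((min b S : ℕ) : ℝ) ^ (4 / 5 : ℝ) :=
            Real.one_le_rpow (by exact_mod_cast hm0) (by norm_num)
        _ = ((min b S : ℕ) : ℝ) * ((min b S : ℕ) : ℝ) ^ (-(1 / 5) : ℝ) := by
            rw [← Real.rpow_one_add' hm0.le (by norm_num)]
            norm_num
        _ ≤ _ := by gcongr
    calc ((Finset.univ : Finset (Fin n)).card : ℝ) = n * 1 := by simp
      _ ≤ n * (n₀ * ((min b S : ℕ) : ℝ) ^ (-(1 / 5) : ℝ)) := by gcongr
      _ = n₀ * (n * ((min b S : ℕ) : ℝ) ^ (-(1 / 5) : ℝ)) := by ring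
      _ ≤ _ := by
          refine mul_le_mul_of_nonneg_right ?_ hx
          have : (0 : ℝ) ≤ D := by positivity
          linarith
  · obtain ⟨hCn, hn2, hDn, hx2, hDδ, hl, hlδ⟩ := hn₀ n hn
    have h := MPC.exec_large hδ hC ha hD hCn hn2 hDn hx2 hDδ hl hlδ hb1 hbn hlb hS hS' hSM hSM'
      (fun i => (hF i).1) hinp hlen
    obtain ⟨c', hc', L, h1, h2, h3⟩ := h
    refine ⟨c', MPC.exec_leaders_of_le hn hc', L, h1, h2, h3.trans ?_⟩
    refine mul_le_mul_of_nonneg_right ?_ hx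
    have : (0 : ℝ) ≤ n₀ := by positivity
    linarith
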